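/- Let $d \ge 1$ be an integer and let $\alpha \in (1,2)$. Let $\nu_\alpha$ be an $\alpha$-stable Lévy measure on $\mathbb{R}^d$, i.e. a positive Borel measure with $\nu_\alpha(\{0\})=0$, $\int_{\mathbb{R}^d}(1\wedge\|u\|^2)\,\nu_\alpha(du)<+\infty$ and $c^{-\alpha}\nu_\alpha(B/c)=\nu_\alpha(B)$ for all $c>0$ and all Borel $B\subset\mathbb{R}^d$. Let $\sigma$ be its spherical part, i.e. the unique finite measure on the unit sphere $\mathbb{S}^{d-1}$ such that $\nu_\alpha(du)=\mathbf{1}_{(0,+\infty)}(r)\,\mathbf{1}_{\mathbb{S}^{d-1}}(y)\,\frac{dr}{r^{\alpha+1}}\,\sigma(dy)$ for $u=ry$, and let $$\lambda_1=-\cos\left(\frac{\alpha\pi}{2}\right)\frac{\Gamma(2-\alpha)}{\alpha(\alpha-1)}\,\sigma,\qquad \sigma_\alpha(\xi)=\left(\int_{\mathbb{S}^{d-1}}|\langle y;\xi\rangle|^\alpha\,\lambda_1(dy)\right)^{1/\alpha},\quad \xi\in\mathbb{R}^d.$$ Assume that $\nu_\alpha$ is symmetric, i.e. $\sigma(B)=\sigma(-B)$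 for all Borel $B\subset\mathbb{S}^{d-1}$, and non-degenerate, i.e. $\inf_{y\in\mathbb{S}^{d-1}}\int_{\mathbb{S}^{d-1}}|\langle y;x\rangle|^\alpha\,\lambda_1(dx)>0$. Let $\mu_\alpha$ be the probability measure on $\mathbb{R}^d$ with $$\int_{\mathbb{R}^d} e^{i\langle y;\xi\rangle}\mu_\alpha(dy)=\exp\left(\int_{\mathbb{R}^d}\left(e^{i\langle u;\xi\rangle}-1-i\langle\xi;u\rangle\right)\nu_\alpha(du)\right),\qquad \xi\in\mathbb{R}^d,$$ and let $Y_\alpha$ be a real random variable with $\mathbb{E}\,e^{i\xi Y_\alpha}=e^{-|\xi|^\alpha}$ for all $\xi\in\mathbb{R}$. For $t>0$, set $$P_t^\alpha(f)(x)=\int_{\mathbb{R}^d} f(x+t^{1/\alpha}y)\,\mu_\alpha(dy),\qquad D^{\alpha-1}(f)(x)=\int_{\mathbb{R}^d}(f(x+u)-f(x))\,u\,\nu_\alpha(du).$$ Then $\mu_\alpha$ has a positive continuously differentiable Lebesgue density $p_\alpha$, the constants $$C^1_{\alpha,d}=\left(\frac{1}{2(\alpha-1)}(2d)^{\frac{\alpha-1}{d+\alpha-1}}+\left(\frac{1}{2d}\right)^{\frac{d}{d+\alpha-1}}\right)^{\frac{d+\alpha-1}{d}}2^{\frac{\alpha-1}{\alpha}}\,\|p_\alpha\|_\infty^{\frac{\alpha-1}{d}}\,\|\nabla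 p_\alpha\|_{L^1(\mathbb{R}^d,dx)},$$ $$C^2_{\alpha,d}=\left(\frac12(2d)^{\frac{1}{d+1}}+\frac{1}{(2d)^{\frac{d}{d+1}}}\right)^{\frac{d+1}{d}}2^{\frac1\alpha}\,\|p_\alpha\|_\infty^{\frac1d}\;\mathbb{E}|Y_\alpha|$$ are finite, and for every Borel set $E\subset\mathbb{R}^d$ with Lebesgue measure $\mathcal{L}_d(E)<+\infty$ the limits $$\mathcal{P}_{\mathrm{frac}}(E)=\lim_{t\to0^+}\|D^{\alpha-1}P_t^\alpha(\mathbf{1}_E)\|_{L^1(\mathbb{R}^d,dx)},\qquad \mathcal{P}_{\mathrm{cl}}(E)=\lim_{t\to0^+}\|\sigma_\alpha(\nabla P_t^\alpha(\mathbf{1}_E))\|_{L^1(\mathbb{R}^d,dx)}$$ exist in $[0,+\infty]$ and satisfy $$\mathcal{L}_d(E)^{\frac{d-(\alpha-1)}{d}}\le C^1_{\alpha,d}\,\mathcal{P}_{\mathrm{frac}}(E),\qquad \mathcal{L}_d(E)^{\frac{d-1}{d}}\le C^2_{\alpha,d}\,\mathcal{P}_{\mathrm{cl}}(E),$$ where the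 second inequality is claimed for $d\ge2$, or for $d=1$ and $\mathcal{L}_1(E)>0$. -/

import Mathlib

open MeasureTheory Set Filter Topology
open scoped ENNReal

noncomputable section

/-- The Euclidean space `ℝ^d`. -/
abbrev RSpace (d : ℕ) : Type := EuclideanSpace ℝ (Fin d)

/-- The Euclidean unit sphere `𝕊^{d-1}` of `ℝ^d`. -/
abbrev USphere (d : ℕ) : Type := Metric.sphere (0 : RSpace d) 1

/-! ### Stable Lévy measures -/

/-- `ν` is an `α`-stable Lévy measure on `ℝ^d`: it does not charge the origin,
`∫ (1 ∧ ‖u‖²) ν(du) < ∞`, and `c^{-α} T_c(ν) = ν` for all `c > 0`, where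
`T_c(ν)(B) = ν(B / c)` is the image of `ν` under `u ↦ c u`. -/
structure IsStableLevyMeasure {d : ℕ} (α : ℝ) (ν : Measure (RSpace d)) : Prop where
  zero : ν {0} = 0
  lintegral_lt_top : ∫⁻ u, ENNReal.ofReal (min 1 (‖u‖ ^ 2)) ∂ν < ∞
  scale : ∀ c : ℝ, 0 < c → ENNReal.ofReal (c ^ (-α)) • ν.map (fun u => c • u) = ν

/-- The measure `1_{(0,∞)}(r) 1_{𝕊^{d-1}}(y) r^{-(α+1)} dr σ(dy)` in polar coordinates `u = r y`. -/
def polarMeasure {d : ℕ} (α : ℝ) (σ : Measure (USphere d)) : Measure (RSpace d) :=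
  (((volume.restrict (Ioi (0 : ℝ))).withDensity
    (fun r => ENNReal.ofReal (r ^ (-(α + 1))))).prod σ).map (fun q => q.1 • (q.2 : RSpace d))

/-- The spherical part `σ` of a stable Lévy measure `ν`,
`σ(B) = α ν({u : ‖u‖ > 1, u / ‖u‖ ∈ B})`. The two facts `polarMeasure_sphericalPart` and
`sphericalPart_polarMeasure` below say that it is the one and only finite measure on the sphere
with `ν(du) = 1_{(0,∞)}(r) 1_{𝕊^{d-1}}(y) r^{-(α+1)} dr σ(dy)`. -/
def sphericalPart {d : ℕ} (α : ℝ) (ν : Measure (RSpace d)) : Measure (USphere d) :=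
  (ENNReal.ofReal α • (ν.restrict {u | 1 < ‖u‖}).map (fun u => ‖u‖⁻¹ • u)).comap Subtype.val

theorem sphericalPart_apply {d : ℕ} (α : ℝ) (ν : Measure (RSpace d)) {B : Set (USphere d)}
    (hB : MeasurableSet B) :
    sphericalPart α ν B =
      ENNReal.ofReal α * ν {u | 1 < ‖u‖ ∧ ‖u‖⁻¹ • u ∈ ((↑) : USphere d → RSpace d) '' B} := by
  have he : MeasurableEmbedding ((↑) : USphere d → RSpace d) :=
    MeasurableEmbedding.subtype_coe (Metric.isClosed_sphere.measurableSet)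
  have hm : Measurable (fun u : RSpace d => ‖u‖⁻¹ • u) := by fun_prop
  have hB' := he.measurableSet_image.2 hB
  rw [sphericalPart, he.comap_apply, Measure.smul_apply, Measure.map_apply hm hB',
    Measure.restrict_apply (hm hB'), smul_eq_mul]
  congr 2
  ext u
  simp [and_comm]

/-- The radial measure `r^{-(α+1)} dr` on `(0,∞)`. -/
def radialMeasure (α : ℝ) : Measure (Ioi (0 : ℝ)) :=
  ((volume.restrict (Ioi (0 : ℝ))).withDensity
    (fun r => ENNReal.ofReal (r ^ (-(α + 1))))).comap Subtype.val

theorem radialMeasure_Ioi {α : ℝ} (hα : 0 < α) (r : Ioi (0 : ℝ)) :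
    radialMeasure α (Ioi r) = ENNReal.ofReal ((r : ℝ) ^ (-α) / α) := by
  have he : MeasurableEmbedding ((↑) : Ioi (0 : ℝ) → ℝ) :=
    MeasurableEmbedding.subtype_coe measurableSet_Ioi
  have hr : (0 : ℝ) < r := r.2
  have himg : ((↑) : Ioi (0 : ℝ) → ℝ) '' Ioi r = Ioi (r : ℝ) := by
    ext s
    constructor
    · rintro ⟨s, hs, rfl⟩
      exact hs
    · intro hs
      exact ⟨⟨s, hr.trans hs⟩, hs, rfl⟩
  rw [radialMeasure, he.comap_apply, himg, withDensity_apply _ measurableSet_Ioi,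
    Measure.restrict_restrict measurableSet_Ioi,
    inter_eq_left.2 (Ioi_subset_Ioi hr.le),
    ← ofReal_integral_eq_lintegral_ofReal (integrableOn_Ioi_rpow_of_lt (by linarith) hr)
      ((ae_restrict_mem measurableSet_Ioi).mono
        fun s hs => Real.rpow_nonneg (hr.trans hs).le _),
    integral_Ioi_rpow_of_lt (by linarith) hr]
  congr 1
  have : -(α + 1) + 1 = -α := by ring
  rw [this, neg_div_neg_eq]

/-- The sets `(1/(n+1), ∞)` cover `(0, ∞)` and have finite radial measure. -/
def radialMeasureSpanning {α : ℝ} (hα : 0 < α) :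
    (radialMeasure α).FiniteSpanningSetsIn (range Ioi) where
  set n := Ioi ⟨1 / ((n : ℝ) + 1), mem_Ioi.2 Nat.one_div_pos_of_nat⟩
  set_mem n := mem_range_self _
  finite n := by
    rw [radialMeasure_Ioi hα]
    exact ENNReal.ofReal_lt_top
  spanning := by
    refine eq_univ_of_forall fun x => mem_iUnion.2 ?_
    obtain ⟨n, hn⟩ := exists_nat_one_div_lt (mem_Ioi.1 x.2)
    exact ⟨n, hn⟩

theorem isFiniteMeasure_sphericalPart {d : ℕ} {α : ℝ} {ν : Measure (RSpace d)}
    (hν : IsStableLevyMeasure α ν) : IsFiniteMeasure (sphericalPart α ν) := by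
  refine ⟨?_⟩
  rw [sphericalPart_apply α ν MeasurableSet.univ]
  refine ENNReal.mul_lt_top ENNReal.ofReal_lt_top (lt_of_le_of_lt ?_ hν.lintegral_lt_top)
  calc ν {u | 1 < ‖u‖ ∧ ‖u‖⁻¹ • u ∈ ((↑) : USphere d → RSpace d) '' univ}
      ≤ ν {u | 1 ≤ ENNReal.ofReal (min 1 (‖u‖ ^ 2))} := by
        refine measure_mono fun u hu => ?_
        have h1 : 1 < ‖u‖ := hu.1
        have : min 1 (‖u‖ ^ 2) = 1 := min_eq_left (by nlinarith)
        rw [mem_ofPred_eq, this, ENNReal.ofReal_one]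
    _ ≤ _ := by
        have := mul_meas_ge_le_lintegral (μ := ν)
          (f := fun u => ENNReal.ofReal (min 1 (‖u‖ ^ 2))) (by fun_prop) 1
        simpa using this

/-- The map `(r, y) ↦ r y` in polar coordinates. -/
def polarMap (d : ℕ) (q : Ioi (0 : ℝ) × USphere d) : RSpace d := (q.1 : ℝ) • (q.2 : RSpace d)

theorem polarMap_embedding (d : ℕ) : MeasurableEmbedding (polarMap d) := by
  have h1 : MeasurableEmbedding ((↑) : ({0}ᶜ : Set (RSpace d)) → RSpace d) :=
    MeasurableEmbedding.subtype_coe (measurableSet_singleton 0).compl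
  exact (h1.comp (homeomorphUnitSphereProd (RSpace d)).symm.measurableEmbedding).comp
    MeasurableEquiv.prodComm.measurableEmbedding

theorem range_polarMap (d : ℕ) : range (polarMap d) = {0}ᶜ := by
  ext u
  constructor
  · rintro ⟨q, rfl⟩
    have h1 : (q.1 : ℝ) ≠ 0 := (q.1.2 : (0 : ℝ) < q.1).ne'
    have h2 : (q.2 : RSpace d) ≠ 0 := ne_zero_of_mem_unit_sphere q.2
    simp [polarMap, h1, h2]
  · intro hu
    have hu' : u ≠ 0 := hu
    refine ⟨(⟨‖u‖, norm_pos_iff.2 hu'⟩, ⟨‖u‖⁻¹ • u, by simp [norm_smul, hu']⟩), ?_⟩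
    simp [polarMap, smul_smul, hu']

theorem polarMap_image {d : ℕ} (r : Ioi (0 : ℝ)) (B : Set (USphere d)) :
    polarMap d '' (Ioi r ×ˢ B) =
      {u | (r : ℝ) < ‖u‖ ∧ ‖u‖⁻¹ • u ∈ ((↑) : USphere d → RSpace d) '' B} := by
  have hr : (0 : ℝ) < r := r.2
  ext u
  constructor
  · rintro ⟨⟨s, y⟩, ⟨hs, hy⟩, rfl⟩
    have hs0 : (0 : ℝ) < s := s.2
    have hn : ‖(s : ℝ) • (y : RSpace d)‖ = s := by simp [norm_smul, abs_of_pos hs0]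
    refine ⟨lt_of_lt_of_eq hs hn.symm, y, hy, ?_⟩
    simp only [polarMap]
    rw [hn, smul_smul, inv_mul_cancel₀ hs0.ne', one_smul]
  · rintro ⟨hu, y, hy, hyu⟩
    have hu0 : 0 < ‖u‖ := hr.trans hu
    refine ⟨(⟨‖u‖, hu0⟩, y), ⟨hu, hy⟩, ?_⟩
    simp only [polarMap]
    rw [hyu, smul_smul, mul_inv_cancel₀ hu0.ne', one_smul]

theorem polarMeasure_eq_map {d : ℕ} {α : ℝ} (hα : 0 < α) (σ : Measure (USphere d)) [IsFiniteMeasure σ] :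
    polarMeasure α σ = ((radialMeasure α).prod σ).map (polarMap d) := by
  have he : MeasurableEmbedding ((↑) : Ioi (0 : ℝ) → ℝ) :=
    MeasurableEmbedding.subtype_coe measurableSet_Ioi
  have hrad : (volume.restrict (Ioi (0 : ℝ))).withDensity
      (fun r => ENNReal.ofReal (r ^ (-(α + 1)))) = (radialMeasure α).map (↑) := by
    rw [radialMeasure, he.map_comap, Subtype.range_coe,
      restrict_withDensity measurableSet_Ioi, Measure.restrict_restrict measurableSet_Ioi,
      inter_self]
  have : SigmaFinite (radialMeasure α) := (radialMeasureSpanning hα).sigmaFinite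
  rw [polarMeasure, hrad]
  conv_lhs => rw [← Measure.map_id (μ := σ)]
  rw [Measure.map_prod_map _ _ he.measurable measurable_id,
    Measure.map_map (by fun_prop) (by fun_prop)]
  rfl

/-- Every stable Lévy measure is given in polar coordinates by its spherical part. -/
theorem polarMeasure_sphericalPart {d : ℕ} {α : ℝ} (hα : 0 < α) {ν : Measure (RSpace d)}
    (hν : IsStableLevyMeasure α ν) : polarMeasure α (sphericalPart α ν) = ν := by
  have := isFiniteMeasure_sphericalPart hν
  have key : (radialMeasure α).prod (sphericalPart α ν) = ν.comap (polarMap d) := by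
    refine Measure.prod_eq_generateFrom (C := range Ioi) (D := {s | MeasurableSet s}) ?_ ?_
      isPiSystem_Ioi MeasurableSpace.isPiSystem_measurableSet ?_
      (sphericalPart α ν).toFiniteSpanningSetsIn ?_
    · rw [← borel_eq_generateFrom_Ioi]
      exact (BorelSpace.measurable_eq).symm
    · exact MeasurableSpace.generateFrom_measurableSet
    · exact radialMeasureSpanning hα
    · rintro _ ⟨r, rfl⟩ B hB
      have hr : (0 : ℝ) < r := r.2
      have hB : MeasurableSet B := hB
      rw [(polarMap_embedding d).comap_apply, radialMeasure_Ioi hα, sphericalPart_apply α ν hB,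
        ← mul_assoc, ← ENNReal.ofReal_mul (by positivity), div_mul_cancel₀ _ hα.ne']
      conv_lhs => rw [← hν.scale r hr]
      rw [Measure.smul_apply, smul_eq_mul, Measure.map_apply (by fun_prop)
        ((polarMap_embedding d).measurableSet_image.2 (measurableSet_Ioi.prod hB)),
        polarMap_image]
      congr 2
      ext u
      have h1 : ‖(r : ℝ) • u‖ = r * ‖u‖ := by rw [norm_smul, Real.norm_of_nonneg hr.le]
      have h2 : ‖(r : ℝ) • u‖⁻¹ • (r : ℝ) • u = ‖u‖⁻¹ • u := by
        rw [h1, smul_smul, mul_inv, mul_right_comm, inv_mul_cancel₀ hr.ne', one_mul]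
      simp only [mem_preimage, mem_ofPred_eq]
      rw [h2, h1, lt_mul_iff_one_lt_right hr]
  rw [polarMeasure_eq_map hα, key, (polarMap_embedding d).map_comap, range_polarMap,
    Measure.restrict_eq_self_of_ae_mem]
  rw [ae_iff]
  simpa using hν.zero

/-- The finite measure on the sphere in a polar decomposition is unique. -/
theorem sphericalPart_polarMeasure {d : ℕ} {α : ℝ} (hα : 0 < α) (σ : Measure (USphere d))
    [IsFiniteMeasure σ] : sphericalPart α (polarMeasure α σ) = σ := by
  ext B hB
  have h := polarMap_image (d := d) ⟨1, mem_Ioi.2 one_pos⟩ B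
  have : SigmaFinite (radialMeasure α) := (radialMeasureSpanning hα).sigmaFinite
  rw [sphericalPart_apply α _ hB, ← h, polarMeasure_eq_map hα, (polarMap_embedding d).map_apply,
    preimage_image_eq _ (polarMap_embedding d).injective, Measure.prod_prod,
    radialMeasure_Ioi hα, ← mul_assoc, ← ENNReal.ofReal_mul hα.le]
  simp [hα.ne']

/-- `ν` is symmetric: `σ(B) = σ(-B)` for all Borel subsets `B` of the sphere. -/
def IsSymmetricLevy {d : ℕ} (α : ℝ) (ν : Measure (RSpace d)) : Prop :=
  ∀ B : Set (USphere d), MeasurableSet B →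
    sphericalPart α ν B = sphericalPart α ν ((fun y => -y) ⁻¹' B)

/-- The spectral measure `λ₁ = - cos (α π / 2) Γ(2 - α) / (α (α - 1)) σ`. -/
def spectralMeasure {d : ℕ} (α : ℝ) (ν : Measure (RSpace d)) : Measure (USphere d) :=
  ENNReal.ofReal (-Real.cos (α * (Real.pi / 2)) * (Real.Gamma (2 - α) / (α * (α - 1)))) •
    sphericalPart α ν

/-- `ν` is non-degenerate: `inf_{y ∈ 𝕊^{d-1}} ∫ |⟨y ; x⟩|^α λ₁(dx) > 0`. -/
def IsNondegenerateLevy {d : ℕ} (α : ℝ) (ν : Measure (RSpace d)) : Prop :=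
  0 < ⨅ y : USphere d,
    ∫ x : USphere d, |inner ℝ (y : RSpace d) (x : RSpace d)| ^ α ∂(spectralMeasure α ν)

/-- The norm `σ_α(ξ) = (∫ |⟨y ; ξ⟩|^α λ₁(dy))^{1/α}`. -/
def sigmaNorm {d : ℕ} (α : ℝ) (ν : Measure (RSpace d)) (ξ : RSpace d) : ℝ :=
  (∫ y : USphere d, |inner ℝ (y : RSpace d) ξ| ^ α ∂(spectralMeasure α ν)) ^ (1 / α)

/-- `μ` is the stable probability measure with Lévy measure `ν`:
`∫ e^{i⟨y;ξ⟩} μ(dy) = exp (∫ (e^{i⟨u;ξ⟩} - 1 - i⟨ξ;u⟩) ν(du))` for all `ξ`. -/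
def IsStableLaw {d : ℕ} (ν μ : Measure (RSpace d)) : Prop :=
  IsProbabilityMeasure μ ∧ ∀ ξ : RSpace d,
    ∫ y, Complex.exp (Complex.I * (inner ℝ y ξ : ℝ)) ∂μ =
      Complex.exp (∫ u, (Complex.exp (Complex.I * (inner ℝ u ξ : ℝ)) - 1
        - Complex.I * (inner ℝ ξ u : ℝ)) ∂ν)

/-! ### The semigroup, the fractional gradient and the perimeters -/

/-- The stable heat semigroup `P_t^α(f)(x) = ∫ f(x + t^{1/α} y) μ_α(dy)`. -/
def stableSemigroup {d : ℕ} (α : ℝ) (μ : Measure (RSpace d)) (t : ℝ) (f : RSpace d → ℝ)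
    (x : RSpace d) : ℝ :=
  ∫ y, f (x + t ^ (1 / α) • y) ∂μ

/-- The fractional gradient `D^{α-1}(f)(x) = ∫ (f(x + u) - f(x)) u ν_α(du)`. -/
def fracGradient {d : ℕ} (ν : Measure (RSpace d)) (f : RSpace d → ℝ) (x : RSpace d) : RSpace d :=
  ∫ u, (f (x + u) - f x) • u ∂ν

/-- `‖D^{α-1} P_t^α(1_E)‖_{L¹(ℝ^d, dx)}`, with values in `[0, ∞]`. -/
def fracVariation {d : ℕ} (α : ℝ) (ν μ : Measure (RSpace d)) (E : Set (RSpace d)) (t : ℝ) : ℝ≥0∞ :=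
  ∫⁻ x, ‖fracGradient ν (stableSemigroup α μ t (E.indicator (fun _ => (1 : ℝ)))) x‖ₑ

/-- `‖σ_α(∇ P_t^α(1_E))‖_{L¹(ℝ^d, dx)}`, with values in `[0, ∞]`. -/
def classVariation {d : ℕ} (α : ℝ) (ν μ : Measure (RSpace d)) (E : Set (RSpace d)) (t : ℝ) :
    ℝ≥0∞ :=
  ∫⁻ x, ‖sigmaNorm α ν (gradient (stableSemigroup α μ t (E.indicator (fun _ => (1 : ℝ)))) x)‖ₑ

/-- The fractional perimeter `P_frac(E) = lim_{t → 0⁺} ‖D^{α-1} P_t^α(1_E)‖_{L¹}`. -/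
def fracPerimeter {d : ℕ} (α : ℝ) (ν μ : Measure (RSpace d)) (E : Set (RSpace d)) : ℝ≥0∞ :=
  limUnder (𝓝[>] (0 : ℝ)) (fracVariation α ν μ E)

/-- The classical perimeter `P_cl(E) = lim_{t → 0⁺} ‖σ_α(∇ P_t^α(1_E))‖_{L¹}`. -/
def classPerimeter {d : ℕ} (α : ℝ) (ν μ : Measure (RSpace d)) (E : Set (RSpace d)) : ℝ≥0∞ :=
  limUnder (𝓝[>] (0 : ℝ)) (classVariation α ν μ E)

/-! ### The constants -/

/-- The constant `C¹_{α,d}`, a function of the density `p = p_α`. -/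
def isoConstFrac {d : ℕ} (α : ℝ) (p : RSpace d → ℝ) : ℝ≥0∞ :=
  ENNReal.ofReal
      ((1 / (2 * (α - 1)) * (2 * d) ^ ((α - 1) / (d + α - 1))
        + (1 / (2 * d)) ^ ((d : ℝ) / (d + α - 1))) ^ ((d + α - 1) / d)
        * 2 ^ ((α - 1) / α))
    * (⨆ x, ‖p x‖ₑ) ^ ((α - 1) / d) * ∫⁻ x, ‖gradient p x‖ₑ

/-- The constant `C²_{α,d}`, a function of the density `p = p_α` and of `m = 𝔼 |Y_α|`. -/
def isoConstClass {d : ℕ} (α : ℝ) (p : RSpace d → ℝ) (m : ℝ≥0∞) : ℝ≥0∞ :=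
  ENNReal.ofReal
      ((1 / 2 * (2 * d) ^ ((1 : ℝ) / (d + 1))
        + 1 / (2 * d) ^ ((d : ℝ) / (d + 1))) ^ (((d : ℝ) + 1) / d)
        * 2 ^ (1 / α))
    * (⨆ x, ‖p x‖ₑ) ^ ((1 : ℝ) / d) * m

end

/-! Let `P_t` be the stable semigroup, `M = sup p`, `v` the volume of `E`, and `Ψ(ξ) = ∫ (1 - cos ⟨u
; ξ⟩) ν(du)`, so that `Ψ = σ_α ^ α` and `μ` has characteristic function `exp (-Ψ)`. The semigroup
preserves integrals, so the `L¹` distance from `1_E` to `P_t 1_E` is `2 (v - ∫_E P_t 1_E)`. The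
kernel of `P_t` is at most `M t ^ (-d/α)`, hence `∫_E P_t 1_E ≤ M t ^ (-d/α) v ^ 2`. An upper bound
`t ^ (θ/α) / θ * Q` for the `L¹` distance therefore gives `2 v ≤ 2 M t ^ (-d/α) v ^ 2 + t ^ (θ/α) /
θ * Q` for all `t`, and the best `t` gives the isoperimetric inequality of exponent `(d - θ) / d`
(`two_mul_volume_le`, `rpow_le_of_forall_scale`). In practice `1_E` is replaced by `P_s 1_E` and `s`
tends to `0`.

Two such bounds are needed. For the classical perimeter (`θ = 1`), an increment in direction `y`
costs at most the `L¹` norm of the directional derivative, and averaging over the stable law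
produces `σ_α(∇) 𝔼|Y|`, because `⟨X ; ξ⟩` has the law of `σ_α(ξ) Y`. For the fractional one (`θ = α
- 1`), Duhamel's formula writes `g - P_t g` as the integral over `r ≤ t` of `Ψ(D) P_r g`. Since `Ψ`
is homogeneous of degree `α`, Euler's identity says that `α Ψ` is, up to sign, the symbol of the
divergence of `D^{α-1}`. Moving the divergence onto the kernel leaves `∇p` against `D^{α-1} g`, at
the cost of `r ^ (-1/α) / α`, which is integrable at `0` because `α > 1`.

Both variations decrease in `t`, since `∇` and `D^{α-1}` commute with averages of translates and
such averages contract `L¹`. So the limits at `0⁺` exist and are suprema.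

Nondegeneracy makes `exp (-Ψ)` decay fast, which gives a bounded `C¹` density. Positivity spreads
from the origin by self-similarity and the convolution identity `p_1 = p_{1/2} ∗ p_{1/2}`. The
integrability of `∇p` is more delicate, since `p` has heavy tails. The small jumps have a density
`q` with exponential moments, as a limit of compound Poisson laws. A nonnegative function with
Lipschitz gradient satisfies `|∇q|² ≤ C q`, so `∇q` is integrable; convolving with the law of the
large jumps keeps this (`exists_smallJump_density`, `lintegral_gradient_stableDensity_lt_top`). -/

noncomputable section

/-! ### Densities obtained by Fourier inversion from limits of characteristic functions -/

section FourierDensity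

open scoped FourierTransform ContDiff Convolution InnerProductSpace

set_option linter.unusedSectionVars false

variable {E : Type*} [NormedAddCommGroup E] [InnerProductSpace ℝ E] [FiniteDimensional ℝ E]
  [MeasurableSpace E] [BorelSpace E]

/-- Reconciles two normalisations: `𝓕` has kernel `e^{-2πi⟨x;ξ⟩}` and `charFun` has `e^{i⟨x;ξ⟩}`.
All later factors `± 2π` come from here. -/
theorem fourierIntegral_one_eq_charFun (m : Measure E) (ξ : E) :
    VectorFourier.fourierIntegral Real.fourierChar m (innerₗ E) (1 : E → ℂ) ξ =
      charFun m (-(2 * Real.pi) • ξ) := by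
  rw [charFun_eq_fourierIntegral', smul_smul]
  congr 1
  rw [neg_mul_neg, inv_mul_cancel₀ (by positivity), one_smul]

/-- The integral of a Fourier transform against a finite measure. -/
theorem integral_fourier_measure (m : Measure E) [IsFiniteMeasure m] {g : E → ℂ}
    (hg : Integrable g) :
    ∫ y, 𝓕 g y ∂m = ∫ ξ, g ξ * charFun m (-(2 * Real.pi) • ξ) := by
  have h := VectorFourier.integral_bilin_fourierIntegral_eq_flip (μ := (volume : Measure E))
    (ν := m) (L := innerₗ E) (e := Real.fourierChar) (f := g) (g := (1 : E → ℂ))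
    (ContinuousLinearMap.mul ℂ ℂ) Real.continuous_fourierChar continuous_inner hg
    (integrable_const 1)
  rw [flip_innerₗ] at h
  simp only [fourierIntegral_one_eq_charFun] at h
  simpa using! h

theorem integrable_fourierChar_mul {h : E → ℂ} (hh : Integrable h) (x : E) :
    Integrable (fun ξ => (Real.fourierChar (-inner ℝ ξ x) : ℂ) * h ξ) := by
  have := (Real.fourierIntegral_convergent_iff (μ := volume) (f := h) x).2 hh
  simpa [Circle.smul_def] using this

/-- The Fourier transform of `h m̂` is an average of translates of the Fourier transform of `h`. -/
theorem fourier_mul_charFun (m : Measure E) [IsFiniteMeasure m] {h : E → ℂ}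
    (hh : Integrable h) (x : E) :
    𝓕 (fun ξ => h ξ * charFun m (-(2 * Real.pi) • ξ)) x = ∫ y, 𝓕 h (x + y) ∂m := by
  -- Modulating `h` by the character at `x` translates its transform by `x`.
  have h1 := integral_fourier_measure m (integrable_fourierChar_mul hh x)
  have h2 : ∀ y, 𝓕 (fun ξ => (Real.fourierChar (-inner ℝ ξ x) : ℂ) * h ξ) y = 𝓕 h (x + y) := by
    intro y
    simp only [Real.fourier_eq, Circle.smul_def, smul_eq_mul]
    refine integral_congr_ae (ae_of_all _ fun ξ => ?_)
    simp only [inner_add_right, neg_add, AddChar.map_add_eq_mul, Circle.coe_mul]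
    ring
  simp only [h2] at h1
  rw [h1, Real.fourier_eq]
  refine integral_congr_ae (ae_of_all _ fun ξ => ?_)
  simp only [Circle.smul_def, smul_eq_mul]
  ring

/-- Parseval: `f` is the transform of a Schwartz function, so its integrals against `m n` are
integrals of characteristic functions against that function, and these are bounded by one. Dominated
convergence suffices; no tightness enters. -/
theorem tendsto_integral_of_tendsto_charFun {m : ℕ → Measure E} [∀ n, IsProbabilityMeasure (m n)]
    {h : E → ℂ} (hh : Integrable h)
    (hm : ∀ ξ, Tendsto (fun n => charFun (m n) ((2 * Real.pi) • ξ)) atTop (𝓝 (h ξ)))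
    {f : E → ℝ} (hf : ContDiff ℝ ∞ f) (hfs : HasCompactSupport f) :
    Tendsto (fun n => ((∫ x, f x ∂(m n) : ℝ) : ℂ)) atTop (𝓝 (∫ x, (f x : ℂ) * 𝓕 h x)) := by
  have hF : ContDiff ℝ ∞ (fun x => (f x : ℂ)) := Complex.ofRealCLM.contDiff.comp hf
  have hFs : HasCompactSupport (fun x => (f x : ℂ)) :=
    hfs.comp_left (g := fun r : ℝ => (r : ℂ)) Complex.ofReal_zero
  set F : SchwartzMap E ℂ := hFs.toSchwartzMap hF with hFdef
  have hFapp : ∀ x, F x = (f x : ℂ) := fun x => rfl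
  set G : SchwartzMap E ℂ := 𝓕 F with hG
  have hGi : Integrable (fun ξ => G (-ξ)) := G.integrable.comp_neg
  have hGF : 𝓕 (fun ξ => G (-ξ)) = F := by
    have h1 : 𝓕 (fun ξ => G (-ξ)) = 𝓕⁻ (G : E → ℂ) := (Real.fourierInv_eq_fourier_comp_neg _).symm
    rw [h1, hG, ← SchwartzMap.fourierInv_coe]
    simp
  have key : ∀ n, ((∫ x, f x ∂(m n) : ℝ) : ℂ) =
      ∫ ξ, G ξ * charFun (m n) ((2 * Real.pi) • ξ) := by
    intro n
    rw [← integral_complex_ofReal]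
    calc ∫ x, (f x : ℂ) ∂(m n) = ∫ x, 𝓕 (fun ξ => G (-ξ)) x ∂(m n) := by rw [hGF]; rfl
      _ = ∫ ξ, G (-ξ) * charFun (m n) (-(2 * Real.pi) • ξ) := integral_fourier_measure _ hGi
      _ = ∫ ξ, (fun ξ => G ξ * charFun (m n) ((2 * Real.pi) • ξ)) (-ξ) := by
          simp only [smul_neg, neg_smul]
      _ = _ := integral_neg_eq_self (fun ξ => G ξ * charFun (m n) ((2 * Real.pi) • ξ)) volume
  have hlim : ∫ x, (f x : ℂ) * 𝓕 h x = ∫ ξ, G ξ * h ξ := by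
    have := VectorFourier.integral_bilin_fourierIntegral_eq_flip (μ := (volume : Measure E))
      (ν := volume) (L := innerₗ E) (e := Real.fourierChar) (f := F) (g := h)
      (ContinuousLinearMap.mul ℂ ℂ) Real.continuous_fourierChar continuous_inner F.integrable hh
    rw [flip_innerₗ] at this
    exact this.symm
  rw [hlim]
  simp only [key]
  refine tendsto_integral_of_dominated_convergence (fun ξ => ‖G ξ‖) ?_ G.integrable.norm ?_ ?_
  · intro n
    exact G.continuous.aestronglyMeasurable.mul
      (measurable_charFun.comp (measurable_const_smul _)).aestronglyMeasurable
  · intro n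
    refine ae_of_all _ fun ξ => ?_
    rw [norm_mul]
    exact mul_le_of_le_one_right (norm_nonneg _) (norm_charFun_le_one _)
  · exact ae_of_all _ fun ξ => (hm ξ).const_mul _

theorem continuous_fourier {h : E → ℂ} (hh : Integrable h) : Continuous (𝓕 h) :=
  VectorFourier.fourierIntegral_continuous Real.continuous_fourierChar continuous_inner hh

/-- The Fourier transform of an integrable limit of characteristic functions is nonnegative. -/
theorem fourier_nonneg_of_tendsto_charFun {m : ℕ → Measure E} [∀ n, IsProbabilityMeasure (m n)]
    {h : E → ℂ} (hh : Integrable h)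
    (hm : ∀ ξ, Tendsto (fun n => charFun (m n) ((2 * Real.pi) • ξ)) atTop (𝓝 (h ξ))) (x : E) :
    0 ≤ (𝓕 h x).re ∧ 𝓕 h x = ((𝓕 h x).re : ℂ) := by
  -- Two limits stay in this closed set: the integrals of a mollifier against `m k`, nonnegative
  -- reals, tend to a mollification of `𝓕 h` at `x`, and the mollifications tend to `𝓕 h x`.
  have hC : IsClosed {z : ℂ | 0 ≤ z.re ∧ z = (z.re : ℂ)} :=
    (isClosed_le continuous_const Complex.continuous_re).inter
      (isClosed_eq continuous_id (Complex.continuous_ofReal.comp Complex.continuous_re))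
  let φ : ℕ → ContDiffBump (0 : E) := fun n =>
    ⟨1 / ((n : ℝ) + 1), 2 / ((n : ℝ) + 1), by positivity, by gcongr; norm_num⟩
  have hφ : Tendsto (fun n => (φ n).rOut) atTop (𝓝 0) := by
    have := (tendsto_one_div_add_atTop_nhds_zero_nat (𝕜 := ℝ)).const_mul 2
    simpa [φ, div_eq_mul_inv] using this
  have hlim := ContDiffBump.convolution_tendsto_right_of_continuous (μ := (volume : Measure E))
    hφ (continuous_fourier hh) x
  refine hC.mem_of_tendsto hlim (Eventually.of_forall fun n => ?_)
  have hconv : ((φ n).normed volume ⋆[ContinuousLinearMap.lsmul ℝ ℝ, volume] 𝓕 h) x =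
      ∫ y, (((φ n).normed volume (x - y) : ℝ) : ℂ) * 𝓕 h y := by
    rw [convolution_eq_swap]
    simp
  rw [hconv]
  have hcs : HasCompactSupport (fun y => (φ n).normed volume (x - y)) :=
    ((φ n).hasCompactSupport_normed (μ := volume)).comp_homeomorph (Homeomorph.subLeft x)
  have ht := tendsto_integral_of_tendsto_charFun hh hm (f := fun y => (φ n).normed volume (x - y))
    ((φ n).contDiff_normed.comp (contDiff_const.sub contDiff_id)) hcs
  refine hC.mem_of_tendsto ht (Eventually.of_forall fun k => ⟨?_, by simp⟩)
  simp only [Complex.ofReal_re]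
  exact integral_nonneg fun y => (φ n).nonneg_normed _

/-- Bounds on integrals of a smooth weight pass to the limit. -/
theorem lintegral_mul_fourier_le {m : ℕ → Measure E} [∀ n, IsProbabilityMeasure (m n)]
    {h : E → ℂ} (hh : Integrable h)
    (hm : ∀ ξ, Tendsto (fun n => charFun (m n) ((2 * Real.pi) • ξ)) atTop (𝓝 (h ξ)))
    {W : E → ℝ} (hW : ContDiff ℝ ∞ W) (hW0 : ∀ x, 0 ≤ W x) {C : ℝ≥0∞}
    (hC : ∀ n, ∫⁻ x, ENNReal.ofReal (W x) ∂(m n) ≤ C) :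
    ∫⁻ x, ENNReal.ofReal (W x * (𝓕 h x).re) ≤ C := by
  rcases eq_or_ne C ∞ with rfl | hCt
  · exact le_top
  -- Cutoffs equal to one on growing balls: `W` may be unbounded, while convergence of integrals is
  -- known only for compactly supported test functions. Fatou's lemma removes the cutoff at the end.
  let φ : ℕ → ContDiffBump (0 : E) := fun n => ⟨(n : ℝ) + 1, (n : ℝ) + 2, by positivity, by simp⟩
  have hcont : Continuous fun x => (𝓕 h x).re := Complex.continuous_re.comp (continuous_fourier hh)
  have hbd : ∀ k, ∫⁻ x, ENNReal.ofReal (φ k x * W x * (𝓕 h x).re) ≤ C := by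
    intro k
    have hf : ContDiff ℝ ∞ (fun x => φ k x * W x) := (φ k).contDiff.mul hW
    have hfs : HasCompactSupport (fun x => φ k x * W x) := (φ k).hasCompactSupport.mul_right
    have ht := tendsto_integral_of_tendsto_charFun hh hm hf hfs
    have hre : ∀ x, ((φ k x * W x : ℝ) : ℂ) * 𝓕 h x
        = ((φ k x * W x * (𝓕 h x).re : ℝ) : ℂ) := by
      intro x
      rw [Complex.ofReal_mul _ ((𝓕 h x).re), ← (fourier_nonneg_of_tendsto_charFun hh hm x).2]
    simp only [hre, integral_complex_ofReal] at ht
    have ht' := (Complex.continuous_re.tendsto _).comp ht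
    simp only [Function.comp_def, Complex.ofReal_re] at ht'
    rw [← ofReal_integral_eq_lintegral_ofReal]
    · refine ENNReal.ofReal_le_of_le_toReal (le_of_tendsto ht' (Eventually.of_forall fun n => ?_))
      rw [integral_eq_lintegral_of_nonneg_ae (ae_of_all _ fun x => mul_nonneg (φ k).nonneg (hW0 x))
        (hf.continuous.aestronglyMeasurable)]
      refine ENNReal.toReal_mono hCt (le_trans (lintegral_mono fun x => ?_) (hC n))
      exact ENNReal.ofReal_le_ofReal (mul_le_of_le_one_left (hW0 x) (φ k).le_one)
    · exact (hf.continuous.mul hcont).integrable_of_hasCompactSupport hfs.mul_right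
    · exact ae_of_all _ fun x => mul_nonneg (mul_nonneg (φ k).nonneg (hW0 x))
        (fourier_nonneg_of_tendsto_charFun hh hm x).1
  have hlim : ∀ x, Tendsto (fun k => ENNReal.ofReal (φ k x * W x * (𝓕 h x).re)) atTop
      (𝓝 (ENNReal.ofReal (W x * (𝓕 h x).re))) := by
    intro x
    refine tendsto_const_nhds.congr' ?_
    obtain ⟨N, hN⟩ := exists_nat_ge ‖x‖
    filter_upwards [eventually_ge_atTop N] with k hk
    have : φ k x = 1 := by
      refine (φ k).one_of_mem_closedBall ?_
      rw [mem_closedBall_zero_iff]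
      have : (N : ℝ) ≤ k := by exact_mod_cast hk
      change ‖x‖ ≤ (k : ℝ) + 1
      linarith
    rw [this, one_mul]
  calc ∫⁻ x, ENNReal.ofReal (W x * (𝓕 h x).re)
      = ∫⁻ x, liminf (fun k => ENNReal.ofReal (φ k x * W x * (𝓕 h x).re)) atTop :=
        lintegral_congr fun x => ((hlim x).liminf_eq).symm
    _ ≤ liminf (fun k => ∫⁻ x, ENNReal.ofReal (φ k x * W x * (𝓕 h x).re)) atTop :=
        lintegral_liminf_le fun k => by
          have := (φ k).contDiff (n := 0) |>.continuous
          have := hW.continuous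
          fun_prop
    _ ≤ liminf (fun _ => C) atTop := liminf_le_liminf (Eventually.of_forall hbd)
    _ = C := by simp

/-- The weight `W = 1`: total masses equal to one bound the integral of the nonnegative function `𝓕
h`. This is what licenses Fourier inversion. -/
theorem integrable_fourier_of_tendsto_charFun {m : ℕ → Measure E}
    [∀ n, IsProbabilityMeasure (m n)] {h : E → ℂ} (hh : Integrable h)
    (hm : ∀ ξ, Tendsto (fun n => charFun (m n) ((2 * Real.pi) • ξ)) atTop (𝓝 (h ξ))) :
    Integrable (𝓕 h) := by
  refine ⟨(continuous_fourier hh).aestronglyMeasurable, ?_⟩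
  refine lt_of_le_of_lt ?_ (ENNReal.one_lt_top)
  refine le_trans (lintegral_mono fun x => ?_)
    (lintegral_mul_fourier_le hh hm (W := fun _ => 1) contDiff_const (by simp) (by simp))
  obtain ⟨h1, h2⟩ := fourier_nonneg_of_tendsto_charFun hh hm x
  rw [h2, one_mul, Complex.ofReal_re, ← ofReal_norm, Complex.norm_real,
    Real.norm_of_nonneg h1]

/-- A probability measure with integrable characteristic function has a continuous density. -/
theorem eq_withDensity_of_integrable_charFun (m : Measure E) [IsProbabilityMeasure m]
    (hh : Integrable (fun ξ => charFun m ((2 * Real.pi) • ξ))) (hc : Continuous (charFun m)) :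
    m = volume.withDensity
      (fun x => ENNReal.ofReal (𝓕 (fun ξ => charFun m ((2 * Real.pi) • ξ)) x).re) := by
  set h : E → ℂ := fun ξ => charFun m ((2 * Real.pi) • ξ) with hdef
  -- The constant sequence `m` puts a single law in the scope of the limit lemmas.
  have hm : ∀ ξ, Tendsto (fun _ : ℕ => charFun m ((2 * Real.pi) • ξ)) atTop (𝓝 (h ξ)) :=
    fun ξ => tendsto_const_nhds
  have hi := integrable_fourier_of_tendsto_charFun hh hm
  have hmeas : Measurable fun x => ENNReal.ofReal (𝓕 h x).re :=
    (Complex.continuous_re.comp (continuous_fourier hh)).measurable.ennreal_ofReal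
  have hfin : IsFiniteMeasure (volume.withDensity fun x => ENNReal.ofReal (𝓕 h x).re) :=
    isFiniteMeasure_withDensity_ofReal hi.re.2
  refine Measure.ext_of_charFun (funext fun t => ?_)
  have hinv := Continuous.fourierInv_fourier_eq (f := h)
    (hc.comp (continuous_const_smul _)) hh hi
  have ht : charFun m t = 𝓕⁻ (𝓕 h) ((2 * Real.pi)⁻¹ • t) := by
    rw [hinv, hdef]
    simp only [smul_smul]
    rw [mul_inv_cancel₀ (by positivity), one_smul]
  rw [ht, charFun_apply, Real.fourierInv_eq', integral_withDensity_eq_integral_toReal_smul hmeas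
    (ae_of_all _ fun _ => ENNReal.ofReal_lt_top)]
  refine integral_congr_ae (ae_of_all _ fun x => ?_)
  obtain ⟨h1, h2⟩ := fourier_nonneg_of_tendsto_charFun hh hm x
  simp only [ENNReal.toReal_ofReal h1]
  rw [Complex.real_smul, ← h2, smul_eq_mul, mul_comm, inner_smul_right]
  congr 3
  push_cast
  have : (Real.pi : ℂ) ≠ 0 := by exact_mod_cast Real.pi_ne_zero
  field_simp

end FourierDensity

/-! ### Compound Poisson laws -/

section CompoundPoisson

open scoped FourierTransform ContDiff Convolution InnerProductSpace

variable {d : ℕ}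

/-- Convolution powers of a measure. -/
def convPow (κ : Measure (RSpace d)) : ℕ → Measure (RSpace d)
  | 0 => Measure.dirac 0
  | n + 1 => κ ∗ convPow κ n

instance isFiniteMeasure_convPow (κ : Measure (RSpace d)) [IsFiniteMeasure κ] (n : ℕ) :
    IsFiniteMeasure (convPow κ n) := by
  induction n with
  | zero => unfold convPow; infer_instance
  | succ n ih => unfold convPow; infer_instance

/-- The compound Poisson law with finite Lévy measure `κ`. -/
def compoundPoisson (κ : Measure (RSpace d)) : Measure (RSpace d) :=
  ENNReal.ofReal (Real.exp (-κ.real univ)) •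
    Measure.sum fun n => ENNReal.ofReal ((n.factorial : ℝ)⁻¹) • convPow κ n

theorem charFun_convPow (κ : Measure (RSpace d)) [IsFiniteMeasure κ] (n : ℕ) (ξ : RSpace d) :
    charFun (convPow κ n) ξ = charFun κ ξ ^ n := by
  induction n with
  | zero => simp [convPow]
  | succ n ih => rw [convPow, charFun_conv, ih, pow_succ']

theorem lintegral_exp_convPow (κ : Measure (RSpace d)) [IsFiniteMeasure κ] (a : RSpace d) (n : ℕ) :
    ∫⁻ x, ENNReal.ofReal (Real.exp (inner ℝ a x)) ∂(convPow κ n) =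
      (∫⁻ x, ENNReal.ofReal (Real.exp (inner ℝ a x)) ∂κ) ^ n := by
  induction n with
  | zero => simp [convPow]
  | succ n ih =>
    rw [convPow, Measure.lintegral_conv (by fun_prop)]
    simp only [inner_add_right, Real.exp_add, ENNReal.ofReal_mul (Real.exp_nonneg _)]
    simp only [lintegral_const_mul _ (show Measurable fun y : RSpace d =>
      ENNReal.ofReal (Real.exp (inner ℝ a y)) by fun_prop), ih]
    rw [lintegral_mul_const _ (by fun_prop), pow_succ']

/-- Laplace transforms of convolution powers are powers, and the exponential series sums them. The
case `a = 0` gives total mass one. -/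
theorem lintegral_exp_compoundPoisson (κ : Measure (RSpace d)) [IsFiniteMeasure κ] (a : RSpace d)
    (ha : Integrable (fun x => Real.exp (inner ℝ a x)) κ) :
    ∫⁻ x, ENNReal.ofReal (Real.exp (inner ℝ a x)) ∂(compoundPoisson κ) =
      ENNReal.ofReal (Real.exp (∫ x, (Real.exp (inner ℝ a x) - 1) ∂κ)) := by
  set L := ∫ x, Real.exp (inner ℝ a x) ∂κ with hL
  have hL0 : 0 ≤ L := integral_nonneg fun x => Real.exp_nonneg _
  have h1 : ∫⁻ x, ENNReal.ofReal (Real.exp (inner ℝ a x)) ∂κ = ENNReal.ofReal L :=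
    (ofReal_integral_eq_lintegral_ofReal ha (ae_of_all _ fun x => Real.exp_nonneg _)).symm
  rw [compoundPoisson, lintegral_smul_measure, lintegral_sum_measure]
  simp only [lintegral_smul_measure, lintegral_exp_convPow, h1, smul_eq_mul]
  have h2 : ∀ n : ℕ, ENNReal.ofReal ((n.factorial : ℝ)⁻¹) * ENNReal.ofReal L ^ n =
      ENNReal.ofReal (L ^ n / n.factorial) := by
    intro n
    rw [← ENNReal.ofReal_pow hL0, ← ENNReal.ofReal_mul (by positivity), div_eq_inv_mul]
  simp only [h2]
  rw [← ENNReal.ofReal_tsum_of_nonneg (fun n => by positivity) (Real.summable_pow_div_factorial L),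
    ← ENNReal.ofReal_mul (Real.exp_nonneg _), integral_sub ha (integrable_const _)]
  have h3 : ∑' n : ℕ, L ^ n / n.factorial = Real.exp L := by
    rw [Real.exp_eq_exp_ℝ, NormedSpace.exp_eq_tsum_div]
  rw [h3, ← Real.exp_add]
  congr 2
  simp [hL]
  ring

instance isProbabilityMeasure_compoundPoisson (κ : Measure (RSpace d)) [IsFiniteMeasure κ] :
    IsProbabilityMeasure (compoundPoisson κ) := by
  have := lintegral_exp_compoundPoisson κ 0 (by simp)
  exact ⟨by simpa using this⟩

theorem charFun_compoundPoisson (κ : Measure (RSpace d)) [IsFiniteMeasure κ] (ξ : RSpace d) :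
    charFun (compoundPoisson κ) ξ = Complex.exp (charFun κ ξ - κ.real univ) := by
  have hfin := isProbabilityMeasure_compoundPoisson κ
  -- Finiteness of the unnormalised sum is read off from the normalised one, the factor being
  -- nonzero; bounded characters are then integrable against it.
  have hS : IsFiniteMeasure
      (Measure.sum fun n => ENNReal.ofReal ((n.factorial : ℝ)⁻¹) • convPow κ n) := by
    refine ⟨lt_of_le_of_ne le_top fun h => ?_⟩
    have := hfin.measure_univ
    rw [compoundPoisson, Measure.smul_apply, h, smul_eq_mul, ENNReal.mul_top] at this
    · exact absurd this (by simp)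
    · simp [Real.exp_pos]
  have hi : Integrable (fun x => Complex.exp ((inner ℝ x ξ : ℝ) * Complex.I))
      (Measure.sum fun n => ENNReal.ofReal ((n.factorial : ℝ)⁻¹) • convPow κ n) := by
    refine (integrable_const (1 : ℝ)).mono (by fun_prop) (ae_of_all _ fun x => ?_)
    rw [Complex.norm_exp_ofReal_mul_I]
    simp
  have hs := hasSum_integral_measure hi
  rw [charFun_apply, compoundPoisson, integral_smul_measure, ← hs.tsum_eq]
  have h1 : ∀ n : ℕ, ∫ x, Complex.exp ((inner ℝ x ξ : ℝ) * Complex.I)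
      ∂(ENNReal.ofReal ((n.factorial : ℝ)⁻¹) • convPow κ n) =
      charFun κ ξ ^ n / n.factorial := by
    intro n
    rw [integral_smul_measure, ← charFun_apply, charFun_convPow,
      ENNReal.toReal_ofReal (by positivity), Complex.real_smul]
    push_cast
    rw [div_eq_inv_mul]
  simp only [h1]
  rw [ENNReal.toReal_ofReal (Real.exp_nonneg _), Complex.real_smul, sub_eq_neg_add,
    Complex.exp_add]
  congr 1
  · push_cast; rfl
  · rw [Complex.exp_eq_exp_ℂ, NormedSpace.exp_eq_tsum_div]

/-- The substitution `u ↦ -u` shows that the integral is its own negative. The change of variables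
for a measurable embedding needs no integrability. -/
theorem integral_odd_eq_zero
    {κ : Measure (RSpace d)} (hs : κ.map (fun u => -u) = κ)
    {f : RSpace d → ℝ} (hf : ∀ u, f (-u) = -f u) : ∫ u, f u ∂κ = 0 := by
  have h1 : ∫ u, f u ∂κ = ∫ u, f (-u) ∂κ := by
    conv_lhs => rw [← hs]
    exact (MeasurableEquiv.neg (RSpace d)).measurableEmbedding.integral_map f
  simp only [hf, integral_neg] at h1
  linarith

/-- For a symmetric finite Lévy measure the characteristic function is real. -/
theorem charFun_compoundPoisson_symm (κ : Measure (RSpace d)) [IsFiniteMeasure κ]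
    (hs : κ.map (fun u => -u) = κ) (ξ : RSpace d) :
    charFun (compoundPoisson κ) ξ =
      (Real.exp (-∫ u, (1 - Real.cos (inner ℝ u ξ)) ∂κ) : ℝ) := by
  have hc : Integrable (fun u => Real.cos (inner ℝ u ξ)) κ :=
    (integrable_const (1 : ℝ)).mono (by fun_prop) (ae_of_all _ fun x => by
      simpa using Real.abs_cos_le_one _)
  have hsin : Integrable (fun u => Real.sin (inner ℝ u ξ)) κ :=
    (integrable_const (1 : ℝ)).mono (by fun_prop) (ae_of_all _ fun x => by
      simpa using Real.abs_sin_le_one _)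
  have h1 : charFun κ ξ = ((∫ u, Real.cos (inner ℝ u ξ) ∂κ : ℝ) : ℂ) := by
    have h0 : ∫ u, Real.sin (inner ℝ u ξ) ∂κ = 0 :=
      integral_odd_eq_zero hs fun u => by rw [inner_neg_left, Real.sin_neg]
    rw [charFun_apply]
    have h2 : ∀ u : RSpace d, Complex.exp ((inner ℝ u ξ : ℝ) * Complex.I) =
        ((Real.cos (inner ℝ u ξ) : ℝ) : ℂ) + ((Real.sin (inner ℝ u ξ) : ℝ) : ℂ) * Complex.I := by
      intro u
      rw [Complex.exp_mul_I]
      push_cast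
      rfl
    simp only [h2]
    rw [integral_add hc.ofReal (hsin.ofReal.mul_const _), integral_mul_const,
      integral_complex_ofReal, integral_complex_ofReal, h0]
    simp
  rw [charFun_compoundPoisson, h1, integral_sub (integrable_const _) hc]
  push_cast
  simp

end CompoundPoisson

/-! ### The radial integral of `1 - cos` and its constant -/

section CosineIntegral

/-- The constant `-cos (α π / 2) Γ(2 - α) / (α (α - 1))`. -/
def cosConst (α : ℝ) : ℝ :=
  -Real.cos (α * (Real.pi / 2)) * (Real.Gamma (2 - α) / (α * (α - 1)))

/-- The reflection formula at `α - 1` and at `α / 2`, joined by the double-angle formula for the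
sine. The right-hand side is the form in which the Gamma integrals below produce the constant, and
its sign is evident. -/
theorem cosConst_eq {α : ℝ} (h1 : 1 < α) (h2 : α < 2) :
    cosConst α = (Real.Gamma (1 + α))⁻¹ * (1 / 2 * (Real.Gamma (α / 2) * Real.Gamma (1 - α / 2))) := by
  have hpi := Real.pi_pos
  have hG1 : Real.Gamma (1 + α) = α * ((α - 1) * Real.Gamma (α - 1)) := by
    rw [add_comm, Real.Gamma_add_one (by linarith)]
    have := Real.Gamma_add_one (s := α - 1) (by linarith)
    rw [sub_add_cancel] at this
    rw [this]
  have hG2 := Real.Gamma_mul_Gamma_one_sub (α - 1)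
  have hG3 := Real.Gamma_mul_Gamma_one_sub (α / 2)
  have hp1 : 0 < Real.Gamma (α - 1) := Real.Gamma_pos_of_pos (by linarith)
  have e1 : 1 - (α - 1) = 2 - α := by ring
  have e2 : Real.sin (Real.pi * (α - 1)) =
      -(2 * Real.sin (α * (Real.pi / 2)) * Real.cos (α * (Real.pi / 2))) := by
    rw [← Real.sin_two_mul, ← Real.sin_sub_pi]
    congr 1
    ring
  have e3 : Real.pi * (α / 2) = α * (Real.pi / 2) := by ring
  have hs : 0 < Real.sin (α * (Real.pi / 2)) :=
    Real.sin_pos_of_pos_of_lt_pi (by positivity) (by nlinarith)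
  have hc : Real.cos (α * (Real.pi / 2)) < 0 :=
    Real.cos_neg_of_pi_div_two_lt_of_lt (by nlinarith) (by nlinarith)
  rw [e1, e2] at hG2
  rw [e3] at hG3
  rw [hG3, hG1, cosConst]
  have hG4 : Real.Gamma (2 - α) = Real.pi /
      -(2 * Real.sin (α * (Real.pi / 2)) * Real.cos (α * (Real.pi / 2))) /
        Real.Gamma (α - 1) := by
    rw [← hG2]
    field_simp
  rw [hG4]
  have : α - 1 ≠ 0 := by linarith
  have hc' := hc.ne
  generalize Real.cos (α * (Real.pi / 2)) = c at *
  generalize Real.sin (α * (Real.pi / 2)) = s at *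
  field_simp

theorem cosConst_pos {α : ℝ} (h1 : 1 < α) (h2 : α < 2) : 0 < cosConst α := by
  rw [cosConst_eq h1 h2]
  have := Real.Gamma_pos_of_pos (s := 1 + α) (by linarith)
  have := Real.Gamma_pos_of_pos (s := α / 2) (by linarith)
  have := Real.Gamma_pos_of_pos (s := 1 - α / 2) (by linarith)
  positivity

theorem lintegral_rpow_mul_exp_neg {a r : ℝ} (ha : 0 < a) (hr : 0 < r) :
    ∫⁻ t in Ioi (0 : ℝ), ENNReal.ofReal (t ^ (a - 1) * Real.exp (-(r * t))) =
      ENNReal.ofReal (r ^ (-a) * Real.Gamma a) := by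
  have h := Real.integral_rpow_mul_exp_neg_mul_Ioi ha hr
  rw [← ofReal_integral_eq_lintegral_ofReal, h, one_div, Real.inv_rpow hr.le, Real.rpow_neg hr.le]
  · refine Integrable.of_integral_ne_zero ?_
    rw [h]
    have := Real.Gamma_pos_of_pos ha
    positivity
  · exact (ae_restrict_mem measurableSet_Ioi).mono fun t ht =>
      mul_nonneg (Real.rpow_nonneg (le_of_lt ht) _) (Real.exp_nonneg _)

/-- The real part of the integral of `e^{(-t+i)r}` gives `t / (1 + t ^ 2)`, to be subtracted from `1
/ t`. -/
theorem lintegral_one_sub_cos_mul_exp {t : ℝ} (ht : 0 < t) :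
    ∫⁻ r in Ioi (0 : ℝ), ENNReal.ofReal ((1 - Real.cos r) * Real.exp (-(r * t))) =
      ENNReal.ofReal (t⁻¹ * (1 + t ^ 2)⁻¹) := by
  have hre : ((-t + Complex.I : ℂ)).re < 0 := by simpa using ht
  have hi1 := integrableOn_exp_mul_complex_Ioi hre 0
  have h1 := integral_exp_mul_complex_Ioi hre 0
  have hi2 : IntegrableOn (fun r : ℝ => Real.exp (-t * r)) (Ioi 0) :=
    integrableOn_exp_mul_Ioi (by linarith) 0
  have h2 := integral_exp_mul_Ioi (a := -t) (by linarith) 0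
  have hexp : ∀ r : ℝ, Real.cos r * Real.exp (-t * r) =
      RCLike.re (Complex.exp ((-t + Complex.I) * r)) := by
    intro r
    rw [RCLike.re_eq_complex_re, Complex.exp_re]
    simp [mul_comm]
  have hcos : ∫ r in Ioi (0 : ℝ), Real.cos r * Real.exp (-t * r) = t * (1 + t ^ 2)⁻¹ := by
    simp only [hexp]
    rw [integral_re hi1, h1]
    have : (-t + Complex.I : ℂ) ≠ 0 := fun h => by rw [h] at hre; simp at hre
    simp only [Complex.ofReal_zero, mul_zero, Complex.exp_zero]
    rw [RCLike.re_eq_complex_re, Complex.div_re]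
    simp [Complex.normSq_apply]
    field_simp
    ring
  have hicos : IntegrableOn (fun r : ℝ => Real.cos r * Real.exp (-t * r)) (Ioi 0) := by
    simp only [hexp]
    exact hi1.re
  have heq : ∀ r : ℝ, (1 - Real.cos r) * Real.exp (-(r * t)) =
      Real.exp (-t * r) - Real.cos r * Real.exp (-t * r) := by
    intro r
    rw [show -(r * t) = -t * r by ring]
    ring
  rw [← ofReal_integral_eq_lintegral_ofReal]
  · simp only [heq]
    rw [integral_sub hi2 hicos, h2, hcos]
    congr 1
    simp
    field_simp
    ring
  · simp only [heq]
    exact hi2.sub hicos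
  · exact ae_of_all _ fun r => mul_nonneg (by linarith [Real.cos_le_one r]) (Real.exp_nonneg _)

/-- Write `1 / (1 + t ^ 2)` as the integral of `e^{-s(1+t²)}` over `s > 0` and exchange: both inner
integrals are Gamma integrals. -/
theorem lintegral_rpow_div_one_add_sq {α : ℝ} (h1 : 0 < α) (h2 : α < 2) :
    ∫⁻ t in Ioi (0 : ℝ), ENNReal.ofReal (t ^ (α - 1) * (1 + t ^ 2)⁻¹) =
      ENNReal.ofReal (1 / 2 * (Real.Gamma (α / 2) * Real.Gamma (1 - α / 2))) := by
  have hG1 := Real.Gamma_pos_of_pos (s := α / 2) (by linarith)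
  have hG2 := Real.Gamma_pos_of_pos (s := 1 - α / 2) (by linarith)
  have e1 : ∀ t ∈ Ioi (0 : ℝ), ENNReal.ofReal (t ^ (α - 1) * (1 + t ^ 2)⁻¹) =
      ∫⁻ s in Ioi (0 : ℝ), ENNReal.ofReal (Real.exp (-s)) *
        ENNReal.ofReal (t ^ (α - 1) * Real.exp (-s * t ^ (2 : ℝ))) := by
    intro t ht
    have ht : 0 < t := ht
    have := lintegral_rpow_mul_exp_neg (a := 1) (r := 1 + t ^ 2) one_pos (by positivity)
    simp only [sub_self, Real.rpow_zero, one_mul, Real.Gamma_one, mul_one, Real.rpow_neg_one]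
      at this
    rw [ENNReal.ofReal_mul (by positivity), ← this, ← lintegral_const_mul _ (by fun_prop)]
    refine lintegral_congr fun s => ?_
    rw [← ENNReal.ofReal_mul (by positivity), ← ENNReal.ofReal_mul (by positivity)]
    congr 1
    rw [show -((1 + t ^ 2) * s) = -s + -s * t ^ (2 : ℝ) by rw [Real.rpow_two]; ring, Real.exp_add]
    ring
  rw [setLIntegral_congr_fun measurableSet_Ioi e1, lintegral_lintegral_swap (by fun_prop)]
  have e2 : ∀ s ∈ Ioi (0 : ℝ), ∫⁻ t in Ioi (0 : ℝ), ENNReal.ofReal (Real.exp (-s)) *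
        ENNReal.ofReal (t ^ (α - 1) * Real.exp (-s * t ^ (2 : ℝ))) =
      ENNReal.ofReal (1 / 2 * Real.Gamma (α / 2)) *
        ENNReal.ofReal (s ^ (1 - α / 2 - 1) * Real.exp (-(1 * s))) := by
    intro s hs
    have hs : 0 < s := hs
    have h := integral_rpow_mul_exp_neg_mul_rpow (p := 2) (q := α - 1) (b := s) (by norm_num)
      (by linarith) hs
    rw [lintegral_const_mul _ (by fun_prop), ← ofReal_integral_eq_lintegral_ofReal, h,
      ← ENNReal.ofReal_mul (by positivity), ← ENNReal.ofReal_mul (by positivity)]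
    · congr 1
      rw [show -(α - 1 + 1) / 2 = 1 - α / 2 - 1 by ring, show (α - 1 + 1) / 2 = α / 2 by ring,
        one_mul]
      ring
    · refine Integrable.of_integral_ne_zero ?_
      rw [h, show (α - 1 + 1) / 2 = α / 2 by ring]
      positivity
    · exact (ae_restrict_mem measurableSet_Ioi).mono fun t ht =>
        mul_nonneg (Real.rpow_nonneg (le_of_lt ht) _) (Real.exp_nonneg _)
  rw [setLIntegral_congr_fun measurableSet_Ioi e2, lintegral_const_mul _ (by fun_prop),
    lintegral_rpow_mul_exp_neg (by linarith) one_pos, ← ENNReal.ofReal_mul (by positivity)]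
  congr 1
  simp
  ring

/-- Write `r ^ (-(α + 1))` as a Laplace transform of `t ^ α / Γ(1 + α)` and exchange; the Laplace
transform of `1 - cos` then leaves the previous integral. Working with `∫⁻` lets Tonelli apply
without integrability checks. -/
theorem lintegral_one_sub_cos {α : ℝ} (h1 : 1 < α) (h2 : α < 2) :
    ∫⁻ r in Ioi (0 : ℝ), ENNReal.ofReal (1 - Real.cos r) * ENNReal.ofReal (r ^ (-(α + 1))) =
      ENNReal.ofReal (cosConst α) := by
  have hG := Real.Gamma_pos_of_pos (s := 1 + α) (by linarith)
  have hcos : ∀ r, 0 ≤ 1 - Real.cos r := fun r => by linarith [Real.cos_le_one r]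
  have e1 : ∀ r ∈ Ioi (0 : ℝ), ENNReal.ofReal (1 - Real.cos r) * ENNReal.ofReal (r ^ (-(α + 1))) =
      ∫⁻ t in Ioi (0 : ℝ), ENNReal.ofReal ((Real.Gamma (1 + α))⁻¹ * t ^ α) *
        ENNReal.ofReal ((1 - Real.cos r) * Real.exp (-(r * t))) := by
    intro r hr
    have hr : 0 < r := hr
    have h := lintegral_rpow_mul_exp_neg (a := 1 + α) (r := r) (by linarith) hr
    have h3 : ENNReal.ofReal (r ^ (-(α + 1))) = ENNReal.ofReal ((Real.Gamma (1 + α))⁻¹) *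
        ENNReal.ofReal (r ^ (-(1 + α)) * Real.Gamma (1 + α)) := by
      rw [← ENNReal.ofReal_mul (by positivity)]
      congr 1
      rw [add_comm α 1]
      field_simp
    rw [h3, ← h, ← mul_assoc, ← ENNReal.ofReal_mul (hcos r), ← lintegral_const_mul _ (by fun_prop)]
    refine setLIntegral_congr_fun measurableSet_Ioi fun t ht => ?_
    have ht : 0 < t := ht
    rw [← ENNReal.ofReal_mul (mul_nonneg (hcos r) (by positivity)),
      ← ENNReal.ofReal_mul (by positivity), show 1 + α - 1 = α by ring]
    congr 1
    ring
  rw [setLIntegral_congr_fun measurableSet_Ioi e1, lintegral_lintegral_swap (by fun_prop)]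
  have e2 : ∀ t ∈ Ioi (0 : ℝ), ∫⁻ r in Ioi (0 : ℝ),
      ENNReal.ofReal ((Real.Gamma (1 + α))⁻¹ * t ^ α) *
        ENNReal.ofReal ((1 - Real.cos r) * Real.exp (-(r * t))) =
      ENNReal.ofReal ((Real.Gamma (1 + α))⁻¹) *
        ENNReal.ofReal (t ^ (α - 1) * (1 + t ^ 2)⁻¹) := by
    intro t ht
    have ht : 0 < t := ht
    rw [lintegral_const_mul _ (by fun_prop), lintegral_one_sub_cos_mul_exp ht,
      ← ENNReal.ofReal_mul (by positivity), ← ENNReal.ofReal_mul (by positivity)]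
    congr 1
    rw [Real.rpow_sub_one ht.ne']
    ring
  rw [setLIntegral_congr_fun measurableSet_Ioi e2, lintegral_const_mul _ (by fun_prop),
    lintegral_rpow_div_one_add_sq (by linarith) h2, ← ENNReal.ofReal_mul (by positivity),
    cosConst_eq h1 h2]

theorem lintegral_comp_mul_Ioi {g : ℝ → ℝ≥0∞} {c : ℝ} (hc : 0 < c) :
    ∫⁻ r in Ioi (0 : ℝ), g (c * r) = ENNReal.ofReal c⁻¹ * ∫⁻ r in Ioi (0 : ℝ), g r := by
  have hme : MeasurableEmbedding (fun r : ℝ => c * r) := measurableEmbedding_mulLeft₀ hc.ne'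
  have h1 := Real.map_volume_mul_left hc.ne'
  have h2 : (fun r : ℝ => c * r) ⁻¹' Ioi 0 = Ioi 0 := by
    ext r
    simp [hc]
  calc ∫⁻ r in Ioi (0 : ℝ), g (c * r)
      = ∫⁻ r in (fun r : ℝ => c * r) ⁻¹' Ioi 0, g (c * r) := by rw [h2]
    _ = ∫⁻ r in Ioi 0, g r ∂(volume.map (fun r : ℝ => c * r)) := by
        rw [hme.restrict_map, hme.lintegral_map]
    _ = _ := by
        rw [h1, Measure.restrict_smul, lintegral_smul_measure, abs_of_pos (inv_pos.2 hc),
          smul_eq_mul]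

theorem lintegral_one_sub_cos_mul {α : ℝ} (h1 : 1 < α) (h2 : α < 2) (s : ℝ) :
    ∫⁻ r in Ioi (0 : ℝ), ENNReal.ofReal (1 - Real.cos (r * s)) * ENNReal.ofReal (r ^ (-(α + 1))) =
      ENNReal.ofReal (cosConst α * |s| ^ α) := by
  rcases eq_or_ne s 0 with rfl | hs
  · simp [Real.zero_rpow (by linarith : α ≠ 0)]
  have ha : 0 < |s| := abs_pos.2 hs
  have e : ∀ r ∈ Ioi (0 : ℝ),
      ENNReal.ofReal (1 - Real.cos (r * s)) * ENNReal.ofReal (r ^ (-(α + 1))) =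
      ENNReal.ofReal (|s| ^ (α + 1)) * (ENNReal.ofReal (1 - Real.cos (|s| * r)) *
        ENNReal.ofReal ((|s| * r) ^ (-(α + 1)))) := by
    intro r hr
    have hr : 0 < r := hr
    have h3 : ENNReal.ofReal (|s| ^ (α + 1)) * ENNReal.ofReal ((|s| * r) ^ (-(α + 1))) =
        ENNReal.ofReal (r ^ (-(α + 1))) := by
      rw [← ENNReal.ofReal_mul (by positivity), Real.mul_rpow ha.le hr.le, ← mul_assoc,
        Real.rpow_neg ha.le, mul_inv_cancel₀ (by positivity), one_mul]
    rw [mul_left_comm (ENNReal.ofReal (|s| ^ (α + 1))), h3]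
    congr 3
    rw [← Real.cos_abs, abs_mul, abs_of_pos hr, mul_comm]
  rw [setLIntegral_congr_fun measurableSet_Ioi e, lintegral_const_mul _ (by fun_prop),
    lintegral_comp_mul_Ioi (g := fun r => ENNReal.ofReal (1 - Real.cos r) *
      ENNReal.ofReal (r ^ (-(α + 1)))) ha, lintegral_one_sub_cos h1 h2,
    ← ENNReal.ofReal_mul (by positivity), ← ENNReal.ofReal_mul (by positivity),
    Real.rpow_add_one ha.ne']
  congr 1
  field_simp

end CosineIntegral

/-! ### Lévy integrals, the exponent `Ψ`, and the characteristic function of the stable law -/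

section LevyMeasure

variable {d : ℕ} {α : ℝ} {ν : Measure (RSpace d)}

theorem lintegral_levy (hα : 0 < α) (hν : IsStableLevyMeasure α ν) {f : RSpace d → ℝ≥0∞}
    (hf : Measurable f) :
    ∫⁻ u, f u ∂ν = ∫⁻ y : USphere d, (∫⁻ r in Ioi (0 : ℝ),
      f (r • (y : RSpace d)) * ENNReal.ofReal (r ^ (-(α + 1)))) ∂(sphericalPart α ν) := by
  have := isFiniteMeasure_sphericalPart hν
  have hm : Measurable fun q : ℝ × USphere d => q.1 • (q.2 : RSpace d) := by fun_prop
  conv_lhs => rw [← polarMeasure_sphericalPart hα hν]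
  rw [polarMeasure, lintegral_map hf hm, 
    lintegral_prod_symm (fun q : ℝ × USphere d => f (q.1 • (q.2 : RSpace d)))
      (hf.comp hm).aemeasurable]
  refine lintegral_congr fun y => ?_
  have hm2 : Measurable fun r : ℝ => f (r • (y : RSpace d)) := by fun_prop
  rw [lintegral_withDensity_eq_lintegral_mul _ (by fun_prop) hm2]
  simp [mul_comm]

theorem sphericalPart_map_neg (hs : IsSymmetricLevy α ν) :
    (sphericalPart α ν).map (fun y => -y) = sphericalPart α ν := by
  have hm : Measurable fun y : USphere d => -y := continuous_neg.measurable
  ext B hB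
  rw [Measure.map_apply hm hB, hs B hB]

theorem levy_map_neg (hα : 0 < α) (hν : IsStableLevyMeasure α ν) (hs : IsSymmetricLevy α ν) :
    ν.map (fun u => -u) = ν := by
  have hfin := isFiniteMeasure_sphericalPart hν
  have hm : Measurable fun y : USphere d => -y := continuous_neg.measurable
  refine Measure.ext_of_lintegral _ fun f hf => ?_
  rw [lintegral_map hf measurable_neg, lintegral_levy hα hν (by fun_prop), lintegral_levy hα hν hf]
  conv_rhs => rw [← sphericalPart_map_neg hs]
  rw [lintegral_map _ hm]
  · simp
  · refine Measurable.lintegral_prod_right' (f := fun p : USphere d × ℝ =>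
      f (p.2 • (p.1 : RSpace d)) * ENNReal.ofReal (p.2 ^ (-(α + 1)))) ?_
    fun_prop

/-- The common majorant for Lévy integrals in this file. Radially it is `r ^ (1 - α)` near `0`,
integrable since `α < 2`, and `r ^ (-α)` at infinity, integrable since `α > 1`. -/
theorem integrable_levy_moment (h1 : 1 < α) (h2 : α < 2) (hν : IsStableLevyMeasure α ν) :
    Integrable (fun u => ‖u‖ * min 1 ‖u‖) ν := by
  have := isFiniteMeasure_sphericalPart hν
  refine ⟨by fun_prop, ?_⟩
  have e1 : ∫⁻ u, ‖‖u‖ * min 1 ‖u‖‖ₑ ∂ν = (∫⁻ r in Ioi (0 : ℝ),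
      ENNReal.ofReal (r * min 1 r * r ^ (-(α + 1)))) * sphericalPart α ν univ := by
    rw [lintegral_levy (by linarith) hν (by fun_prop), ← lintegral_const]
    refine lintegral_congr fun y => setLIntegral_congr_fun measurableSet_Ioi fun r hr => ?_
    have hr : 0 < r := hr
    rw [norm_smul, Real.norm_of_nonneg hr.le, norm_eq_of_mem_sphere, mul_one,
      Real.enorm_of_nonneg (by positivity), ← ENNReal.ofReal_mul (by positivity)]
  rw [HasFiniteIntegral, e1]
  refine ENNReal.mul_lt_top ?_ (measure_lt_top _ _)
  have hi : IntegrableOn (fun r : ℝ => r * min 1 r * r ^ (-(α + 1))) (Ioi 0) := by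
    rw [← Ioc_union_Ioi_eq_Ioi zero_le_one]
    refine IntegrableOn.union ?_ ?_
    · have h3 : IntegrableOn (fun r : ℝ => r ^ (1 - α)) (Ioc 0 1) := by
        rw [← intervalIntegrable_iff_integrableOn_Ioc_of_le zero_le_one]
        exact intervalIntegral.intervalIntegrable_rpow' (by linarith)
      refine h3.congr_fun (fun r hr => ?_) measurableSet_Ioc
      dsimp only
      have hr0 : r ≠ 0 := hr.1.ne'
      rw [min_eq_right hr.2, show 1 - α = -(α + 1) + (2 : ℕ) by push_cast; ring,
        Real.rpow_add_natCast hr0]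
      ring
    · have h3 : IntegrableOn (fun r : ℝ => r ^ (-α)) (Ioi 1) :=
        integrableOn_Ioi_rpow_of_lt (by linarith) one_pos
      refine h3.congr_fun (fun r hr => ?_) measurableSet_Ioi
      have hr : 1 < r := hr
      dsimp only
      rw [min_eq_left hr.le, mul_one, show -(α + 1) = -α - 1 by ring,
        Real.rpow_sub_one (by linarith)]
      field_simp
  exact hi.lintegral_lt_top

/-- The exponent `Ψ(ξ) = ∫ (1 - cos ⟨u ; ξ⟩) ν(du)`. -/
def levyExponent (ν : Measure (RSpace d)) (ξ : RSpace d) : ℝ :=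
  ∫ u, (1 - Real.cos (inner ℝ u ξ)) ∂ν

theorem levyExponent_nonneg (ν : Measure (RSpace d)) (ξ : RSpace d) : 0 ≤ levyExponent ν ξ :=
  integral_nonneg fun u => by simpa using Real.cos_le_one _

theorem abs_sin_le_min (a : ℝ) : |Real.sin a| ≤ min 1 |a| :=
  le_min (Real.abs_sin_le_one a) Real.abs_sin_le_abs

/-- Brings bounds of the type "bounded and Lipschitz" to a multiple of `min 1 ‖u‖`, the shape
required by `integrable_levy_moment`. -/
theorem min_mul_le {a b c : ℝ} (hc : 0 ≤ c) (hb : 0 ≤ b) (h : a ≤ min 1 (b * c)) :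
    a ≤ (1 + c) * min 1 b := by
  rcases le_total 1 b with hb1 | hb1
  · rw [min_eq_left hb1]
    have := h.trans (min_le_left _ _)
    linarith
  · rw [min_eq_right hb1]
    have := h.trans (min_le_right _ _)
    nlinarith

theorem abs_inner_le (u ξ : RSpace d) : |inner ℝ u ξ| ≤ ‖u‖ * ‖ξ‖ :=
  abs_real_inner_le_norm u ξ

theorem abs_sin_mul_inner_le (u ξ : RSpace d) :
    |Real.sin (inner ℝ u ξ) * inner ℝ u ξ| ≤ ((1 + ‖ξ‖) * ‖ξ‖) * (‖u‖ * min 1 ‖u‖) := by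
  rw [abs_mul]
  have h1 : |Real.sin (inner ℝ u ξ)| ≤ (1 + ‖ξ‖) * min 1 ‖u‖ :=
    min_mul_le (norm_nonneg _) (norm_nonneg _)
      ((abs_sin_le_min _).trans (min_le_min le_rfl (abs_inner_le u ξ)))
  calc _ ≤ ((1 + ‖ξ‖) * min 1 ‖u‖) * (‖u‖ * ‖ξ‖) :=
        mul_le_mul h1 (abs_inner_le u ξ) (abs_nonneg _) (by positivity)
    _ = _ := by ring

theorem one_sub_cos_inner_le (u ξ : RSpace d) :
    1 - Real.cos (inner ℝ u ξ) ≤ (2 * ((1 + ‖ξ‖) * ‖ξ‖)) * (‖u‖ * min 1 ‖u‖) := by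
  have h0 : 1 - Real.cos (inner ℝ u ξ) = 2 * (|Real.sin (inner ℝ u ξ / 2)| *
      |Real.sin (inner ℝ u ξ / 2)|) := by
    rw [abs_mul_abs_self, ← sq, Real.sin_sq_eq_half_sub]
    rw [show 2 * (inner ℝ u ξ / 2) = inner ℝ u ξ by ring]
    ring
  have h2 : |inner ℝ u ξ / 2| ≤ ‖u‖ * ‖ξ‖ := by
    rw [abs_div, abs_two]
    have := abs_inner_le u ξ
    linarith [abs_nonneg (inner ℝ u ξ)]
  have h1 : |Real.sin (inner ℝ u ξ / 2)| ≤ (1 + ‖ξ‖) * min 1 ‖u‖ :=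
    min_mul_le (norm_nonneg _) (norm_nonneg _)
      ((abs_sin_le_min _).trans (min_le_min le_rfl h2))
  have h3 := mul_le_mul h1 (Real.abs_sin_le_abs.trans h2) (abs_nonneg _) (by positivity)
  rw [h0]
  linarith

theorem integrable_one_sub_cos (h1 : 1 < α) (h2 : α < 2) (hν : IsStableLevyMeasure α ν)
    (ξ : RSpace d) : Integrable (fun u => 1 - Real.cos (inner ℝ u ξ)) ν := by
  refine ((integrable_levy_moment h1 h2 hν).const_mul (2 * ((1 + ‖ξ‖) * ‖ξ‖))).mono'
    (by fun_prop) (ae_of_all _ fun u => ?_)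
  rw [Real.norm_of_nonneg (by simpa using Real.cos_le_one _)]
  exact one_sub_cos_inner_le u ξ

theorem integrable_abs_inner_rpow (hα : 0 < α) (σ : Measure (USphere d)) [IsFiniteMeasure σ]
    (ξ : RSpace d) : Integrable (fun y : USphere d => |inner ℝ (y : RSpace d) ξ| ^ α) σ := by
  refine (integrable_const (‖ξ‖ ^ α)).mono' ?_ (ae_of_all _ fun y => ?_)
  · have : Measurable fun y : USphere d => |inner ℝ (y : RSpace d) ξ| ^ α := by fun_prop
    exact this.aestronglyMeasurable
  · rw [Real.norm_of_nonneg (by positivity)]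
    refine Real.rpow_le_rpow (abs_nonneg _) ?_ hα.le
    simpa [norm_eq_of_mem_sphere] using abs_inner_le (y : RSpace d) ξ

/-- In polar coordinates the radial integral of `1 - cos (r s)` is `cosConst α * |s| ^ α`, and
`cosConst α` is exactly the factor between `σ` and the spectral measure. Hence `Ψ = σ_α ^ α`. -/
theorem levyExponent_eq (h1 : 1 < α) (h2 : α < 2) (hν : IsStableLevyMeasure α ν) (ξ : RSpace d) :
    levyExponent ν ξ = ∫ y : USphere d, |inner ℝ (y : RSpace d) ξ| ^ α ∂(spectralMeasure α ν) := by
  have := isFiniteMeasure_sphericalPart hν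
  have hc := cosConst_pos h1 h2
  have hm : Measurable fun y : USphere d => |inner ℝ (y : RSpace d) ξ| ^ α := by fun_prop
  rw [levyExponent, integral_eq_lintegral_of_nonneg_ae
    (ae_of_all _ fun u => by simpa using Real.cos_le_one _) (by fun_prop),
    integral_eq_lintegral_of_nonneg_ae (ae_of_all _ fun u => by positivity)
      hm.aestronglyMeasurable, spectralMeasure, lintegral_smul_measure,
    lintegral_levy (by linarith) hν (by fun_prop)]
  simp only [inner_smul_left, RCLike.conj_to_real, lintegral_one_sub_cos_mul h1 h2,
    ENNReal.ofReal_mul hc.le]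
  rw [lintegral_const_mul _ hm.ennreal_ofReal]
  rfl

theorem sigmaNorm_rpow (h1 : 1 < α) (h2 : α < 2) (hν : IsStableLevyMeasure α ν) (ξ : RSpace d) :
    sigmaNorm α ν ξ = levyExponent ν ξ ^ (1 / α) := by
  rw [sigmaNorm, levyExponent_eq h1 h2 hν]

theorem sigmaNorm_nonneg (ξ : RSpace d) : 0 ≤ sigmaNorm α ν ξ :=
  Real.rpow_nonneg (integral_nonneg fun _ => by positivity) _

theorem levyExponent_smul (h1 : 1 < α) (h2 : α < 2) (hν : IsStableLevyMeasure α ν)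
    {c : ℝ} (hc : 0 ≤ c) (ξ : RSpace d) :
    levyExponent ν (c • ξ) = c ^ α * levyExponent ν ξ := by
  rw [levyExponent_eq h1 h2 hν, levyExponent_eq h1 h2 hν, ← integral_const_mul]
  refine integral_congr_ae (ae_of_all _ fun y => ?_)
  dsimp only
  rw [inner_smul_right, abs_mul, abs_of_nonneg hc, Real.mul_rpow hc (abs_nonneg _)]

theorem levyExponent_neg (ν : Measure (RSpace d)) (ξ : RSpace d) :
    levyExponent ν (-ξ) = levyExponent ν ξ := by
  simp [levyExponent]

theorem isFiniteMeasure_spectralMeasure (hν : IsStableLevyMeasure α ν) :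
    IsFiniteMeasure (spectralMeasure α ν) := by
  have := isFiniteMeasure_sphericalPart hν
  unfold spectralMeasure
  exact Measure.smul_finite _ ENNReal.ofReal_ne_top

theorem levyExponent_le (h1 : 1 < α) (h2 : α < 2) (hν : IsStableLevyMeasure α ν) :
    ∃ C : ℝ, 0 ≤ C ∧ ∀ ξ, levyExponent ν ξ ≤ C * ‖ξ‖ ^ α := by
  have := isFiniteMeasure_spectralMeasure hν
  refine ⟨(spectralMeasure α ν).real univ, by positivity, fun ξ => ?_⟩
  rw [levyExponent_eq h1 h2 hν]
  calc _ ≤ ∫ y : USphere d, ‖ξ‖ ^ α ∂(spectralMeasure α ν) := by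
        refine integral_mono (integrable_abs_inner_rpow (by linarith) _ ξ) (integrable_const _)
          fun y => ?_
        refine Real.rpow_le_rpow (abs_nonneg _) ?_ (by linarith)
        simpa [norm_eq_of_mem_sphere] using abs_inner_le (y : RSpace d) ξ
    _ = _ := by simp

theorem le_levyExponent (h1 : 1 < α) (h2 : α < 2) (hν : IsStableLevyMeasure α ν)
    (hnd : IsNondegenerateLevy α ν) :
    ∃ c : ℝ, 0 < c ∧ ∀ ξ, c * ‖ξ‖ ^ α ≤ levyExponent ν ξ := by
  -- The constant is the infimum in the nondegeneracy hypothesis; homogeneity carries the bound from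
  -- the sphere to all `ξ`.
  refine ⟨_, hnd, fun ξ => ?_⟩
  rcases eq_or_ne ξ 0 with rfl | hξ
  · simp [Real.zero_rpow (by linarith : α ≠ 0), levyExponent]
  have hξ0 : 0 < ‖ξ‖ := norm_pos_iff.2 hξ
  let y : USphere d := ⟨‖ξ‖⁻¹ • ξ, by simp [norm_smul, hξ]⟩
  have hb : BddBelow (range fun y : USphere d =>
      ∫ x : USphere d, |inner ℝ (y : RSpace d) (x : RSpace d)| ^ α ∂(spectralMeasure α ν)) :=
    ⟨0, by rintro _ ⟨y, rfl⟩; exact integral_nonneg fun _ => by positivity⟩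
  have h3 := ciInf_le hb y
  have h4 : ∫ x : USphere d, |inner ℝ (y : RSpace d) (x : RSpace d)| ^ α ∂(spectralMeasure α ν) =
      levyExponent ν (y : RSpace d) := by
    rw [levyExponent_eq h1 h2 hν]
    simp only [real_inner_comm]
  rw [h4] at h3
  have h5 : ξ = ‖ξ‖ • (y : RSpace d) := by simp [y, smul_smul, hξ]
  calc _ ≤ levyExponent ν (y : RSpace d) * ‖ξ‖ ^ α := by gcongr
    _ = levyExponent ν ξ := by
        conv_rhs => rw [h5, levyExponent_smul h1 h2 hν hξ0.le]
        ring

theorem continuous_levyExponent (h1 : 1 < α) (h2 : α < 2) (hν : IsStableLevyMeasure α ν) :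
    Continuous (levyExponent ν) := by
  refine continuous_iff_continuousAt.2 fun ξ₀ => ?_
  refine continuousAt_of_dominated (bound := fun u =>
    (2 * ((1 + (‖ξ₀‖ + 1)) * (‖ξ₀‖ + 1))) * (‖u‖ * min 1 ‖u‖)) ?_ ?_ ?_ ?_
  · exact Eventually.of_forall fun ξ => by fun_prop
  · filter_upwards [Metric.ball_mem_nhds ξ₀ one_pos] with ξ hξ
    refine ae_of_all _ fun u => ?_
    have h3 : ‖ξ‖ ≤ ‖ξ₀‖ + 1 := by
      have := norm_le_norm_add_norm_sub' ξ ξ₀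
      rw [mem_ball_iff_norm] at hξ
      linarith
    rw [Real.norm_of_nonneg (by simpa using Real.cos_le_one _)]
    refine (one_sub_cos_inner_le u ξ).trans ?_
    gcongr
  · exact (integrable_levy_moment h1 h2 hν).const_mul _
  · exact ae_of_all _ fun u => by fun_prop

theorem integrable_sin_mul_inner (h1 : 1 < α) (h2 : α < 2) (hν : IsStableLevyMeasure α ν)
    (ξ : RSpace d) : Integrable (fun u => Real.sin (inner ℝ u ξ) * inner ℝ u ξ) ν :=
  ((integrable_levy_moment h1 h2 hν).const_mul ((1 + ‖ξ‖) * ‖ξ‖)).mono'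
    (by fun_prop) (ae_of_all _ fun u => abs_sin_mul_inner_le u ξ)

/-- Euler's identity for the homogeneous function `levyExponent ν`. -/
theorem integral_sin_mul_inner (h1 : 1 < α) (h2 : α < 2) (hν : IsStableLevyMeasure α ν)
    (ξ : RSpace d) :
    ∫ u, Real.sin (inner ℝ u ξ) * inner ℝ u ξ ∂ν = α * levyExponent ν ξ := by
  -- By homogeneity the integral of `1 - cos (c ⟨u ; ξ⟩)` is `c ^ α Ψ(ξ)`. Both expressions are
  -- differentiated in `c` at `1`; the majorant uses `|c| ≤ 2`.
  have key := hasDerivAt_integral_of_dominated_loc_of_deriv_le (μ := ν) (𝕜 := ℝ)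
    (F := fun c u => 1 - Real.cos (c * inner ℝ u ξ))
    (F' := fun c u => Real.sin (c * inner ℝ u ξ) * inner ℝ u ξ) (x₀ := 1)
    (s := Metric.ball 1 1)
    (bound := fun u => (1 + 2 * ‖ξ‖) * ‖ξ‖ * (‖u‖ * min 1 ‖u‖))
    (Metric.ball_mem_nhds _ one_pos) (Eventually.of_forall fun c => by fun_prop)
    (by simpa using integrable_one_sub_cos h1 h2 hν ξ) (by fun_prop)
    (ae_of_all _ fun u c hc => ?_) ((integrable_levy_moment h1 h2 hν).const_mul _)
    (ae_of_all _ fun u c _ => ?_)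
  · have h3 : HasDerivAt (fun c : ℝ => c ^ α * levyExponent ν ξ) (α * levyExponent ν ξ) 1 := by
      have := (Real.hasDerivAt_rpow_const (x := 1) (p := α) (Or.inl one_ne_zero)).mul_const
        (levyExponent ν ξ)
      simpa using this
    have h4 : HasDerivAt (fun c : ℝ => ∫ u, (1 - Real.cos (c * inner ℝ u ξ)) ∂ν)
        (α * levyExponent ν ξ) 1 := by
      refine h3.congr_of_eventuallyEq ?_
      filter_upwards [lt_mem_nhds (zero_lt_one (α := ℝ))] with c hc
      rw [← levyExponent_smul h1 h2 hν hc.le, levyExponent]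
      simp only [inner_smul_right]
    have := key.2.unique h4
    simpa using this
  · have hc2 : |c| ≤ 2 := by
      rw [Metric.mem_ball, Real.dist_eq, abs_lt] at hc
      rw [abs_le]
      constructor <;> linarith [hc.1, hc.2]
    have h5 : |c * inner ℝ u ξ| ≤ ‖u‖ * (2 * ‖ξ‖) := by
      rw [abs_mul]
      have := mul_le_mul hc2 (abs_inner_le u ξ) (abs_nonneg _) zero_le_two
      linarith
    rw [Real.norm_eq_abs, abs_mul]
    have h6 : |Real.sin (c * inner ℝ u ξ)| ≤ (1 + 2 * ‖ξ‖) * min 1 ‖u‖ :=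
      min_mul_le (by positivity) (norm_nonneg _)
        ((abs_sin_le_min _).trans (min_le_min le_rfl h5))
    calc _ ≤ ((1 + 2 * ‖ξ‖) * min 1 ‖u‖) * (‖u‖ * ‖ξ‖) :=
          mul_le_mul h6 (abs_inner_le u ξ) (abs_nonneg _) (by positivity)
      _ = _ := by ring
  · have := ((hasDerivAt_id c).mul_const (inner ℝ u ξ)).cos.const_sub 1
    simpa using this

/-- The imaginary part `sin ⟨u ; ξ⟩ - ⟨u ; ξ⟩` of the Lévy–Khintchine integrand is odd, so it
integrates to zero by symmetry and only the cosine part remains. Its integrability, needed to split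
the integral, combines a linear bound for large jumps with a quadratic one for small jumps. -/
theorem charFun_stableLaw (h1 : 1 < α) (h2 : α < 2) (hν : IsStableLevyMeasure α ν)
    (hs : IsSymmetricLevy α ν) {μ : Measure (RSpace d)} (hμ : IsStableLaw ν μ) (ξ : RSpace d) :
    charFun μ ξ = (Real.exp (-levyExponent ν ξ) : ℝ) := by
  have hmap := levy_map_neg (by linarith) hν hs
  have h3 : ∀ u : RSpace d, Complex.exp (Complex.I * (inner ℝ u ξ : ℝ)) - 1
        - Complex.I * (inner ℝ ξ u : ℝ) = ((-(1 - Real.cos (inner ℝ u ξ)) : ℝ) : ℂ) +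
      ((Real.sin (inner ℝ u ξ) - inner ℝ u ξ : ℝ) : ℂ) * Complex.I := by
    intro u
    rw [mul_comm, Complex.exp_mul_I, real_inner_comm u ξ]
    push_cast
    ring
  have hodd : ∫ u, (Real.sin (inner ℝ u ξ) - inner ℝ u ξ) ∂ν = 0 :=
    integral_odd_eq_zero hmap fun u => by rw [inner_neg_left, Real.sin_neg]; ring
  have hi : Integrable (fun u => Real.sin (inner ℝ u ξ) - inner ℝ u ξ) ν := by
    refine ((integrable_levy_moment h1 h2 hν).const_mul (2 * (‖ξ‖ + ‖ξ‖ ^ 2))).mono'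
      (by fun_prop) (ae_of_all _ fun u => ?_)
    set t := inner ℝ u ξ with ht
    have hb : |t| ≤ ‖u‖ * ‖ξ‖ := abs_inner_le u ξ
    have h4 : |Real.sin t - t| ≤ 2 * |t| := by
      have := abs_sub (Real.sin t) t
      have := Real.abs_sin_le_abs (x := t)
      linarith
    rw [Real.norm_eq_abs]
    rcases le_total 1 ‖u‖ with hu | hu
    · rw [min_eq_left hu]
      nlinarith [norm_nonneg u, sq_nonneg ‖ξ‖]
    · rw [min_eq_right hu]
      have h5 : |Real.sin t - t| ≤ 2 * t ^ 2 := by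
        rcases le_total 1 |t| with h6 | h6
        · rw [← sq_abs]
          nlinarith [abs_nonneg t]
        · have h7 := Real.sin_bound (x := t) h6
          have h8 : |t| ^ 3 ≤ t ^ 2 := by
            rw [← sq_abs]; nlinarith [abs_nonneg t, sq_nonneg |t|]
          have h9 : |t| ^ 5 ≤ t ^ 2 := by
            rw [← sq_abs]
            exact pow_le_pow_of_le_one (abs_nonneg _) h6 (by norm_num)
          have h10 : Real.sin t - t = (Real.sin t - (t - t ^ 3 / 6)) - t ^ 3 / 6 := by ring
          rw [h10]
          have h11 := abs_sub (Real.sin t - (t - t ^ 3 / 6)) (t ^ 3 / 6)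
          rw [abs_div, abs_pow, abs_of_pos (by norm_num : (0 : ℝ) < 6)] at h11
          nlinarith [sq_nonneg t]
      have h6 : t ^ 2 ≤ (‖u‖ * ‖ξ‖) ^ 2 := by
        rw [← sq_abs t]
        exact pow_le_pow_left₀ (abs_nonneg _) hb 2
      nlinarith [mul_nonneg (norm_nonneg ξ) (sq_nonneg ‖u‖)]
  have h4 := hμ.2 ξ
  simp only [h3] at h4
  rw [integral_add (integrable_one_sub_cos h1 h2 hν ξ).neg.ofReal (hi.ofReal.mul_const _),
    integral_mul_const, integral_complex_ofReal, integral_complex_ofReal, hodd, integral_neg] at h4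
  rw [charFun_apply, levyExponent]
  push_cast at h4 ⊢
  rw [zero_mul, add_zero] at h4
  rw [← h4]
  simp only [mul_comm]

theorem continuous_charFun_of_isFiniteMeasure (m : Measure (RSpace d)) [IsFiniteMeasure m] :
    Continuous (charFun m) := by
  have h := VectorFourier.fourierIntegral_continuous (μ := m) (L := innerₗ (RSpace d))
    (e := Real.probChar) (f := 1) Real.continuous_probChar continuous_inner (integrable_const (1 : ℂ))
  have h2 : charFun m = fun t => VectorFourier.fourierIntegral Real.probChar m
      (innerₗ (RSpace d)) 1 (-t) := funext fun t => charFun_eq_fourierIntegral t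
  rw [h2]
  exact h.comp continuous_neg

end LevyMeasure

/-! ### Functions whose Fourier transform has two moments -/

section FourierRep

open scoped FourierTransform InnerProductSpace

variable {d : ℕ}

theorem integrable_fourierSMulRight {F : Type*} [NormedAddCommGroup F] [NormedSpace ℂ F]
    {h : RSpace d → F} (hh : Integrable h) (h1 : Integrable fun ξ => ‖ξ‖ * ‖h ξ‖) :
    Integrable (VectorFourier.fourierSMulRight (innerSL ℝ) h) := by
  refine (h1.const_mul (2 * Real.pi * ‖(innerSL ℝ : RSpace d →L[ℝ] RSpace d →L[ℝ] ℝ)‖)).mono'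
    hh.1.fourierSMulRight (ae_of_all _ fun ξ => ?_)
  refine (VectorFourier.norm_fourierSMulRight_le _ _ _).trans_eq (by ring)

/-- The derivative of `𝓕 h` is the transform of a linear-map-valued `H` of size `|ξ| |h|`. The
second moment of `h` is the first moment of `H`, so this derivative is itself differentiable with
bounded derivative. -/
theorem lipschitz_fderiv_fourier {h : RSpace d → ℂ} (h0 : Integrable h)
    (h1 : Integrable fun ξ => ‖ξ‖ * ‖h ξ‖) (h2 : Integrable fun ξ => ‖ξ‖ ^ 2 * ‖h ξ‖) :
    ∃ C : ℝ, 0 ≤ C ∧ ∀ x y, ‖fderiv ℝ (𝓕 h) y - fderiv ℝ (𝓕 h) x‖ ≤ C * ‖y - x‖ := by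
  set H := VectorFourier.fourierSMulRight (innerSL ℝ) h with hH
  have hH0 : Integrable H := integrable_fourierSMulRight h0 h1
  have hH1 : Integrable fun ξ => ‖ξ‖ * ‖H ξ‖ := by
    refine (h2.const_mul (2 * Real.pi * ‖(innerSL ℝ : RSpace d →L[ℝ] RSpace d →L[ℝ] ℝ)‖)).mono'
      (by fun_prop) (ae_of_all _ fun ξ => ?_)
    rw [Real.norm_of_nonneg (by positivity)]
    have := VectorFourier.norm_fourierSMulRight_le (innerSL ℝ) h ξ
    calc ‖ξ‖ * ‖H ξ‖ ≤ ‖ξ‖ * (2 * Real.pi *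
          ‖(innerSL ℝ : RSpace d →L[ℝ] RSpace d →L[ℝ] ℝ)‖ * ‖ξ‖ * ‖h ξ‖) := by gcongr
      _ = _ := by ring
  have hd := Real.fderiv_fourier h0 h1
  refine ⟨∫ ξ, ‖VectorFourier.fourierSMulRight (innerSL ℝ) H ξ‖, by positivity, fun x y => ?_⟩
  rw [hd]
  refine Convex.norm_image_sub_le_of_norm_hasFDerivWithin_le (𝕜 := ℝ) (s := univ)
    (fun z _ => (Real.hasFDerivAt_fourier hH0 hH1 z).hasFDerivWithinAt) (fun z _ => ?_) convex_univ
    (mem_univ _) (mem_univ _)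
  exact VectorFourier.norm_fourierIntegral_le_integral_norm _ _ _ _ _

/-- `g` is the Fourier transform of `h`, which has a finite second moment. -/
structure FourierRep (g : RSpace d → ℝ) (h : RSpace d → ℂ) : Prop where
  int0 : Integrable h
  int2 : Integrable fun ξ => ‖ξ‖ ^ 2 * ‖h ξ‖
  eq : ∀ x, (g x : ℂ) = 𝓕 h x

namespace FourierRep

variable {g : RSpace d → ℝ} {h : RSpace d → ℂ}

theorem int1 (H : FourierRep g h) : Integrable fun ξ => ‖ξ‖ * ‖h ξ‖ := by
  have hm := H.int0.1
  refine (H.int0.norm.add H.int2).mono' (by fun_prop) (ae_of_all _ fun ξ => ?_)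
  rw [Real.norm_of_nonneg (by positivity)]
  simp only [Pi.add_apply]
  nlinarith [norm_nonneg (h ξ), mul_nonneg (norm_nonneg (h ξ)) (sq_nonneg (‖ξ‖ - 1)),
    mul_nonneg (norm_nonneg (h ξ)) (sq_nonneg ‖ξ‖)]

theorem eq_fun (H : FourierRep g h) : (fun x => (g x : ℂ)) = 𝓕 h := funext H.eq

theorem eq_re (H : FourierRep g h) : g = fun x => (𝓕 h x).re := by
  funext x
  rw [← H.eq, Complex.ofReal_re]

theorem contDiff (H : FourierRep g h) : ContDiff ℝ 1 g := by
  rw [H.eq_re]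
  refine Complex.reCLM.contDiff.comp ?_
  refine Real.contDiff_fourier (N := 1) fun n hn => ?_
  have hn' : n ≤ 1 := by exact_mod_cast hn
  interval_cases n
  · simpa using H.int0.norm
  · simpa using H.int1

theorem hasFDerivAt_complex (H : FourierRep g h) (x : RSpace d) :
    HasFDerivAt (𝓕 h) (Complex.ofRealCLM ∘L fderiv ℝ g x) x := by
  rw [← H.eq_fun]
  have h1 := (H.contDiff.differentiable one_ne_zero x).hasFDerivAt
  exact Complex.ofRealCLM.hasFDerivAt.comp x h1

theorem inner_gradient (H : FourierRep g h) (x v : RSpace d) :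
    ((inner ℝ (gradient g x) v : ℝ) : ℂ) =
      𝓕 (fun ξ => -(2 * Real.pi * Complex.I * (inner ℝ ξ v : ℝ)) * h ξ) x := by
  have h1 := (H.hasFDerivAt_complex x).unique (Real.hasFDerivAt_fourier H.int0 H.int1 x)
  have h2 := DFunLike.congr_fun h1 v
  rw [Real.fourier_continuousLinearMap_apply
    (integrable_fourierSMulRight H.int0 H.int1)] at h2
  simp only [ContinuousLinearMap.comp_apply, Complex.ofRealCLM_apply] at h2
  rw [gradient, InnerProductSpace.toDual_symm_apply, h2]
  refine congrArg (fun f : RSpace d → ℂ => (𝓕 f : RSpace d → ℂ) x) (funext fun ξ => ?_)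
  change -(2 * Real.pi * Complex.I) • (inner ℝ ξ v : ℝ) • h ξ = _
  rw [Complex.real_smul, smul_eq_mul]
  ring

theorem lipschitz_gradient (H : FourierRep g h) :
    ∃ C : ℝ, 0 ≤ C ∧ ∀ x y, ‖gradient g y - gradient g x‖ ≤ C * ‖y - x‖ := by
  obtain ⟨C, hC, hl⟩ := lipschitz_fderiv_fourier H.int0 H.int1 H.int2
  refine ⟨C, hC, fun x y => le_trans ?_ (hl x y)⟩
  rw [gradient, gradient, ← map_sub, LinearIsometryEquiv.norm_map,
    (H.hasFDerivAt_complex x).fderiv, (H.hasFDerivAt_complex y).fderiv, ← ContinuousLinearMap.comp_sub]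
  refine ContinuousLinearMap.opNorm_le_bound _ (norm_nonneg _) fun v => ?_
  have := (Complex.ofRealCLM ∘L (fderiv ℝ g y - fderiv ℝ g x)).le_opNorm v
  rwa [ContinuousLinearMap.comp_apply, Complex.ofRealCLM_apply, Complex.norm_real] at this

theorem continuous_gradient (H : FourierRep g h) : Continuous (gradient g) := by
  have := H.contDiff.continuous_fderiv one_ne_zero
  exact (InnerProductSpace.toDual ℝ (RSpace d)).symm.continuous.comp this

theorem hasGradientAt (H : FourierRep g h) (x : RSpace d) : HasGradientAt g (gradient g x) x :=
  (H.contDiff.differentiable one_ne_zero x).hasGradientAt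

theorem abs_le (H : FourierRep g h) (x : RSpace d) : |g x| ≤ ∫ ξ, ‖h ξ‖ := by
  have h1 : ‖(g x : ℂ)‖ ≤ ∫ ξ, ‖h ξ‖ := by
    rw [H.eq]
    exact VectorFourier.norm_fourierIntegral_le_integral_norm _ _ _ _ _
  simpa using h1

theorem norm_gradient_le (H : FourierRep g h) :
    ∃ C : ℝ, 0 ≤ C ∧ ∀ x, ‖gradient g x‖ ≤ C := by
  refine ⟨2 * Real.pi * ∫ ξ, ‖ξ‖ * ‖h ξ‖, by positivity, fun x => ?_⟩
  rcases eq_or_ne (gradient g x) 0 with h0 | h0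
  · rw [h0, norm_zero]; positivity
  -- Pairing the gradient with itself and dividing by its norm turns the directional bound into a
  -- bound on the norm.
  have h1 : ‖((inner ℝ (gradient g x) (gradient g x) : ℝ) : ℂ)‖ ≤
      ∫ ξ, 2 * Real.pi * ‖gradient g x‖ * (‖ξ‖ * ‖h ξ‖) := by
    rw [H.inner_gradient]
    refine (VectorFourier.norm_fourierIntegral_le_integral_norm _ _ _ _ _).trans ?_
    refine integral_mono_of_nonneg (ae_of_all _ fun ξ => norm_nonneg _) (H.int1.const_mul _)
      (ae_of_all _ fun ξ => ?_)
    simp only [norm_mul, norm_neg, Complex.norm_real, Complex.norm_I, mul_one, Complex.norm_two]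
    rw [Real.norm_of_nonneg Real.pi_pos.le]
    have := abs_inner_le ξ (gradient g x)
    calc _ ≤ 2 * Real.pi * (‖ξ‖ * ‖gradient g x‖) * ‖h ξ‖ := by
          gcongr; exact this
      _ = _ := by ring
  rw [integral_const_mul, Complex.norm_real, real_inner_self_eq_norm_sq, norm_pow, norm_norm] at h1
  have h2 : 0 < ‖gradient g x‖ := norm_pos_iff.2 h0
  nlinarith

/-- Averaging translates multiplies the transform by a bounded function, so the class is stable
under the semigroup. -/
theorem translate_average (H : FourierRep g h) (m : Measure (RSpace d)) [IsFiniteMeasure m] :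
    FourierRep (fun x => ∫ y, g (x + y) ∂m)
      (fun ξ => h ξ * charFun m (-(2 * Real.pi) • ξ)) := by
  have hm := H.int0.1
  have hc : Measurable fun ξ : RSpace d => charFun m (-(2 * Real.pi) • ξ) :=
    measurable_charFun.comp (measurable_const_smul _)
  have hcb : ∀ ξ, ‖charFun m (-(2 * Real.pi) • ξ)‖ ≤ m.real univ := fun ξ => norm_charFun_le _
  refine ⟨?_, ?_, fun x => ?_⟩
  · exact H.int0.mul_bdd (c := m.real univ) hc.aestronglyMeasurable (ae_of_all _ hcb)
  · refine (H.int2.mul_const (m.real univ)).mono' (by fun_prop) (ae_of_all _ fun ξ => ?_)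
    rw [Real.norm_of_nonneg (by positivity), norm_mul, ← mul_assoc]
    gcongr
    exact hcb ξ
  · rw [fourier_mul_charFun m H.int0, ← integral_complex_ofReal]
    simp only [H.eq]

theorem integrable_gradient (H : FourierRep g h) (m : Measure (RSpace d)) [IsFiniteMeasure m]
    (x : RSpace d) : Integrable (fun y => gradient g (x + y)) m := by
  obtain ⟨C, hC, hb⟩ := H.norm_gradient_le
  have := H.continuous_gradient
  exact (integrable_const C).mono' (by fun_prop) (ae_of_all _ fun y => hb _)

theorem integrable_translate (H : FourierRep g h) (m : Measure (RSpace d)) [IsFiniteMeasure m]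
    (x : RSpace d) : Integrable (fun y => g (x + y)) m := by
  have := H.contDiff.continuous
  exact (integrable_const _).mono' (by fun_prop) (ae_of_all _ fun y => H.abs_le _)

/-- Checked against each vector `v` on the Fourier side, where both operations are multiplications.
-/
theorem gradient_translate_average (H : FourierRep g h) (m : Measure (RSpace d))
    [IsFiniteMeasure m] (x : RSpace d) :
    gradient (fun x => ∫ y, g (x + y) ∂m) x = ∫ y, gradient g (x + y) ∂m := by
  refine ext_inner_right ℝ fun v => ?_
  have h1 := (H.translate_average m).inner_gradient x v
  have hi : Integrable fun ξ => -(2 * Real.pi * Complex.I * (inner ℝ ξ v : ℝ)) * h ξ := by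
    have hm := H.int0.1
    refine (H.int1.const_mul (2 * Real.pi * ‖v‖)).mono' (by fun_prop) (ae_of_all _ fun ξ => ?_)
    simp only [norm_mul, norm_neg, Complex.norm_real, Complex.norm_I, mul_one, Complex.norm_two]
    rw [Real.norm_of_nonneg Real.pi_pos.le]
    calc _ ≤ 2 * Real.pi * (‖ξ‖ * ‖v‖) * ‖h ξ‖ := by
          gcongr; exact abs_inner_le ξ v
      _ = _ := by ring
  have h2 := fourier_mul_charFun m hi x
  simp only [← H.inner_gradient] at h2
  rw [integral_complex_ofReal] at h2
  have h3 : ∫ y, inner ℝ (gradient g (x + y)) v ∂m = inner ℝ (∫ y, gradient g (x + y) ∂m) v := by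
    rw [real_inner_comm, ← integral_inner (H.integrable_gradient m x)]
    simp only [real_inner_comm]
  rw [← h3]
  have h4 : ((inner ℝ (gradient (fun x => ∫ y, g (x + y) ∂m) x) v : ℝ) : ℂ) =
      ((∫ y, inner ℝ (gradient g (x + y)) v ∂m : ℝ) : ℂ) := by
    rw [h1, ← h2]
    refine congrArg (fun f : RSpace d → ℂ => (𝓕 f : RSpace d → ℂ) x) (funext fun ξ => ?_)
    ring
  exact_mod_cast h4

/-- A nonnegative function with Lipschitz gradient satisfies `|∇g|² ≤ C g`. -/
theorem norm_gradient_sq_le (H : FourierRep g h) (h0 : ∀ x, 0 ≤ g x) :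
    ∃ C : ℝ, 0 < C ∧ ∀ x, ‖gradient g x‖ ^ 2 ≤ C * g x := by
  obtain ⟨M, hM, hl⟩ := H.lipschitz_gradient
  refine ⟨4 * (M + 1), by positivity, fun x => ?_⟩
  set w := gradient g x with hw
  -- Descent along `-w`: `0 ≤ g (x - s w) ≤ g x - s |w|² + M s² |w|²`, and this `s` makes the last
  -- term at most `s |w|² / 2`. Using `M + 1` covers `M = 0`.
  set s : ℝ := 1 / (2 * (M + 1)) with hs
  have hs0 : 0 < s := by positivity
  have key := Convex.norm_image_sub_le_of_norm_hasFDerivWithin_le' (𝕜 := ℝ)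
    (s := Metric.closedBall x (s * ‖w‖)) (f := g)
    (f' := fun z => InnerProductSpace.toDual ℝ (RSpace d) (gradient g z))
    (φ := InnerProductSpace.toDual ℝ (RSpace d) w) (C := M * (s * ‖w‖)) (x := x) (y := x - s • w)
    (fun z _ => (H.hasGradientAt z).hasFDerivAt.hasFDerivWithinAt)
    (fun z hz => ?_) (convex_closedBall _ _) (Metric.mem_closedBall_self (by positivity))
    (by simp [norm_smul, abs_of_pos hs0])
  · have h1 : x - s • w - x = -(s • w) := by abel
    rw [h1, norm_neg, norm_smul, Real.norm_of_nonneg hs0.le, Real.norm_eq_abs] at key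
    have h2 := (_root_.abs_le.1 key).2
    simp only [map_neg, InnerProductSpace.toDual_apply_apply, inner_smul_right,
      real_inner_self_eq_norm_sq] at h2
    have h3 := h0 (x - s • w)
    have h4 : s * (M + 1) = 1 / 2 := by rw [hs]; field_simp
    have h5 : M * (s * ‖w‖) * (s * ‖w‖) ≤ (s * (M + 1)) * s * ‖w‖ ^ 2 := by
      have : 0 ≤ s * s * ‖w‖ ^ 2 := by positivity
      nlinarith
    rw [h4] at h5
    have h6 : s / 2 * ‖w‖ ^ 2 ≤ g x := by linarith
    calc ‖w‖ ^ 2 = 4 * (M + 1) * (s / 2 * ‖w‖ ^ 2) := by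
          have : 4 * (M + 1) * (s / 2 * ‖w‖ ^ 2) = 2 * (s * (M + 1)) * ‖w‖ ^ 2 := by ring
          rw [this, h4]; ring
      _ ≤ _ := by gcongr
  · rw [← map_sub, LinearIsometryEquiv.norm_map]
    refine (hl x z).trans ?_
    gcongr
    simpa [dist_eq_norm] using hz

end FourierRep

theorem integrable_pow_mul_of_norm_le_exp {h : RSpace d → ℂ} (hm : AEStronglyMeasurable h)
    {A c : ℝ} (hc : 0 < c) (hb : ∀ ξ, ‖h ξ‖ ≤ A * Real.exp (-(c * ‖ξ‖))) (k : ℕ) :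
    Integrable fun ξ => ‖ξ‖ ^ k * ‖h ξ‖ := by
  -- The power `k` absorbs the weight, and `d + 1` leaves the integrable function `(1 + ‖ξ‖) ^ (-(d
  -- + 1))`.
  set n := k + (d + 1) with hn
  have hA : 0 ≤ A := by
    have := (norm_nonneg _).trans (hb 0)
    simpa using this
  have hi : Integrable fun ξ : RSpace d => (1 + ‖ξ‖) ^ (-((d : ℝ) + 1)) :=
    integrable_one_add_norm (by simp)
  refine (hi.const_mul (A * (n.factorial / c ^ n * Real.exp c))).mono' (by fun_prop)
    (ae_of_all _ fun ξ => ?_)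
  rw [Real.norm_of_nonneg (by positivity)]
  have h1 := Real.pow_div_factorial_le_exp (x := c * (1 + ‖ξ‖)) (by positivity) n
  have h2 : (1 + ‖ξ‖) ^ n * Real.exp (-(c * ‖ξ‖)) ≤ n.factorial / c ^ n * Real.exp c := by
    rw [mul_pow, div_le_iff₀ (by positivity), show c * (1 + ‖ξ‖) = c + c * ‖ξ‖ by ring,
      Real.exp_add] at h1
    rw [Real.exp_neg, ← div_eq_mul_inv, div_le_iff₀ (Real.exp_pos _), div_mul_eq_mul_div,
      div_mul_eq_mul_div, le_div_iff₀ (by positivity)]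
    linarith
  have h3 : (1 + ‖ξ‖) ^ (-((d : ℝ) + 1)) = ((1 + ‖ξ‖) ^ (d + 1))⁻¹ := by
    rw [Real.rpow_neg (by positivity)]
    congr 1
    exact_mod_cast Real.rpow_natCast (1 + ‖ξ‖) (d + 1)
  rw [h3, ← div_eq_mul_inv, le_div_iff₀ (by positivity)]
  calc ‖ξ‖ ^ k * ‖h ξ‖ * (1 + ‖ξ‖) ^ (d + 1)
      ≤ (1 + ‖ξ‖) ^ k * (A * Real.exp (-(c * ‖ξ‖))) * (1 + ‖ξ‖) ^ (d + 1) := by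
        gcongr
        · linarith
        · exact hb ξ
    _ = A * ((1 + ‖ξ‖) ^ n * Real.exp (-(c * ‖ξ‖))) := by rw [hn, pow_add]; ring
    _ ≤ _ := by gcongr

end FourierRep

/-! ### The law of the small jumps: exponential moments and integrable gradient -/

section SmallJumps

open scoped FourierTransform InnerProductSpace

variable {d : ℕ} {α : ℝ} {ν : Measure (RSpace d)}

theorem levy_tail_lt_top (h1 : 1 < α) (h2 : α < 2) (hν : IsStableLevyMeasure α ν)
    {r : ℝ} (hr : 0 < r) : ν {u | r < ‖u‖} < ∞ := by
  have hi := integrable_levy_moment h1 h2 hν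
  refine lt_of_le_of_lt (measure_mono fun u hu => ?_)
    (hi.measure_norm_ge_lt_top (ε := r * min 1 r) (by positivity))
  have hu : r < ‖u‖ := hu
  change r * min 1 r ≤ ‖‖u‖ * min 1 ‖u‖‖
  rw [Real.norm_of_nonneg (by positivity)]
  gcongr

theorem restrict_map_neg (hmap : ν.map (fun u => -u) = ν) {S : Set (RSpace d)}
    (hS : (fun u => -u) ⁻¹' S = S) : (ν.restrict S).map (fun u => -u) = ν.restrict S := by
  have he : MeasurableEmbedding (fun u : RSpace d => -u) :=
    (MeasurableEquiv.neg (RSpace d)).measurableEmbedding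
  conv_rhs => rw [← hmap, he.restrict_map, hS]

/-- The jumps of size in `(1 / (n + 1), 1]`. -/
def smallJumpShell (d n : ℕ) : Set (RSpace d) := {u | 1 / ((n : ℝ) + 1) < ‖u‖ ∧ ‖u‖ ≤ 1}

theorem measurableSet_smallJumpShell (n : ℕ) : MeasurableSet (smallJumpShell d n) :=
  (measurableSet_lt measurable_const measurable_norm).inter
    (measurableSet_le measurable_norm measurable_const)

theorem isFiniteMeasure_smallJumps (h1 : 1 < α) (h2 : α < 2) (hν : IsStableLevyMeasure α ν)
    (n : ℕ) : IsFiniteMeasure (ν.restrict (smallJumpShell d n)) := by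
  refine ⟨?_⟩
  rw [Measure.restrict_apply_univ]
  exact lt_of_le_of_lt (measure_mono fun u hu => hu.1)
    (levy_tail_lt_top h1 h2 hν (r := 1 / ((n : ℝ) + 1)) (by positivity))

theorem isFiniteMeasure_largeJumps (h1 : 1 < α) (h2 : α < 2) (hν : IsStableLevyMeasure α ν) :
    IsFiniteMeasure (ν.restrict {u | 1 < ‖u‖}) := by
  refine ⟨?_⟩
  rw [Measure.restrict_apply_univ]
  exact levy_tail_lt_top h1 h2 hν one_pos

/-- The shells increase to the punctured unit ball, and `ν` does not charge the origin. -/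
theorem tendsto_levyExponent_smallJumps (h1 : 1 < α) (h2 : α < 2) (hν : IsStableLevyMeasure α ν)
    (ξ : RSpace d) :
    Tendsto (fun n => levyExponent (ν.restrict (smallJumpShell d n)) ξ) atTop
      (𝓝 (levyExponent (ν.restrict {u | ‖u‖ ≤ 1}) ξ)) := by
  have hU : ⋃ n, smallJumpShell d n = {u : RSpace d | ‖u‖ ≤ 1} \ {0} := by
    ext u
    simp only [mem_iUnion, smallJumpShell, mem_ofPred_eq, Set.mem_sdiff, mem_singleton_iff]
    constructor
    · rintro ⟨n, hn, hu⟩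
      refine ⟨hu, ?_⟩
      rintro rfl
      rw [norm_zero] at hn
      exact absurd hn (not_lt.2 (by positivity))
    · rintro ⟨hu, h0⟩
      obtain ⟨n, hn⟩ := exists_nat_one_div_lt (norm_pos_iff.2 h0)
      exact ⟨n, hn, hu⟩
  have hmono : Monotone (smallJumpShell d) := by
    intro m n hmn u hu
    refine ⟨lt_of_le_of_lt ?_ hu.1, hu.2⟩
    gcongr
  have ht := tendsto_setIntegral_of_monotone (μ := ν)
    (f := fun u : RSpace d => 1 - Real.cos (inner ℝ u ξ)) measurableSet_smallJumpShell hmono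
    (integrable_one_sub_cos h1 h2 hν ξ).integrableOn
  rw [hU] at ht
  have h0 : (({u : RSpace d | ‖u‖ ≤ 1} \ {0} : Set (RSpace d))) =ᵐ[ν] {u : RSpace d | ‖u‖ ≤ 1} :=
    sdiff_null_ae_eq_self hν.zero
  rw [setIntegral_congr_set h0] at ht
  exact ht

theorem levyExponent_add (h1 : 1 < α) (h2 : α < 2) (hν : IsStableLevyMeasure α ν) (ξ : RSpace d) :
    levyExponent (ν.restrict {u | ‖u‖ ≤ 1}) ξ + levyExponent (ν.restrict {u | 1 < ‖u‖}) ξ =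
      levyExponent ν ξ := by
  have h := integral_add_compl (measurableSet_le measurable_norm measurable_const :
    MeasurableSet {u : RSpace d | ‖u‖ ≤ 1}) (integrable_one_sub_cos h1 h2 hν ξ)
  have hc : {u : RSpace d | ‖u‖ ≤ 1}ᶜ = {u | 1 < ‖u‖} := by
    ext u
    simp
  rw [hc] at h
  exact h

theorem levyExponent_le_of_isFiniteMeasure (κ : Measure (RSpace d)) [IsFiniteMeasure κ]
    (ξ : RSpace d) : levyExponent κ ξ ≤ 2 * κ.real univ := by
  have hc : Integrable (fun u => 1 - Real.cos (inner ℝ u ξ)) κ :=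
    (integrable_const (2 : ℝ)).mono' (by fun_prop) (ae_of_all _ fun u => by
      rw [Real.norm_of_nonneg (by simpa using Real.cos_le_one _)]
      linarith [Real.neg_one_le_cos (inner ℝ u ξ)])
  calc levyExponent κ ξ ≤ ∫ _, (2 : ℝ) ∂κ := integral_mono hc (integrable_const _) fun u => by
        linarith [Real.neg_one_le_cos (inner ℝ u ξ)]
    _ = _ := by simp [mul_comm]

/-- Exponential moments of the small jumps are bounded uniformly in the truncation. -/
theorem lintegral_exp_smallJumps_le (h1 : 1 < α) (h2 : α < 2) (hν : IsStableLevyMeasure α ν)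
    (hmap : ν.map (fun u => -u) = ν) (n : ℕ) {a : RSpace d} (ha : ‖a‖ ≤ 1) :
    ∫⁻ x, ENNReal.ofReal (Real.exp (inner ℝ a x))
        ∂(compoundPoisson (ν.restrict (smallJumpShell d n))) ≤
      ENNReal.ofReal (Real.exp (∫ u, ‖u‖ * min 1 ‖u‖ ∂ν)) := by
  have := isFiniteMeasure_smallJumps h1 h2 hν n
  set κ := ν.restrict (smallJumpShell d n) with hκ
  have hs : κ.map (fun u => -u) = κ :=
    restrict_map_neg hmap (by ext u; simp [smallJumpShell])
  have hin : ∀ᵐ u ∂κ, ‖u‖ ≤ 1 :=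
    (ae_restrict_mem (measurableSet_smallJumpShell n)).mono fun u hu => hu.2
  have hab : ∀ u : RSpace d, |inner ℝ a u| ≤ ‖u‖ := fun u =>
    (abs_inner_le a u).trans (mul_le_of_le_one_left (norm_nonneg _) ha)
  have hi : Integrable (fun x => Real.exp (inner ℝ a x)) κ := by
    refine (integrable_const (Real.exp 1)).mono' (by fun_prop) (hin.mono fun u hu => ?_)
    rw [Real.norm_of_nonneg (Real.exp_nonneg _)]
    exact Real.exp_le_exp.2 ((le_abs_self _).trans ((hab u).trans hu))
  have hil : Integrable (fun x => inner ℝ a x) κ :=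
    (integrable_const (1 : ℝ)).mono' (by fun_prop) (hin.mono fun u hu => (hab u).trans hu)
  rw [lintegral_exp_compoundPoisson κ a hi]
  refine ENNReal.ofReal_le_ofReal (Real.exp_le_exp.2 ?_)
  -- By symmetry the linear term may be subtracted, leaving `e^s - 1 - s ≤ s²` for `|s| ≤ 1`. This
  -- is at most `‖u‖ * min 1 ‖u‖` on the shell, whose integral does not depend on `n`.
  have h0 : ∫ x, inner ℝ a x ∂κ = 0 := integral_odd_eq_zero hs fun u => inner_neg_right _ _
  have h3 : ∫ x, (Real.exp (inner ℝ a x) - 1) ∂κ =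
      ∫ x, (Real.exp (inner ℝ a x) - 1 - inner ℝ a x) ∂κ := by
    rw [integral_sub (f := fun x => Real.exp (inner ℝ a x) - 1) (g := fun x => inner ℝ a x)
      (hi.sub (integrable_const _)) hil, h0, sub_zero]
  rw [h3]
  have hmom := integrable_levy_moment h1 h2 hν
  calc _ ≤ ∫ u, ‖u‖ * min 1 ‖u‖ ∂κ := by
        refine integral_mono_ae ((hi.sub (integrable_const _)).sub hil) hmom.restrict
          (hin.mono fun u hu => ?_)
        dsimp only
        have h4 := Real.abs_exp_sub_one_sub_id_le ((hab u).trans hu)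
        have h5 : (inner ℝ a u : ℝ) ^ 2 ≤ ‖u‖ ^ 2 := by
          rw [← sq_abs]
          exact pow_le_pow_left₀ (abs_nonneg _) (hab u) 2
        rw [min_eq_right hu]
        nlinarith [le_abs_self (Real.exp (inner ℝ a u) - 1 - inner ℝ a u)]
    _ ≤ _ := setIntegral_le_integral hmom (ae_of_all _ fun u => by positivity)

/-- A smooth weight of exponential growth. -/
def expWeight (x : RSpace d) : ℝ :=
  ∑ i : Fin d, (Real.exp (inner ℝ (EuclideanSpace.single i (1 : ℝ)) x) +
    Real.exp (inner ℝ (EuclideanSpace.single i (-1 : ℝ)) x))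

theorem contDiff_expWeight : ContDiff ℝ ((⊤ : ℕ∞) : WithTop ℕ∞) (expWeight (d := d)) := by
  exact ContDiff.sum fun i _ => (contDiff_const.inner ℝ contDiff_id).exp.add
    (contDiff_const.inner ℝ contDiff_id).exp

/-- The norm is at most `d` times the largest `|x i|`, and `e^{|x i|}` is at most one pair of
summands. The sum replaces `e^{‖x‖/d}` because `lintegral_mul_fourier_le` needs a smooth weight. -/
theorem exp_le_expWeight (hd : 1 ≤ d) (x : RSpace d) :
    Real.exp ((1 / d) * ‖x‖) ≤ expWeight x := by
  have : Nonempty (Fin d) := ⟨⟨0, hd⟩⟩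
  have hd0 : (0 : ℝ) < d := by exact_mod_cast hd
  have hd1 : (1 : ℝ) ≤ d := by exact_mod_cast hd
  obtain ⟨i, hi⟩ := Finite.exists_max fun i => |x i|
  have h1 : ‖x‖ ≤ d * |x i| := by
    refine le_of_abs_le (abs_le_of_sq_le_sq ?_ (by positivity))
    rw [EuclideanSpace.norm_sq_eq]
    calc ∑ j, ‖x j‖ ^ 2 ≤ ∑ _j : Fin d, |x i| ^ 2 := by
          refine Finset.sum_le_sum fun j _ => ?_
          rw [Real.norm_eq_abs]
          exact pow_le_pow_left₀ (abs_nonneg _) (hi j) 2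
      _ = d * |x i| ^ 2 := by simp
      _ ≤ (d * |x i|) ^ 2 := by nlinarith [sq_nonneg |x i|]
  have h2 : (1 / d) * ‖x‖ ≤ |x i| := by
    rw [one_div, inv_mul_le_iff₀ hd0]
    exact h1
  refine (Real.exp_le_exp.2 h2).trans ?_
  have h3 : Real.exp |x i| ≤ Real.exp (inner ℝ (EuclideanSpace.single i (1 : ℝ)) x) +
      Real.exp (inner ℝ (EuclideanSpace.single i (-1 : ℝ)) x) := by
    have e1 : (inner ℝ (EuclideanSpace.single i (1 : ℝ)) x : ℝ) = x i := by
      rw [EuclideanSpace.inner_single_left]; simp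
    have e2 : (inner ℝ (EuclideanSpace.single i (-1 : ℝ)) x : ℝ) = -x i := by
      rw [EuclideanSpace.inner_single_left]; simp
    rw [e1, e2]
    rcases abs_choice (x i) with h | h <;> rw [h] <;>
      linarith [Real.exp_pos (x i), Real.exp_pos (-x i)]
  refine h3.trans ?_
  exact Finset.single_le_sum (f := fun i => Real.exp (inner ℝ (EuclideanSpace.single i (1 : ℝ)) x) +
      Real.exp (inner ℝ (EuclideanSpace.single i (-1 : ℝ)) x)) (fun _ _ => by positivity)
      (Finset.mem_univ i)

theorem lintegral_expWeight_le (h1 : 1 < α) (h2 : α < 2) (hν : IsStableLevyMeasure α ν)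
    (hmap : ν.map (fun u => -u) = ν) (n : ℕ) :
    ∫⁻ x, ENNReal.ofReal (expWeight x)
        ∂(compoundPoisson (ν.restrict (smallJumpShell d n))) ≤
      d * (2 * ENNReal.ofReal (Real.exp (∫ u, ‖u‖ * min 1 ‖u‖ ∂ν))) := by
  have h3 : ∀ x : RSpace d, ENNReal.ofReal (expWeight x) =
      ∑ i : Fin d, (ENNReal.ofReal (Real.exp (inner ℝ (EuclideanSpace.single i (1 : ℝ)) x)) +
        ENNReal.ofReal (Real.exp (inner ℝ (EuclideanSpace.single i (-1 : ℝ)) x))) := by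
    intro x
    rw [expWeight, ENNReal.ofReal_sum_of_nonneg fun _ _ => by positivity]
    refine Finset.sum_congr rfl fun i _ => ?_
    rw [ENNReal.ofReal_add (by positivity) (by positivity)]
  simp only [h3]
  rw [lintegral_finsetSum _ fun i _ => by fun_prop]
  calc _ ≤ ∑ _i : Fin d, 2 * ENNReal.ofReal (Real.exp (∫ u, ‖u‖ * min 1 ‖u‖ ∂ν)) := by
        refine Finset.sum_le_sum fun i _ => ?_
        rw [lintegral_add_left (by fun_prop), two_mul]
        exact add_le_add (lintegral_exp_smallJumps_le h1 h2 hν hmap n (by simp))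
          (lintegral_exp_smallJumps_le h1 h2 hν hmap n (by simp))
    _ = _ := by simp

theorem integrable_expWeight_inv (hd : 1 ≤ d) :
    Integrable fun x : RSpace d => (expWeight x)⁻¹ := by
  have hd0 : (0 : ℝ) < d := by exact_mod_cast hd
  have hi := integrable_pow_mul_of_norm_le_exp (d := d)
    (h := fun x => ((Real.exp (-(1 / d * ‖x‖)) : ℝ) : ℂ)) (A := 1) (c := 1 / d)
    (by fun_prop) (by positivity)
    (fun x => by rw [one_mul, Complex.norm_real, Real.norm_of_nonneg (Real.exp_nonneg _)]) 0
  have hm := (contDiff_expWeight (d := d)).continuous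
  refine hi.mono' hm.measurable.inv.aestronglyMeasurable (ae_of_all _ fun x => ?_)
  have h0 := exp_le_expWeight hd x
  have hp := (Real.exp_pos _).trans_le h0
  rw [pow_zero, one_mul, Complex.norm_real, Real.norm_of_nonneg (Real.exp_nonneg _),
    Real.norm_of_nonneg (inv_nonneg.2 hp.le), Real.exp_neg]
  gcongr

/-- The characteristic function of the small jumps, at `2 π ξ`. -/
def smallJumpTransform (ν : Measure (RSpace d)) (ξ : RSpace d) : ℂ :=
  (Real.exp (-levyExponent (ν.restrict {u | ‖u‖ ≤ 1}) ((2 * Real.pi) • ξ)) : ℝ)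

theorem sub_one_le_rpow {x : ℝ} (h1 : 1 < α) (hx : 0 ≤ x) : x - 1 ≤ x ^ α := by
  rcases le_total x 1 with h | h
  · linarith [Real.rpow_nonneg hx α]
  · have := Real.self_le_rpow_of_one_le h h1.le
    linarith

/-- The inequality `x - 1 ≤ x ^ α` trades decay in `‖ξ‖ ^ α` for plain exponential decay, which
already gives all moments. -/
theorem exp_neg_levyExponent_le (h1 : 1 < α) (h2 : α < 2) (hν : IsStableLevyMeasure α ν)
    (hnd : IsNondegenerateLevy α ν) : ∃ c A : ℝ, 0 < c ∧
      ∀ ξ, Real.exp (-levyExponent ν ξ) ≤ A * Real.exp (-(c * ‖ξ‖)) := by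
  obtain ⟨c, hc, hb⟩ := le_levyExponent h1 h2 hν hnd
  refine ⟨c, Real.exp c, hc, fun ξ => ?_⟩
  rw [← Real.exp_add]
  refine Real.exp_le_exp.2 ?_
  have h3 := sub_one_le_rpow (α := α) h1 (norm_nonneg ξ)
  have h4 := hb ξ
  nlinarith

/-- The exponent of the large jumps is bounded by twice their mass, so discarding them costs only a
constant factor. -/
theorem smallJumpTransform_norm_le (h1 : 1 < α) (h2 : α < 2) (hν : IsStableLevyMeasure α ν)
    (hnd : IsNondegenerateLevy α ν) : ∃ c A : ℝ, 0 < c ∧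
      ∀ ξ, ‖smallJumpTransform ν ξ‖ ≤ A * Real.exp (-(c * ‖ξ‖)) := by
  obtain ⟨c, A, hc, hb⟩ := exp_neg_levyExponent_le h1 h2 hν hnd
  have := isFiniteMeasure_largeJumps h1 h2 hν
  refine ⟨c * (2 * Real.pi), A * Real.exp (2 * (ν.restrict {u | 1 < ‖u‖}).real univ),
    by positivity, fun ξ => ?_⟩
  rw [smallJumpTransform, Complex.norm_real, Real.norm_of_nonneg (Real.exp_nonneg _)]
  have h3 := levyExponent_add h1 h2 hν ((2 * Real.pi) • ξ)
  have h4 := levyExponent_le_of_isFiniteMeasure (ν.restrict {u : RSpace d | 1 < ‖u‖})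
    ((2 * Real.pi) • ξ)
  have h5 := hb ((2 * Real.pi) • ξ)
  rw [norm_smul, Real.norm_of_nonneg (by positivity)] at h5
  calc _ ≤ Real.exp (2 * (ν.restrict {u | 1 < ‖u‖}).real univ) *
        Real.exp (-levyExponent ν ((2 * Real.pi) • ξ)) := by
        rw [← Real.exp_add]
        refine Real.exp_le_exp.2 ?_
        linarith
    _ ≤ Real.exp (2 * (ν.restrict {u | 1 < ‖u‖}).real univ) *
        (A * Real.exp (-(c * (2 * Real.pi * ‖ξ‖)))) := by gcongr
    _ = _ := by rw [← mul_assoc c]; ring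

theorem tendsto_charFun_smallJumps (h1 : 1 < α) (h2 : α < 2) (hν : IsStableLevyMeasure α ν)
    (hmap : ν.map (fun u => -u) = ν) (ξ : RSpace d) :
    Tendsto (fun n => charFun (compoundPoisson (ν.restrict (smallJumpShell d n)))
      ((2 * Real.pi) • ξ)) atTop (𝓝 (smallJumpTransform ν ξ)) := by
  have h3 : ∀ n, charFun (compoundPoisson (ν.restrict (smallJumpShell d n))) ((2 * Real.pi) • ξ) =
      (Real.exp (-levyExponent (ν.restrict (smallJumpShell d n)) ((2 * Real.pi) • ξ)) : ℝ) := by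
    intro n
    have := isFiniteMeasure_smallJumps h1 h2 hν n
    exact charFun_compoundPoisson_symm _
      (restrict_map_neg hmap (by ext u; simp [smallJumpShell])) _
  simp only [h3]
  exact (Complex.continuous_ofReal.tendsto _).comp ((Real.continuous_exp.tendsto _).comp
    (tendsto_levyExponent_smallJumps h1 h2 hν _).neg)

theorem measurable_smallJumpTransform (h1 : 1 < α) (h2 : α < 2) (hν : IsStableLevyMeasure α ν)
    (hmap : ν.map (fun u => -u) = ν) : Measurable (smallJumpTransform ν) := by
  refine measurable_of_tendsto_metrizable (fun n => ?_)
    (tendsto_pi_nhds.2 (tendsto_charFun_smallJumps h1 h2 hν hmap))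
  have := isFiniteMeasure_smallJumps h1 h2 hν n
  exact measurable_charFun.comp (measurable_const_smul _)

/-- The law of the small jumps has a nonnegative density with integrable gradient. -/
theorem exists_smallJump_density (hd : 1 ≤ d) (h1 : 1 < α) (h2 : α < 2)
    (hν : IsStableLevyMeasure α ν) (hnd : IsNondegenerateLevy α ν)
    (hmap : ν.map (fun u => -u) = ν) :
    ∃ q : RSpace d → ℝ, FourierRep q (smallJumpTransform ν) ∧ ∫⁻ x, ‖gradient q x‖ₑ < ∞ := by
  obtain ⟨c, A, hc, hb⟩ := smallJumpTransform_norm_le h1 h2 hν hnd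
  have hm := measurable_smallJumpTransform h1 h2 hν hmap
  have hi0 : Integrable (smallJumpTransform ν) := by
    have := integrable_pow_mul_of_norm_le_exp hm.aestronglyMeasurable hc hb 0
    simp only [pow_zero, one_mul] at this
    exact (integrable_norm_iff hm.aestronglyMeasurable).1 this
  have hfin := isFiniteMeasure_smallJumps h1 h2 hν
  have ht := tendsto_charFun_smallJumps h1 h2 hν hmap
  have hpos := fourier_nonneg_of_tendsto_charFun hi0 ht
  set q : RSpace d → ℝ := fun x => (𝓕 (smallJumpTransform ν) x).re with hq
  have H : FourierRep q (smallJumpTransform ν) :=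
    ⟨hi0, integrable_pow_mul_of_norm_le_exp hm.aestronglyMeasurable hc hb 2,
      fun x => (hpos x).2.symm⟩
  refine ⟨q, H, ?_⟩
  -- With `w = expWeight`, `|∇q| ≤ √C √(w q · w⁻¹) ≤ √C (w q + w⁻¹)`. The first term is integrable
  -- by the uniform exponential moments, the second because `w` grows exponentially.
  obtain ⟨C, hC, hg⟩ := H.norm_gradient_sq_le fun x => (hpos x).1
  have hW : ∫⁻ x, ENNReal.ofReal (expWeight x * q x) ≤
      d * (2 * ENNReal.ofReal (Real.exp (∫ u, ‖u‖ * min 1 ‖u‖ ∂ν))) :=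
    lintegral_mul_fourier_le hi0 ht contDiff_expWeight
      (fun x => (Real.exp_nonneg _).trans (exp_le_expWeight hd x))
      (lintegral_expWeight_le h1 h2 hν hmap)
  have hWi := (integrable_expWeight_inv hd).lintegral_lt_top
  calc ∫⁻ x, ‖gradient q x‖ₑ
      ≤ ∫⁻ x, ENNReal.ofReal √C * (ENNReal.ofReal (expWeight x * q x) +
          ENNReal.ofReal ((expWeight x)⁻¹)) := by
        refine lintegral_mono fun x => ?_
        have hw : 0 < expWeight x := (Real.exp_pos _).trans_le (exp_le_expWeight hd x)
        have hqx : 0 ≤ q x := (hpos x).1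
        rw [← ENNReal.ofReal_add (by positivity) (by positivity),
          ← ENNReal.ofReal_mul (by positivity), ← ofReal_norm]
        refine ENNReal.ofReal_le_ofReal ?_
        refine le_of_abs_le (abs_le_of_sq_le_sq ((hg x).trans ?_) (by positivity))
        rw [mul_pow, Real.sq_sqrt hC.le]
        have hone : expWeight x * (expWeight x)⁻¹ = 1 := mul_inv_cancel₀ hw.ne'
        have h3 : q x = (expWeight x * q x) * (expWeight x)⁻¹ := by
          rw [mul_right_comm, hone, one_mul]
        have h4 : 0 ≤ expWeight x * q x := by positivity
        have h5 : 0 ≤ (expWeight x)⁻¹ := by positivity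
        gcongr
        nlinarith
    _ = ENNReal.ofReal √C * ((∫⁻ x, ENNReal.ofReal (expWeight x * q x)) +
          ∫⁻ x : RSpace d, ENNReal.ofReal ((expWeight x)⁻¹)) := by
        have hc1 := (contDiff_expWeight (d := d)).continuous
        have hc2 := H.contDiff.continuous
        rw [lintegral_const_mul' _ _ ENNReal.ofReal_ne_top, lintegral_add_left (by fun_prop)]
    _ < ∞ := by
        refine ENNReal.mul_lt_top ENNReal.ofReal_lt_top (ENNReal.add_lt_top.2 ⟨?_, hWi⟩)
        refine hW.trans_lt ?_
        exact ENNReal.mul_lt_top (by simp) (ENNReal.mul_lt_top (by simp) ENNReal.ofReal_lt_top)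

end SmallJumps

/-! ### The stable density: regularity, integrable gradient, positivity -/

section StableDensity

open scoped FourierTransform InnerProductSpace

variable {d : ℕ} {α : ℝ} {ν μ : Measure (RSpace d)}

/-- The transform `exp (-s Ψ(2 π ξ))` of the stable law at time `s`. -/
def stableTransform (ν : Measure (RSpace d)) (s : ℝ) (ξ : RSpace d) : ℂ :=
  (Real.exp (-(s * levyExponent ν ((2 * Real.pi) • ξ))) : ℝ)

/-- The stable density at time `s`. -/
def stableDensity (ν : Measure (RSpace d)) (s : ℝ) (x : RSpace d) : ℝ :=
  (𝓕 (stableTransform ν s) x).re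

/-- The law of `s^{1/α} X`. -/
def stableLaw (α : ℝ) (μ : Measure (RSpace d)) (s : ℝ) : Measure (RSpace d) :=
  μ.map fun y => s ^ (1 / α) • y

theorem isProbabilityMeasure_stableLaw [IsProbabilityMeasure μ] (s : ℝ) :
    IsProbabilityMeasure (stableLaw α μ s) :=
  Measure.isProbabilityMeasure_map (by fun_prop)

theorem rpow_one_div_rpow {s : ℝ} (h1 : 1 < α) (hs : 0 ≤ s) : (s ^ (1 / α)) ^ α = s := by
  rw [← Real.rpow_mul hs, one_div, inv_mul_cancel₀ (by linarith), Real.rpow_one]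

theorem mul_levyExponent (h1 : 1 < α) (h2 : α < 2) (hν : IsStableLevyMeasure α ν)
    {s : ℝ} (hs : 0 ≤ s) (ξ : RSpace d) :
    s * levyExponent ν ξ = levyExponent ν (s ^ (1 / α) • ξ) := by
  rw [levyExponent_smul h1 h2 hν (by positivity), rpow_one_div_rpow h1 hs]

theorem charFun_stableLaw_time (h1 : 1 < α) (h2 : α < 2) (hν : IsStableLevyMeasure α ν)
    (hs : IsSymmetricLevy α ν) (hμ : IsStableLaw ν μ) {s : ℝ} (hs0 : 0 ≤ s) (ξ : RSpace d) :
    charFun (stableLaw α μ s) ξ = (Real.exp (-(s * levyExponent ν ξ)) : ℝ) := by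
  rw [stableLaw, charFun_map_smul, charFun_stableLaw h1 h2 hν hs hμ, mul_levyExponent h1 h2 hν hs0]

theorem charFun_stableLaw_two_pi (h1 : 1 < α) (h2 : α < 2) (hν : IsStableLevyMeasure α ν)
    (hs : IsSymmetricLevy α ν) (hμ : IsStableLaw ν μ) {s : ℝ} (hs0 : 0 ≤ s) (ξ : RSpace d) :
    charFun (stableLaw α μ s) ((2 * Real.pi) • ξ) = stableTransform ν s ξ :=
  charFun_stableLaw_time h1 h2 hν hs hμ hs0 _

theorem charFun_stableLaw_neg_two_pi (h1 : 1 < α) (h2 : α < 2) (hν : IsStableLevyMeasure α ν)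
    (hs : IsSymmetricLevy α ν) (hμ : IsStableLaw ν μ) {s : ℝ} (hs0 : 0 ≤ s) (ξ : RSpace d) :
    charFun (stableLaw α μ s) (-(2 * Real.pi) • ξ) = stableTransform ν s ξ := by
  rw [neg_smul, charFun_stableLaw_time h1 h2 hν hs hμ hs0, levyExponent_neg, stableTransform]

theorem continuous_stableTransform (h1 : 1 < α) (h2 : α < 2) (hν : IsStableLevyMeasure α ν)
    (s : ℝ) : Continuous (stableTransform ν s) := by
  have := continuous_levyExponent h1 h2 hν
  unfold stableTransform
  fun_prop

theorem stableTransform_norm_le (h1 : 1 < α) (h2 : α < 2) (hν : IsStableLevyMeasure α ν)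
    (hnd : IsNondegenerateLevy α ν) {s : ℝ} (hs : 0 < s) : ∃ c A : ℝ, 0 < c ∧
      ∀ ξ, ‖stableTransform ν s ξ‖ ≤ A * Real.exp (-(c * ‖ξ‖)) := by
  obtain ⟨c, A, hc, hb⟩ := exp_neg_levyExponent_le h1 h2 hν hnd
  refine ⟨c * (s ^ (1 / α) * (2 * Real.pi)), A, by positivity, fun ξ => ?_⟩
  rw [stableTransform, Complex.norm_real, Real.norm_of_nonneg (Real.exp_nonneg _),
    mul_levyExponent h1 h2 hν hs.le]
  refine (hb _).trans_eq ?_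
  rw [norm_smul, norm_smul, Real.norm_of_nonneg (by positivity), Real.norm_of_nonneg (by positivity)]
  congr 3
  ring

theorem integrable_pow_mul_stableTransform (h1 : 1 < α) (h2 : α < 2)
    (hν : IsStableLevyMeasure α ν) (hnd : IsNondegenerateLevy α ν) {s : ℝ} (hs : 0 < s) (k : ℕ) :
    Integrable fun ξ => ‖ξ‖ ^ k * ‖stableTransform ν s ξ‖ := by
  obtain ⟨c, A, hc, hb⟩ := stableTransform_norm_le h1 h2 hν hnd hs
  exact integrable_pow_mul_of_norm_le_exp
    (continuous_stableTransform h1 h2 hν s).aestronglyMeasurable hc hb k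

theorem integrable_stableTransform (h1 : 1 < α) (h2 : α < 2)
    (hν : IsStableLevyMeasure α ν) (hnd : IsNondegenerateLevy α ν) {s : ℝ} (hs : 0 < s) :
    Integrable (stableTransform ν s) := by
  have := integrable_pow_mul_stableTransform h1 h2 hν hnd hs 0
  simp only [pow_zero, one_mul] at this
  exact (integrable_norm_iff (continuous_stableTransform h1 h2 hν s).aestronglyMeasurable).1 this

theorem fourier_stableTransform_nonneg (h1 : 1 < α) (h2 : α < 2) (hν : IsStableLevyMeasure α ν)
    (hs : IsSymmetricLevy α ν) (hnd : IsNondegenerateLevy α ν) (hμ : IsStableLaw ν μ)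
    {s : ℝ} (hs0 : 0 < s) (x : RSpace d) :
    0 ≤ stableDensity ν s x ∧ 𝓕 (stableTransform ν s) x = (stableDensity ν s x : ℂ) := by
  have := hμ.1
  have := isProbabilityMeasure_stableLaw (α := α) (μ := μ) s
  refine fourier_nonneg_of_tendsto_charFun (m := fun _ => stableLaw α μ s)
    (integrable_stableTransform h1 h2 hν hnd hs0) (fun ξ => ?_) x
  rw [charFun_stableLaw_two_pi h1 h2 hν hs hμ hs0.le]
  exact tendsto_const_nhds

theorem fourierRep_stableDensity (h1 : 1 < α) (h2 : α < 2) (hν : IsStableLevyMeasure α ν)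
    (hs : IsSymmetricLevy α ν) (hnd : IsNondegenerateLevy α ν) (hμ : IsStableLaw ν μ)
    {s : ℝ} (hs0 : 0 < s) : FourierRep (stableDensity ν s) (stableTransform ν s) :=
  ⟨integrable_stableTransform h1 h2 hν hnd hs0, integrable_pow_mul_stableTransform h1 h2 hν hnd hs0 2,
    fun x => (fourier_stableTransform_nonneg h1 h2 hν hs hnd hμ hs0 x).2.symm⟩

theorem stableLaw_eq_withDensity (h1 : 1 < α) (h2 : α < 2) (hν : IsStableLevyMeasure α ν)
    (hs : IsSymmetricLevy α ν) (hnd : IsNondegenerateLevy α ν) (hμ : IsStableLaw ν μ)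
    {s : ℝ} (hs0 : 0 < s) :
    stableLaw α μ s = volume.withDensity fun x => ENNReal.ofReal (stableDensity ν s x) := by
  have := hμ.1
  have := isProbabilityMeasure_stableLaw (α := α) (μ := μ) s
  have h3 : (fun ξ => charFun (stableLaw α μ s) ((2 * Real.pi) • ξ)) = stableTransform ν s :=
    funext fun ξ => charFun_stableLaw_two_pi h1 h2 hν hs hμ hs0.le ξ
  have h4 := eq_withDensity_of_integrable_charFun (stableLaw α μ s)
    (by rw [h3]; exact integrable_stableTransform h1 h2 hν hnd hs0)
    (continuous_charFun_of_isFiniteMeasure _)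
  rw [h3] at h4
  exact h4

theorem stableLaw_one (μ : Measure (RSpace d)) : stableLaw α μ 1 = μ := by
  simp [stableLaw]

/-- Tonelli and translation invariance. With `m` a probability measure this is the `L¹` contraction
behind both monotonicity statements. -/
theorem lintegral_lintegral_translate {f : RSpace d → ℝ≥0∞} (hf : Measurable f)
    (m : Measure (RSpace d)) [SFinite m] :
    ∫⁻ x, ∫⁻ y, f (x + y) ∂m = m univ * ∫⁻ x, f x := by
  rw [lintegral_lintegral_swap (by fun_prop)]
  calc ∫⁻ y, (∫⁻ x, f (x + y)) ∂m = ∫⁻ _, (∫⁻ x, f x) ∂m :=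
        lintegral_congr fun y => lintegral_add_right_eq_self f y
    _ = _ := by rw [lintegral_const, mul_comm]

/-- Small and large jumps are independent: the exponents add, so `p` is the average of translates of
`q` under the compound Poisson law of the large jumps. The gradient passes inside, and the average
does not increase its `L¹` norm. -/
theorem lintegral_gradient_stableDensity_lt_top (hd : 1 ≤ d) (h1 : 1 < α) (h2 : α < 2)
    (hν : IsStableLevyMeasure α ν) (hs : IsSymmetricLevy α ν) (hnd : IsNondegenerateLevy α ν) :
    ∫⁻ x, ‖gradient (stableDensity ν 1) x‖ₑ < ⊤ := by
  have hmap := levy_map_neg (by linarith) hν hs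
  obtain ⟨q, H, hq⟩ := exists_smallJump_density hd h1 h2 hν hnd hmap
  have := isFiniteMeasure_largeJumps h1 h2 hν
  set m := compoundPoisson (ν.restrict {u | 1 < ‖u‖}) with hm
  have hchar : ∀ ξ : RSpace d, charFun m (-(2 * Real.pi) • ξ) =
      (Real.exp (-levyExponent (ν.restrict {u | 1 < ‖u‖}) ((2 * Real.pi) • ξ)) : ℝ) := by
    intro ξ
    rw [hm, neg_smul, charFun_compoundPoisson_symm _ (restrict_map_neg hmap (by ext u; simp))]
    change ((Real.exp (-levyExponent _ (-((2 * Real.pi) • ξ))) : ℝ) : ℂ) = _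
    rw [levyExponent_neg]
  have hT : (fun ξ => smallJumpTransform ν ξ * charFun m (-(2 * Real.pi) • ξ)) =
      stableTransform ν 1 := by
    funext ξ
    rw [hchar, smallJumpTransform, stableTransform, ← Complex.ofReal_mul, ← Real.exp_add, one_mul,
      ← levyExponent_add h1 h2 hν]
    congr 2
    ring
  have hp : stableDensity ν 1 = fun x => ∫ y, q (x + y) ∂m := by
    have h3 := (H.translate_average m).eq_re
    rw [hT] at h3
    exact h3.symm
  have hc := H.continuous_gradient
  rw [hp]
  simp only [H.gradient_translate_average]
  calc ∫⁻ x, ‖∫ y, gradient q (x + y) ∂m‖ₑ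
      ≤ ∫⁻ x, ∫⁻ y, ‖gradient q (x + y)‖ₑ ∂m :=
        lintegral_mono fun x => enorm_integral_le_lintegral_enorm _
    _ = ∫⁻ x, ‖gradient q x‖ₑ := by
        rw [lintegral_lintegral_translate hc.enorm.measurable, measure_univ, one_mul]
    _ < ⊤ := hq

theorem stableDensity_zero_pos (h1 : 1 < α) (h2 : α < 2) (hν : IsStableLevyMeasure α ν)
    (hnd : IsNondegenerateLevy α ν) : 0 < stableDensity ν 1 0 := by
  have hi := integrable_stableTransform h1 h2 hν hnd one_pos
  have h3 : stableDensity ν 1 0 =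
      ∫ ξ, Real.exp (-(1 * levyExponent ν ((2 * Real.pi) • ξ))) := by
    rw [stableDensity, Real.fourier_eq]
    simp only [inner_zero_right, neg_zero, AddChar.map_zero_eq_one, one_smul, stableTransform]
    rw [integral_complex_ofReal, Complex.ofReal_re]
  rw [h3]
  refine integral_exp_pos ?_
  have := hi.re
  simpa [stableTransform, ← Complex.ofReal_exp] using this

/-- Substitution `ξ ↦ s ^ (1/α) ξ` in the inversion integral. The factor is its Jacobian; only its
sign matters for positivity. -/
theorem stableDensity_eq_smul (h1 : 1 < α) (h2 : α < 2) (hν : IsStableLevyMeasure α ν)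
    {s : ℝ} (hs : 0 < s) : ∃ c : ℝ, 0 < c ∧ ∀ x,
      stableDensity ν s x = c * stableDensity ν 1 ((s ^ (1 / α))⁻¹ • x) := by
  have hr : 0 < s ^ (1 / α) := by positivity
  refine ⟨_, abs_pos.2 (inv_ne_zero (pow_ne_zero (Module.finrank ℝ (RSpace d)) hr.ne')),
    fun x => ?_⟩
  have h3 := Measure.integral_comp_smul (volume : Measure (RSpace d))
    (fun ξ => (Real.fourierChar (-inner ℝ ξ ((s ^ (1 / α))⁻¹ • x)) : ℂ) * stableTransform ν 1 ξ)
    (s ^ (1 / α))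
  rw [stableDensity, stableDensity, ← Complex.re_ofReal_mul]
  congr 1
  rw [Real.fourier_eq, Real.fourier_eq]
  simp only [Circle.smul_def, smul_eq_mul]
  rw [← Complex.real_smul, ← h3]
  refine integral_congr_ae (ae_of_all _ fun ξ => ?_)
  dsimp only
  rw [inner_smul_left, inner_smul_right, RCLike.conj_to_real, mul_inv_cancel_left₀ hr.ne']
  congr 1
  rw [stableTransform, stableTransform, one_mul, smul_comm, ← mul_levyExponent h1 h2 hν hs.le]

theorem stableDensity_add (h1 : 1 < α) (h2 : α < 2) (hν : IsStableLevyMeasure α ν)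
    (hs : IsSymmetricLevy α ν) (hnd : IsNondegenerateLevy α ν) (hμ : IsStableLaw ν μ)
    {s t : ℝ} (hs0 : 0 < s) (ht0 : 0 < t) (x : RSpace d) :
    stableDensity ν (s + t) x = ∫ y, stableDensity ν s (x + y) ∂(stableLaw α μ t) := by
  have := hμ.1
  have := isProbabilityMeasure_stableLaw (α := α) (μ := μ) t
  have h3 := ((fourierRep_stableDensity h1 h2 hν hs hnd hμ hs0).translate_average
    (stableLaw α μ t)).eq_re
  rw [funext_iff] at h3
  rw [h3, stableDensity]
  refine congrArg (fun f : RSpace d → ℂ => ((𝓕 f : RSpace d → ℂ) x).re) (funext fun ξ => ?_)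
  rw [charFun_stableLaw_neg_two_pi h1 h2 hν hs hμ ht0.le]
  simp only [stableTransform, ← Complex.ofReal_mul, ← Real.exp_add]
  congr 2
  ring

/-- By scaling, `p_{1/2}` is positive on the ball of radius `2 ^ (-1/α) R`. In the convolution `p_1
= p_{1/2} ∗ p_{1/2}` the point `y = -x/2` makes both factors positive, and continuity makes them
positive on a set of positive measure. -/
theorem stableDensity_pos_step (h1 : 1 < α) (h2 : α < 2) (hν : IsStableLevyMeasure α ν)
    (hs : IsSymmetricLevy α ν) (hnd : IsNondegenerateLevy α ν) (hμ : IsStableLaw ν μ)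
    {R : ℝ} (hR : ∀ x : RSpace d, ‖x‖ < R → 0 < stableDensity ν 1 x) (x : RSpace d)
    (hx : ‖x‖ < 2 * (1 / 2 : ℝ) ^ (1 / α) * R) : 0 < stableDensity ν 1 x := by
  have hh : (0 : ℝ) < 1 / 2 := by norm_num
  set r : ℝ := (1 / 2 : ℝ) ^ (1 / α) with hr
  have hr0 : 0 < r := by positivity
  obtain ⟨c, hc, hsc⟩ := stableDensity_eq_smul h1 h2 hν hh
  have hH : ∀ y : RSpace d, ‖y‖ < r * R → 0 < stableDensity ν (1 / 2) y := by
    intro y hy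
    rw [hsc]
    refine mul_pos hc (hR _ ?_)
    rw [norm_smul, norm_inv, Real.norm_of_nonneg hr0.le, inv_mul_lt_iff₀ hr0]
    exact hy
  have hnn := fun y => (fourier_stableTransform_nonneg h1 h2 hν hs hnd hμ hh y).1
  have hFR := fourierRep_stableDensity h1 h2 hν hs hnd hμ hh
  have hcont := hFR.contDiff.continuous
  have hprob := hμ.1
  have hprob2 := isProbabilityMeasure_stableLaw (α := α) (μ := μ) (1 / 2)
  have hxn : ‖(1 / 2 : ℝ) • x‖ < r * R := by
    rw [norm_smul, Real.norm_of_nonneg hh.le]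
    linarith
  rw [← add_halves (1 : ℝ), stableDensity_add h1 h2 hν hs hnd hμ hh hh,
    integral_pos_iff_support_of_nonneg (fun y => hnn _) (hFR.integrable_translate _ x)]
  have hU : IsOpen {y : RSpace d | 0 < stableDensity ν (1 / 2) (x + y) ∧
      0 < stableDensity ν (1 / 2) y} :=
    (isOpen_lt continuous_const (hcont.comp (continuous_const.add continuous_id))).and
      (isOpen_lt continuous_const hcont)
  have hne : {y : RSpace d | 0 < stableDensity ν (1 / 2) (x + y) ∧
      0 < stableDensity ν (1 / 2) y}.Nonempty := by
    refine ⟨-((1 / 2 : ℝ) • x), hH _ ?_, hH _ ?_⟩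
    · have : x + -((1 / 2 : ℝ) • x) = (1 / 2 : ℝ) • x := by module
      rwa [this]
    · rwa [norm_neg]
  have hvol := hU.measure_pos volume hne
  refine lt_of_lt_of_le ?_ (measure_mono (fun y (hy : y ∈ {y : RSpace d |
    0 < stableDensity ν (1 / 2) (x + y) ∧ 0 < stableDensity ν (1 / 2) y}) => hy.1.ne'))
  rw [stableLaw_eq_withDensity h1 h2 hν hs hnd hμ hh, withDensity_apply _ hU.measurableSet,
    setLIntegral_pos_iff (by fun_prop)]
  refine hvol.trans_le (measure_mono fun y hy => ⟨?_, hy⟩)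
  simpa using hy.2

/-- Start from a ball around `0`, where the density is the integral of a positive function. Each
step multiplies the radius by `2 ^ (1 - 1/α) > 1`, so the balls exhaust the space. -/
theorem stableDensity_pos (h1 : 1 < α) (h2 : α < 2) (hν : IsStableLevyMeasure α ν)
    (hs : IsSymmetricLevy α ν) (hnd : IsNondegenerateLevy α ν) (hμ : IsStableLaw ν μ)
    (x : RSpace d) : 0 < stableDensity ν 1 x := by
  have hcont := (fourierRep_stableDensity h1 h2 hν hs hnd hμ one_pos).contDiff.continuous
  have hopen : IsOpen {y : RSpace d | 0 < stableDensity ν 1 y} := isOpen_lt continuous_const hcont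
  obtain ⟨R, hR, hball⟩ := Metric.isOpen_iff.1 hopen 0 (stableDensity_zero_pos h1 h2 hν hnd)
  set k : ℝ := 2 * (1 / 2 : ℝ) ^ (1 / α) with hk
  have hk1 : 1 < k := by
    have : (1 / 2 : ℝ) ^ (1 : ℝ) < (1 / 2 : ℝ) ^ (1 / α) :=
      Real.rpow_lt_rpow_of_exponent_gt (by norm_num) (by norm_num)
        (by rw [div_lt_one (by linarith)]; exact h1)
    rw [Real.rpow_one] at this
    linarith
  have hn : ∀ n : ℕ, ∀ y : RSpace d, ‖y‖ < k ^ n * R → 0 < stableDensity ν 1 y := by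
    intro n
    induction n with
    | zero =>
      intro y hy
      exact hball (by simpa using hy)
    | succ n ih =>
      intro y hy
      refine stableDensity_pos_step h1 h2 hν hs hnd hμ ih y ?_
      rw [pow_succ'] at hy
      linarith
  obtain ⟨n, hn'⟩ := ((tendsto_pow_atTop_atTop_of_one_lt hk1).atTop_mul_const hR
    |>.eventually_gt_atTop ‖x‖).exists
  exact hn n x hn'

theorem iSup_stableDensity_lt_top (h1 : 1 < α) (h2 : α < 2) (hν : IsStableLevyMeasure α ν)
    (hs : IsSymmetricLevy α ν) (hnd : IsNondegenerateLevy α ν) (hμ : IsStableLaw ν μ) :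
    ⨆ x, ‖stableDensity ν 1 x‖ₑ < ⊤ := by
  refine lt_of_le_of_lt (iSup_le fun x => ?_) (ENNReal.ofReal_lt_top
    (r := ∫ ξ, ‖stableTransform ν 1 ξ‖))
  rw [← ofReal_norm]
  exact ENNReal.ofReal_le_ofReal
    ((fourierRep_stableDensity h1 h2 hν hs hnd hμ one_pos).abs_le x)

end StableDensity

/-! ### The semigroup on indicators -/

section Semigroup

open scoped FourierTransform InnerProductSpace

variable {d : ℕ} {α : ℝ} {ν μ : Measure (RSpace d)}

theorem stableSemigroup_eq {f : RSpace d → ℝ} (hf : Measurable f) (t : ℝ) (x : RSpace d) :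
    stableSemigroup α μ t f x = ∫ y, f (x + y) ∂(stableLaw α μ t) := by
  have hm : Measurable fun y => f (x + y) := hf.comp (measurable_const_add x)
  rw [stableLaw, integral_map (by fun_prop) hm.aestronglyMeasurable]
  rfl

theorem stableLaw_add (h1 : 1 < α) (h2 : α < 2) (hν : IsStableLevyMeasure α ν)
    (hs : IsSymmetricLevy α ν) (hμ : IsStableLaw ν μ) {s t : ℝ} (hs0 : 0 ≤ s) (ht0 : 0 ≤ t) :
    stableLaw α μ (s + t) = stableLaw α μ s ∗ stableLaw α μ t := by
  have := hμ.1
  have := isProbabilityMeasure_stableLaw (α := α) (μ := μ) t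
  have := isProbabilityMeasure_stableLaw (α := α) (μ := μ) s
  have := isProbabilityMeasure_stableLaw (α := α) (μ := μ) (s + t)
  refine Measure.ext_of_charFun (funext fun ξ => ?_)
  rw [charFun_conv, charFun_stableLaw_time h1 h2 hν hs hμ (by positivity),
    charFun_stableLaw_time h1 h2 hν hs hμ hs0, charFun_stableLaw_time h1 h2 hν hs hμ ht0,
    ← Complex.ofReal_mul, ← Real.exp_add]
  congr 2
  ring

theorem stableSemigroup_add (h1 : 1 < α) (h2 : α < 2) (hν : IsStableLevyMeasure α ν)
    (hs : IsSymmetricLevy α ν) (hμ : IsStableLaw ν μ) {s t : ℝ} (hs0 : 0 ≤ s) (ht0 : 0 ≤ t)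
    {f : RSpace d → ℝ} (hf : Measurable f) {C : ℝ} (hC : ∀ x, |f x| ≤ C) (x : RSpace d) :
    stableSemigroup α μ (s + t) f x =
      ∫ y, stableSemigroup α μ t f (x + y) ∂(stableLaw α μ s) := by
  have := hμ.1
  have := isProbabilityMeasure_stableLaw (α := α) (μ := μ) t
  have := isProbabilityMeasure_stableLaw (α := α) (μ := μ) s
  rw [stableSemigroup_eq hf, stableLaw_add h1 h2 hν hs hμ hs0 ht0, integral_conv]
  · refine integral_congr_ae (ae_of_all _ fun y => ?_)
    dsimp only
    rw [stableSemigroup_eq hf]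
    simp only [add_assoc]
  · exact (integrable_const C).mono' (hf.comp (measurable_const_add x)).aestronglyMeasurable
      (ae_of_all _ fun y => hC _)

theorem stableDensity_neg (ν : Measure (RSpace d)) (s : ℝ) (x : RSpace d) :
    stableDensity ν s (-x) = stableDensity ν s x := by
  have h1 : (fun ξ => stableTransform ν s (-ξ)) = stableTransform ν s := by
    funext ξ
    rw [stableTransform, smul_neg, levyExponent_neg, stableTransform]
  rw [stableDensity, ← Real.fourierInv_eq_fourier_neg, Real.fourierInv_eq_fourier_comp_neg, h1,
    stableDensity]

/-- The Fourier transform of the stable regularisation of the indicator of `A`. -/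
def indicatorTransform (ν : Measure (RSpace d)) (A : Set (RSpace d)) (t : ℝ) (ξ : RSpace d) : ℂ :=
  stableTransform ν t ξ *
    charFun ((volume.restrict A).map fun y => -y) (-(2 * Real.pi) • ξ)

theorem measurable_indicator_one {A : Set (RSpace d)} (hA : MeasurableSet A) :
    Measurable (A.indicator fun _ => (1 : ℝ)) :=
  measurable_const.indicator hA

/-- `P_t 1_A` is the average of translates of the density `p_t` over the reflection of Lebesgue
measure on `A`, a finite measure. The identification uses the substitution `y ↦ y - x` and the
evenness of `p_t`. -/
theorem fourierRep_stableSemigroup_indicator (h1 : 1 < α) (h2 : α < 2)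
    (hν : IsStableLevyMeasure α ν) (hs : IsSymmetricLevy α ν) (hnd : IsNondegenerateLevy α ν)
    (hμ : IsStableLaw ν μ) {A : Set (RSpace d)} (hA : MeasurableSet A) (hAf : volume A < ⊤)
    {t : ℝ} (ht : 0 < t) :
    FourierRep (stableSemigroup α μ t (A.indicator fun _ => (1 : ℝ)))
      (indicatorTransform ν A t) := by
  have hfin : IsFiniteMeasure (volume.restrict A) := ⟨by simpa using hAf⟩
  have H := fourierRep_stableDensity h1 h2 hν hs hnd hμ ht
  have hcont := H.contDiff.continuous
  have H2 := H.translate_average ((volume.restrict A).map fun y => -y)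
  have heq : (fun x => ∫ y, stableDensity ν t (x + y) ∂((volume.restrict A).map fun y => -y)) =
      stableSemigroup α μ t (A.indicator fun _ => (1 : ℝ)) := by
    funext x
    rw [stableSemigroup_eq (measurable_indicator_one hA),
      stableLaw_eq_withDensity h1 h2 hν hs hnd hμ ht,
      integral_withDensity_eq_integral_toReal_smul (by fun_prop)
        (ae_of_all _ fun _ => ENNReal.ofReal_lt_top), integral_map (by fun_prop) (by fun_prop),
      ← integral_indicator hA]
    rw [← integral_sub_right_eq_self (μ := volume) (fun y => (ENNReal.ofReal
      (stableDensity ν t y)).toReal • A.indicator (fun _ => (1 : ℝ)) (x + y)) x]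
    refine integral_congr_ae (ae_of_all _ fun y => ?_)
    dsimp only
    rw [ENNReal.toReal_ofReal
      (fourier_stableTransform_nonneg h1 h2 hν hs hnd hμ ht _).1, add_sub_cancel]
    by_cases hy : y ∈ A
    · simp only [hy, indicator_of_mem, smul_eq_mul, mul_one]
      rw [← stableDensity_neg ν t (y - x), neg_sub, sub_eq_add_neg]
    · simp [hy]
  rw [← heq]
  exact H2

theorem abs_indicator_one_le (A : Set (RSpace d)) (x : RSpace d) :
    |A.indicator (fun _ => (1 : ℝ)) x| ≤ 1 := by
  by_cases hx : x ∈ A <;> simp [hx]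

theorem stableSemigroup_indicator_add (h1 : 1 < α) (h2 : α < 2) (hν : IsStableLevyMeasure α ν)
    (hs : IsSymmetricLevy α ν) (hμ : IsStableLaw ν μ) {A : Set (RSpace d)} (hA : MeasurableSet A)
    {s t : ℝ} (hs0 : 0 ≤ s) (ht0 : 0 ≤ t) :
    stableSemigroup α μ (s + t) (A.indicator fun _ => (1 : ℝ)) =
      fun x => ∫ y, stableSemigroup α μ t (A.indicator fun _ => (1 : ℝ)) (x + y)
        ∂(stableLaw α μ s) :=
  funext fun x => stableSemigroup_add h1 h2 hν hs hμ hs0 ht0 (measurable_indicator_one hA)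
    (abs_indicator_one_le A) x

end Semigroup

/-! ### The fractional gradient and its monotone variation -/

section FracGradient

open scoped FourierTransform InnerProductSpace

variable {d : ℕ} {α : ℝ} {ν μ : Measure (RSpace d)} {g : RSpace d → ℝ} {h : RSpace d → ℂ}

theorem sFinite_levy (hα : 0 < α) (hν : IsStableLevyMeasure α ν) : SFinite ν := by
  have := isFiniteMeasure_sphericalPart hν
  rw [← polarMeasure_sphericalPart hα hν]
  unfold polarMeasure
  infer_instance

/-- `g` is bounded and Lipschitz, so its increments are bounded by a multiple of `min 1 ‖u‖`,
uniformly in `x`. This makes the integral defining `D^{α-1} g` converge and justifies Fubini against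
`ν`. -/
theorem FourierRep.norm_increment_le (H : FourierRep g h) :
    ∃ C : ℝ, 0 ≤ C ∧ ∀ x u, ‖(g (x + u) - g x) • u‖ ≤ C * (‖u‖ * min 1 ‖u‖) := by
  obtain ⟨C, hC, hb⟩ := H.norm_gradient_le
  set B := ∫ ξ, ‖h ξ‖ with hB
  have hB0 : 0 ≤ B := by positivity
  refine ⟨2 * B + C, by positivity, fun x u => ?_⟩
  have e1 : |g (x + u) - g x| ≤ 2 * B := by
    have := H.abs_le (x + u)
    have := H.abs_le x
    have := abs_sub (g (x + u)) (g x)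
    linarith
  have e2 : |g (x + u) - g x| ≤ C * ‖u‖ := by
    have := Convex.norm_image_sub_le_of_norm_hasFDerivWithin_le (𝕜 := ℝ) (s := univ) (f := g)
      (f' := fun z => InnerProductSpace.toDual ℝ (RSpace d) (gradient g z)) (C := C) (x := x)
      (y := x + u) (fun z _ => (H.hasGradientAt z).hasFDerivAt.hasFDerivWithinAt)
      (fun z _ => by rw [LinearIsometryEquiv.norm_map]; exact hb z) convex_univ
      (mem_univ _) (mem_univ _)
    simpa using this
  have e3 : |g (x + u) - g x| ≤ (2 * B + C) * min 1 ‖u‖ := by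
    rcases le_total 1 ‖u‖ with hu | hu
    · rw [min_eq_left hu]; linarith
    · rw [min_eq_right hu]; nlinarith [norm_nonneg u]
  rw [norm_smul, Real.norm_eq_abs]
  calc _ ≤ (2 * B + C) * min 1 ‖u‖ * ‖u‖ := by gcongr
    _ = _ := by ring

theorem FourierRep.continuous_fracGradient (H : FourierRep g h) (h1 : 1 < α) (h2 : α < 2)
    (hν : IsStableLevyMeasure α ν) : Continuous (fracGradient ν g) := by
  obtain ⟨C, hC, hb⟩ := H.norm_increment_le
  have hc := H.contDiff.continuous
  exact continuous_of_dominated (bound := fun u => C * (‖u‖ * min 1 ‖u‖))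
    (fun x => by fun_prop) (fun x => ae_of_all _ fun u => hb x u)
    ((integrable_levy_moment h1 h2 hν).const_mul _) (ae_of_all _ fun u => by fun_prop)

theorem FourierRep.fracGradient_translate_average (H : FourierRep g h) (h1 : 1 < α) (h2 : α < 2)
    (hν : IsStableLevyMeasure α ν) (m : Measure (RSpace d)) [IsFiniteMeasure m] (x : RSpace d) :
    fracGradient ν (fun x => ∫ y, g (x + y) ∂m) x = ∫ y, fracGradient ν g (x + y) ∂m := by
  have := sFinite_levy (by linarith) hν
  obtain ⟨C, hC, hb⟩ := H.norm_increment_le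
  have hc := H.contDiff.continuous
  have hi : Integrable (fun p : RSpace d × RSpace d =>
      (g (x + p.1 + p.2) - g (x + p.1)) • p.2) (m.prod ν) := by
    refine (((integrable_levy_moment h1 h2 hν).const_mul C).comp_snd m).mono'
      (by fun_prop) (ae_of_all _ fun p => hb _ _)
  simp only [fracGradient]
  rw [integral_integral_swap hi]
  refine integral_congr_ae (ae_of_all _ fun u => ?_)
  dsimp only
  rw [integral_smul_const, integral_sub]
  · simp only [add_right_comm]
  · have := H.integrable_translate m (x + u)
    simpa only [add_right_comm] using this
  · exact H.integrable_translate m x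

/-- `D^{α-1}` commutes with averages of translates, and averaging under a probability measure
contracts `L¹`. -/
theorem fracVariation_add_le (h1 : 1 < α) (h2 : α < 2) (hν : IsStableLevyMeasure α ν)
    (hs : IsSymmetricLevy α ν) (hnd : IsNondegenerateLevy α ν) (hμ : IsStableLaw ν μ)
    {A : Set (RSpace d)} (hA : MeasurableSet A) (hAf : volume A < ⊤) {s t : ℝ}
    (hs0 : 0 ≤ s) (ht0 : 0 < t) : fracVariation α ν μ A (s + t) ≤ fracVariation α ν μ A t := by
  have := hμ.1
  have := isProbabilityMeasure_stableLaw (α := α) (μ := μ) s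
  have H := fourierRep_stableSemigroup_indicator h1 h2 hν hs hnd hμ hA hAf ht0
  have hc := H.continuous_fracGradient h1 h2 hν
  rw [fracVariation, stableSemigroup_indicator_add h1 h2 hν hs hμ hA hs0 ht0.le]
  simp only [H.fracGradient_translate_average h1 h2 hν]
  refine (lintegral_mono fun x => enorm_integral_le_lintegral_enorm _).trans ?_
  rw [lintegral_lintegral_translate hc.enorm.measurable, measure_univ, one_mul]
  rfl

/-- A nonincreasing function on `(0, ∞)` has a limit at `0⁺`, its supremum. -/
theorem tendsto_limUnder_of_antitone {V : ℝ → ℝ≥0∞}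
    (hV : ∀ s t : ℝ, 0 ≤ s → 0 < t → V (s + t) ≤ V t) :
    Tendsto V (𝓝[>] 0) (𝓝 (limUnder (𝓝[>] 0) V)) := by
  have hanti : AntitoneOn V (Ioi 0) := by
    intro a ha b hb hab
    have := hV (b - a) a (by linarith) ha
    rwa [sub_add_cancel] at this
  refine tendsto_nhds_limUnder ⟨sSup (V '' Ioi 0), ?_⟩
  exact hanti.tendsto_nhdsGT (OrderTop.bddAbove _)

theorem le_limUnder_of_antitone {V : ℝ → ℝ≥0∞}
    (hV : ∀ s t : ℝ, 0 ≤ s → 0 < t → V (s + t) ≤ V t) {t : ℝ} (ht : 0 < t) :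
    V t ≤ limUnder (𝓝[>] 0) V := by
  refine ge_of_tendsto (tendsto_limUnder_of_antitone hV) ?_
  filter_upwards [Ioo_mem_nhdsGT ht] with s hs
  have := hV (t - s) s (by linarith [hs.2]) hs.1
  rwa [sub_add_cancel] at this

end FracGradient

/-! ### The scalar variable `Y` and the classical variation -/

section ScalarStable

open scoped FourierTransform InnerProductSpace

variable {α : ℝ} {Ω : Type*} [MeasurableSpace Ω] {P : Measure Ω} [IsProbabilityMeasure P]
  {Y : Ω → ℝ}

theorem lintegral_one_sub_cos_stable (hY : Measurable Y)
    (hYchar : ∀ ξ : ℝ, ∫ ω, Complex.exp (Complex.I * (ξ * Y ω : ℝ)) ∂P =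
      Complex.exp (-(|ξ| ^ α : ℝ))) (r : ℝ) :
    ∫⁻ ω, ENNReal.ofReal (1 - Real.cos (r * Y ω)) ∂P =
      ENNReal.ofReal (1 - Real.exp (-(|r| ^ α))) := by
  have hi : Integrable (fun ω => Complex.exp (Complex.I * (r * Y ω : ℝ))) P := by
    refine (integrable_const (1 : ℝ)).mono' (by fun_prop) (ae_of_all _ fun ω => ?_)
    rw [mul_comm, Complex.norm_exp_ofReal_mul_I]
  have hre : ∀ ω, RCLike.re (Complex.exp (Complex.I * (r * Y ω : ℝ))) = Real.cos (r * Y ω) := by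
    intro ω
    rw [RCLike.re_eq_complex_re, mul_comm, Complex.exp_ofReal_mul_I_re]
  have h1 := integral_re hi
  simp only [hre] at h1
  rw [hYchar, ← Complex.ofReal_neg, ← Complex.ofReal_exp, RCLike.re_eq_complex_re,
    Complex.ofReal_re] at h1
  have hic : Integrable (fun ω => Real.cos (r * Y ω)) P := by
    have := hi.re
    simpa only [hre] using this
  rw [← ofReal_integral_eq_lintegral_ofReal (f := fun ω => 1 - Real.cos (r * Y ω))
    ((integrable_const 1).sub hic) (ae_of_all _ fun ω => by simpa using Real.cos_le_one _)]
  congr 1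
  rw [integral_sub (integrable_const _) hic, h1]
  simp

/-- A moment of order `β` strictly between `1` and `α` is finite: the cosine integral at exponent
`β` and Tonelli turn it into the integral of `(1 - e^{-r^α}) r^{-(β+1)}`, which converges at `0`
because `β < α` and at infinity because `β > 0`. Then `|Y| ≤ 1 + |Y| ^ β`. -/
theorem lintegral_enorm_stable_lt_top (h1 : 1 < α) (h2 : α < 2) (hY : Measurable Y)
    (hYchar : ∀ ξ : ℝ, ∫ ω, Complex.exp (Complex.I * (ξ * Y ω : ℝ)) ∂P =
      Complex.exp (-(|ξ| ^ α : ℝ))) : ∫⁻ ω, ‖Y ω‖ₑ ∂P < ⊤ := by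
  set β := (1 + α) / 2 with hβ
  have hβ1 : 1 < β := by linarith
  have hβ2 : β < 2 := by linarith
  have hβα : β < α := by linarith
  have hc := cosConst_pos hβ1 hβ2
  have hmom : ∫⁻ ω, ENNReal.ofReal (cosConst β * |Y ω| ^ β) ∂P < ⊤ := by
    simp only [← lintegral_one_sub_cos_mul hβ1 hβ2]
    rw [lintegral_lintegral_swap (by fun_prop)]
    have h3 : ∀ r, ∫⁻ ω, ENNReal.ofReal (1 - Real.cos (r * Y ω)) *
        ENNReal.ofReal (r ^ (-(β + 1))) ∂P =
        ENNReal.ofReal (1 - Real.exp (-(|r| ^ α))) * ENNReal.ofReal (r ^ (-(β + 1))) := by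
      intro r
      rw [lintegral_mul_const _ (by fun_prop), lintegral_one_sub_cos_stable hY hYchar]
    simp only [h3]
    have hi : IntegrableOn (fun r : ℝ => (1 - Real.exp (-(|r| ^ α))) * r ^ (-(β + 1)))
        (Ioi 0) := by
      rw [← Ioc_union_Ioi_eq_Ioi zero_le_one]
      refine IntegrableOn.union ?_ ?_
      · have h4 : IntegrableOn (fun r : ℝ => r ^ (α - β - 1)) (Ioc 0 1) := by
          rw [← intervalIntegrable_iff_integrableOn_Ioc_of_le zero_le_one]
          exact intervalIntegral.intervalIntegrable_rpow' (by linarith)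
        refine h4.mono' (by fun_prop) ((ae_restrict_mem measurableSet_Ioc).mono fun r hr => ?_)
        have hr0 : 0 < r := hr.1
        have h5 := Real.add_one_le_exp (-(|r| ^ α))
        have h6 : Real.exp (-(|r| ^ α)) ≤ 1 := Real.exp_le_one_iff.2 (by simp; positivity)
        rw [abs_of_pos hr0] at h5 h6 ⊢
        rw [Real.norm_of_nonneg (mul_nonneg (by linarith) (by positivity)),
          show α - β - 1 = α + -(β + 1) by ring, Real.rpow_add hr0]
        gcongr
        linarith
      · have h4 : IntegrableOn (fun r : ℝ => r ^ (-(β + 1))) (Ioi 1) :=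
          integrableOn_Ioi_rpow_of_lt (by linarith) one_pos
        refine h4.mono' (by fun_prop) ((ae_restrict_mem measurableSet_Ioi).mono fun r hr => ?_)
        have hr0 : 0 < r := zero_lt_one.trans hr
        have h6 : Real.exp (-(|r| ^ α)) ≤ 1 := Real.exp_le_one_iff.2 (by simp; positivity)
        rw [Real.norm_of_nonneg (mul_nonneg (by linarith) (by positivity))]
        refine mul_le_of_le_one_left (by positivity) ?_
        linarith [Real.exp_pos (-(|r| ^ α))]
    refine lt_of_le_of_lt (lintegral_mono_ae ?_) hi.lintegral_lt_top
    filter_upwards [ae_restrict_mem measurableSet_Ioi] with r hr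
    rw [ENNReal.ofReal_mul' (Real.rpow_nonneg (le_of_lt hr) _)]
  have hle : ∀ ω, ‖Y ω‖ₑ ≤ 1 + ENNReal.ofReal (cosConst β)⁻¹ *
      ENNReal.ofReal (cosConst β * |Y ω| ^ β) := by
    intro ω
    rw [← ENNReal.ofReal_mul (by positivity), inv_mul_cancel_left₀ hc.ne', ← ENNReal.ofReal_one,
      ← ENNReal.ofReal_add zero_le_one (by positivity), ← ofReal_norm, Real.norm_eq_abs]
    refine ENNReal.ofReal_le_ofReal ?_
    have := sub_one_le_rpow hβ1 (abs_nonneg (Y ω))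
    linarith
  refine lt_of_le_of_lt (lintegral_mono hle) ?_
  rw [lintegral_add_left measurable_const, lintegral_const_mul' _ _ ENNReal.ofReal_ne_top]
  simp only [lintegral_const, measure_univ, mul_one]
  exact ENNReal.add_lt_top.2 ⟨ENNReal.one_lt_top, ENNReal.mul_lt_top ENNReal.ofReal_lt_top hmom⟩

/-- Needed to cancel `𝔼|Y|`. If `Y` vanished almost surely its characteristic function at `1` would
be `1` and not `e^{-1}`. -/
theorem lintegral_enorm_stable_ne_zero (hY : Measurable Y)
    (hYchar : ∀ ξ : ℝ, ∫ ω, Complex.exp (Complex.I * (ξ * Y ω : ℝ)) ∂P =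
      Complex.exp (-(|ξ| ^ α : ℝ))) : ∫⁻ ω, ‖Y ω‖ₑ ∂P ≠ 0 := by
  intro h0
  rw [lintegral_eq_zero_iff (by fun_prop)] at h0
  have h1 := lintegral_one_sub_cos_stable hY hYchar 1
  have h2 : ∫⁻ ω, ENNReal.ofReal (1 - Real.cos (1 * Y ω)) ∂P = 0 := by
    rw [lintegral_eq_zero_iff (by fun_prop)]
    filter_upwards [h0] with ω hω
    have : Y ω = 0 := by simpa using hω
    simp [this]
  rw [h2, eq_comm, ENNReal.ofReal_eq_zero, abs_one, Real.one_rpow] at h1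
  have h3 : Real.exp (-1) < 1 := by
    rw [← Real.exp_zero]
    exact Real.exp_lt_exp.2 (by norm_num)
  linarith

variable {d : ℕ} {ν μ : Measure (RSpace d)}

/-- The law of `⟨X ; ξ⟩` under the stable law is that of `σ_α(ξ) Y`. -/
theorem lintegral_enorm_inner_stable (h1 : 1 < α) (h2 : α < 2) (hν : IsStableLevyMeasure α ν)
    (hs : IsSymmetricLevy α ν) (hμ : IsStableLaw ν μ) (hY : Measurable Y)
    (hYchar : ∀ ξ : ℝ, ∫ ω, Complex.exp (Complex.I * (ξ * Y ω : ℝ)) ∂P =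
      Complex.exp (-(|ξ| ^ α : ℝ))) (ξ : RSpace d) :
    ∫⁻ y, ‖(inner ℝ ξ y : ℝ)‖ₑ ∂μ = ‖sigmaNorm α ν ξ‖ₑ * ∫⁻ ω, ‖Y ω‖ₑ ∂P := by
  have := hμ.1
  have hm1 : Measurable fun y : RSpace d => (inner ℝ ξ y : ℝ) := by fun_prop
  have hm2 : Measurable fun ω => sigmaNorm α ν ξ * Y ω := by fun_prop
  have hlaw : μ.map (fun y => (inner ℝ ξ y : ℝ)) = P.map fun ω => sigmaNorm α ν ξ * Y ω := by
    have := Measure.isProbabilityMeasure_map (μ := μ) hm1.aemeasurable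
    have := Measure.isProbabilityMeasure_map (μ := P) hm2.aemeasurable
    refine Measure.ext_of_charFun (funext fun t => ?_)
    rw [charFun_apply, charFun_apply, integral_map hm1.aemeasurable (by fun_prop),
      integral_map hm2.aemeasurable (by fun_prop)]
    have h3 : ∀ y : RSpace d, (inner ℝ (inner ℝ ξ y : ℝ) t : ℝ) = inner ℝ y (t • ξ) := by
      intro y
      rw [inner_smul_right, real_inner_comm ξ y]
      simp
    have h4 : ∀ ω, Complex.exp ((inner ℝ (sigmaNorm α ν ξ * Y ω) t : ℝ) * Complex.I) =
        Complex.exp (Complex.I * ((t * sigmaNorm α ν ξ) * Y ω : ℝ)) := by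
      intro ω
      rw [mul_comm]
      congr 3
      simp [mul_assoc]
    simp only [h3, h4]
    rw [hYchar, ← charFun_apply, charFun_stableLaw h1 h2 hν hs hμ]
    have h5 : levyExponent ν (t • ξ) = |t * sigmaNorm α ν ξ| ^ α := by
      have h6 : levyExponent ν (t • ξ) = levyExponent ν (|t| • ξ) := by
        rcases abs_choice t with h | h <;> rw [h]
        rw [neg_smul, levyExponent_neg]
      rw [h6, levyExponent_smul h1 h2 hν (abs_nonneg t), abs_mul, abs_of_nonneg (sigmaNorm_nonneg ξ),
        Real.mul_rpow (abs_nonneg _) (sigmaNorm_nonneg ξ), sigmaNorm_rpow h1 h2 hν,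
        rpow_one_div_rpow h1 (levyExponent_nonneg ν ξ)]
    rw [h5]
    push_cast
    rfl
  calc ∫⁻ y, ‖(inner ℝ ξ y : ℝ)‖ₑ ∂μ = ∫⁻ z, ‖z‖ₑ ∂(μ.map fun y => (inner ℝ ξ y : ℝ)) := by
        rw [lintegral_map (by fun_prop) hm1]
    _ = ∫⁻ ω, ‖sigmaNorm α ν ξ * Y ω‖ₑ ∂P := by
        rw [hlaw, lintegral_map (by fun_prop) hm2]
    _ = _ := by
        simp only [enorm_mul]
        rw [lintegral_const_mul _ (by fun_prop)]

/-- Replaces `σ_α(∇)` by an average over `y` of `|⟨∇ ; y⟩|`, linear inside the absolute value.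
Convexity arguments then apply for each `y`, with no separate triangle inequality for `σ_α`. -/
theorem classVariation_mul (h1 : 1 < α) (h2 : α < 2) (hν : IsStableLevyMeasure α ν)
    (hs : IsSymmetricLevy α ν) (hμ : IsStableLaw ν μ) (hY : Measurable Y)
    (hYchar : ∀ ξ : ℝ, ∫ ω, Complex.exp (Complex.I * (ξ * Y ω : ℝ)) ∂P =
      Complex.exp (-(|ξ| ^ α : ℝ))) (A : Set (RSpace d)) (t : ℝ) :
    classVariation α ν μ A t * ∫⁻ ω, ‖Y ω‖ₑ ∂P =
      ∫⁻ x, ∫⁻ y, ‖(inner ℝ (gradient (stableSemigroup α μ t (A.indicator fun _ => (1 : ℝ))) x) y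
        : ℝ)‖ₑ ∂μ := by
  rw [classVariation, ← lintegral_mul_const' _ _ (lintegral_enorm_stable_lt_top h1 h2 hY hYchar).ne]
  simp only [lintegral_enorm_inner_stable h1 h2 hν hs hμ hY hYchar]

/-- After multiplication by `𝔼|Y|` and an exchange of integrals, each directional derivative
contracts in `L¹` under averaging; `𝔼|Y|`, finite and nonzero, is then cancelled. -/
theorem classVariation_add_le (h1 : 1 < α) (h2 : α < 2) (hν : IsStableLevyMeasure α ν)
    (hs : IsSymmetricLevy α ν) (hnd : IsNondegenerateLevy α ν) (hμ : IsStableLaw ν μ)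
    (hY : Measurable Y)
    (hYchar : ∀ ξ : ℝ, ∫ ω, Complex.exp (Complex.I * (ξ * Y ω : ℝ)) ∂P =
      Complex.exp (-(|ξ| ^ α : ℝ)))
    {A : Set (RSpace d)} (hA : MeasurableSet A) (hAf : volume A < ⊤) {s t : ℝ}
    (hs0 : 0 ≤ s) (ht0 : 0 < t) : classVariation α ν μ A (s + t) ≤ classVariation α ν μ A t := by
  have := hμ.1
  have := isProbabilityMeasure_stableLaw (α := α) (μ := μ) s
  have H := fourierRep_stableSemigroup_indicator h1 h2 hν hs hnd hμ hA hAf ht0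
  set g := stableSemigroup α μ t (A.indicator fun _ => (1 : ℝ)) with hg
  have hc := H.continuous_gradient
  rw [← ENNReal.mul_le_mul_iff_left (lintegral_enorm_stable_ne_zero hY hYchar)
    (lintegral_enorm_stable_lt_top h1 h2 hY hYchar).ne,
    classVariation_mul h1 h2 hν hs hμ hY hYchar, classVariation_mul h1 h2 hν hs hμ hY hYchar,
    stableSemigroup_indicator_add h1 h2 hν hs hμ hA hs0 ht0.le, ← hg]
  simp only [H.gradient_translate_average]
  have hG : ∀ y : RSpace d, Measurable fun x => ‖(inner ℝ (gradient g x) y : ℝ)‖ₑ := fun y =>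
    (hc.inner continuous_const).enorm.measurable
  have hG2 : Measurable fun p : RSpace d × RSpace d => ‖(inner ℝ (gradient g p.1) p.2 : ℝ)‖ₑ :=
    ((hc.comp continuous_fst).inner continuous_snd).enorm.measurable
  have hGi : Continuous fun x => ∫ z, gradient g (x + z) ∂(stableLaw α μ s) := by
    have := (H.translate_average (stableLaw α μ s)).continuous_gradient
    simpa only [funext (H.gradient_translate_average (stableLaw α μ s))] using this
  have hG3 : Measurable fun p : RSpace d × RSpace d =>
      ‖(inner ℝ (∫ z, gradient g (p.1 + z) ∂(stableLaw α μ s)) p.2 : ℝ)‖ₑ :=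
    ((hGi.comp continuous_fst).inner continuous_snd).enorm.measurable
  rw [lintegral_lintegral_swap hG3.aemeasurable, lintegral_lintegral_swap
    (f := fun x y => ‖(inner ℝ (gradient g x) y : ℝ)‖ₑ) hG2.aemeasurable]
  refine lintegral_mono fun y => ?_
  calc ∫⁻ x, ‖(inner ℝ (∫ z, gradient g (x + z) ∂(stableLaw α μ s)) y : ℝ)‖ₑ
      ≤ ∫⁻ x, ∫⁻ z, ‖(inner ℝ (gradient g (x + z)) y : ℝ)‖ₑ ∂(stableLaw α μ s) := by
        refine lintegral_mono fun x => ?_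
        rw [real_inner_comm, ← integral_inner (H.integrable_gradient _ x)]
        refine (enorm_integral_le_lintegral_enorm _).trans_eq ?_
        simp only [real_inner_comm]
    _ = _ := by
        rw [lintegral_lintegral_translate (hG y), measure_univ, one_mul]

/-- The fundamental theorem of calculus along the segment from `x` to `x + y`, then translation
invariance at each point of the segment. -/
theorem lintegral_increment_le {g : RSpace d → ℝ} {h : RSpace d → ℂ} (H : FourierRep g h)
    (y : RSpace d) :
    ∫⁻ x, ‖g (x + y) - g x‖ₑ ≤ ∫⁻ x, ‖(inner ℝ (gradient g x) y : ℝ)‖ₑ := by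
  have hc := H.continuous_gradient
  have hftc : ∀ x, g (x + y) - g x = ∫ θ in (0 : ℝ)..1, inner ℝ (gradient g (x + θ • y)) y := by
    intro x
    have hd : ∀ θ ∈ uIcc (0 : ℝ) 1, HasDerivAt (fun θ : ℝ => g (x + θ • y))
        (inner ℝ (gradient g (x + θ • y)) y) θ := by
      intro θ _
      have h1 := (H.hasGradientAt (x + θ • y)).hasFDerivAt
      have h2 : HasDerivAt (fun θ : ℝ => x + θ • y) y θ := by
        simpa using ((hasDerivAt_id θ).smul_const y).const_add x
      have h3 := h1.comp_hasDerivAt θ h2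
      exact h3
    have hi : Continuous fun θ : ℝ => (inner ℝ (gradient g (x + θ • y)) y : ℝ) :=
      (hc.comp (by fun_prop)).inner continuous_const
    rw [intervalIntegral.integral_eq_sub_of_hasDerivAt hd (hi.intervalIntegrable _ _)]
    simp
  have hm : Measurable fun p : RSpace d × ℝ =>
      ‖(inner ℝ (gradient g (p.1 + p.2 • y)) y : ℝ)‖ₑ :=
    ((hc.comp (by fun_prop)).inner continuous_const).enorm.measurable
  calc ∫⁻ x, ‖g (x + y) - g x‖ₑ
      ≤ ∫⁻ x, ∫⁻ θ in Ioc (0 : ℝ) 1, ‖(inner ℝ (gradient g (x + θ • y)) y : ℝ)‖ₑ := by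
        refine lintegral_mono fun x => ?_
        rw [hftc, intervalIntegral.integral_of_le zero_le_one]
        exact enorm_integral_le_lintegral_enorm _
    _ = ∫⁻ θ in Ioc (0 : ℝ) 1, ∫⁻ x, ‖(inner ℝ (gradient g (x + θ • y)) y : ℝ)‖ₑ :=
        lintegral_lintegral_swap hm.aemeasurable
    _ = ∫⁻ _θ in Ioc (0 : ℝ) 1, ∫⁻ x, ‖(inner ℝ (gradient g x) y : ℝ)‖ₑ :=
        lintegral_congr fun θ => lintegral_add_right_eq_self
          (fun x => ‖(inner ℝ (gradient g x) y : ℝ)‖ₑ) (θ • y)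
    _ = _ := by simp

/-- Averages the increment bound over `y` of law `t ^ (1/α) X`. The inner average is
`classVariation_mul` and the dilation factor comes out by homogeneity. -/
theorem lintegral_semigroup_sub_le_class (h1 : 1 < α) (h2 : α < 2) (hν : IsStableLevyMeasure α ν)
    (hs : IsSymmetricLevy α ν) (hnd : IsNondegenerateLevy α ν) (hμ : IsStableLaw ν μ)
    (hY : Measurable Y)
    (hYchar : ∀ ξ : ℝ, ∫ ω, Complex.exp (Complex.I * (ξ * Y ω : ℝ)) ∂P =
      Complex.exp (-(|ξ| ^ α : ℝ)))
    {A : Set (RSpace d)} (hA : MeasurableSet A) (hAf : volume A < ⊤) {s t : ℝ}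
    (hs0 : 0 < s) (ht0 : 0 ≤ t) :
    ∫⁻ x, ‖stableSemigroup α μ (t + s) (A.indicator fun _ => (1 : ℝ)) x -
        stableSemigroup α μ s (A.indicator fun _ => (1 : ℝ)) x‖ₑ ≤
      ENNReal.ofReal (t ^ (1 / α)) * (classVariation α ν μ A s * ∫⁻ ω, ‖Y ω‖ₑ ∂P) := by
  have := hμ.1
  have := isProbabilityMeasure_stableLaw (α := α) (μ := μ) t
  have H := fourierRep_stableSemigroup_indicator h1 h2 hν hs hnd hμ hA hAf hs0
  rw [stableSemigroup_indicator_add h1 h2 hν hs hμ hA ht0 hs0.le,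
    classVariation_mul h1 h2 hν hs hμ hY hYchar]
  set g := stableSemigroup α μ s (A.indicator fun _ => (1 : ℝ)) with hg
  have hc := H.continuous_gradient
  have hgc := H.contDiff.continuous
  have hG2 : Measurable fun p : RSpace d × RSpace d => ‖(inner ℝ (gradient g p.1) p.2 : ℝ)‖ₑ :=
    ((hc.comp continuous_fst).inner continuous_snd).enorm.measurable
  calc ∫⁻ x, ‖(∫ y, g (x + y) ∂(stableLaw α μ t)) - g x‖ₑ
      ≤ ∫⁻ x, ∫⁻ y, ‖g (x + y) - g x‖ₑ ∂(stableLaw α μ t) := by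
        refine lintegral_mono fun x => ?_
        have h3 : (∫ y, g (x + y) ∂(stableLaw α μ t)) - g x =
            ∫ y, (g (x + y) - g x) ∂(stableLaw α μ t) := by
          rw [integral_sub (H.integrable_translate _ x) (integrable_const _)]
          simp
        rw [h3]
        exact enorm_integral_le_lintegral_enorm _
    _ = ∫⁻ y, (∫⁻ x, ‖g (x + y) - g x‖ₑ) ∂(stableLaw α μ t) :=
        lintegral_lintegral_swap (by fun_prop)
    _ ≤ ∫⁻ y, (∫⁻ x, ‖(inner ℝ (gradient g x) y : ℝ)‖ₑ) ∂(stableLaw α μ t) :=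
        lintegral_mono fun y => lintegral_increment_le H y
    _ = ∫⁻ x, ∫⁻ y, ‖(inner ℝ (gradient g x) y : ℝ)‖ₑ ∂(stableLaw α μ t) :=
        (lintegral_lintegral_swap hG2.aemeasurable).symm
    _ = ∫⁻ x, ENNReal.ofReal (t ^ (1 / α)) * ∫⁻ y, ‖(inner ℝ (gradient g x) y : ℝ)‖ₑ ∂μ := by
        refine lintegral_congr fun x => ?_
        rw [stableLaw, lintegral_map (by fun_prop) (by fun_prop),
          ← lintegral_const_mul _ (by fun_prop)]
        refine lintegral_congr fun y => ?_
        rw [inner_smul_right, enorm_mul, Real.enorm_of_nonneg (by positivity)]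
    _ = _ := lintegral_const_mul' _ _ ENNReal.ofReal_ne_top

end ScalarStable

/-! ### Pairing the fractional gradient with the gradient of a kernel -/

section FracPairing

open scoped FourierTransform InnerProductSpace

variable {d : ℕ} {α : ℝ} {ν μ : Measure (RSpace d)} {g : RSpace d → ℝ} {h : RSpace d → ℂ}

/-- The multiplication formula for Fourier transforms, with a translation and a dilation in the
first factor. -/
theorem integral_fourier_translate_mul {k q : RSpace d → ℂ} (hk : Integrable k)
    (hq : Integrable q) (c : ℝ) (y : RSpace d) :
    ∫ z, 𝓕 k (y + c • z) * q z = 𝓕 (fun ξ => k ξ * 𝓕 q (c • ξ)) y := by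
  simp only [Real.fourier_eq, Circle.smul_def, smul_eq_mul]
  have hi : Integrable (fun w : RSpace d × RSpace d =>
      (Real.fourierChar (-inner ℝ w.2 (y + c • w.1)) : ℂ) * k w.2 * q w.1)
      (volume.prod volume) := by
    refine (hq.norm.mul_prod hk.norm).mono' ?_ (ae_of_all _ fun w => ?_)
    · refine AEStronglyMeasurable.mul (AEStronglyMeasurable.mul ?_ hk.1.comp_snd) hq.1.comp_fst
      exact (Continuous.aestronglyMeasurable (by fun_prop))
    · rw [norm_mul, norm_mul, Circle.norm_coe, one_mul, mul_comm]
  simp only [← integral_mul_const]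
  rw [integral_integral_swap (f := fun z ξ =>
    (Real.fourierChar (-inner ℝ ξ (y + c • z)) : ℂ) * k ξ * q z) hi]
  refine integral_congr_ae (ae_of_all _ fun ξ => ?_)
  dsimp only
  rw [← integral_const_mul, ← integral_const_mul]
  refine integral_congr_ae (ae_of_all _ fun z => ?_)
  dsimp only
  rw [inner_add_right, neg_add, AddChar.map_add_eq_mul, Circle.coe_mul, inner_smul_right,
    inner_smul_right, real_inner_comm z ξ]
  ring

/-- The directional derivative is the transform of an integrable function and is itself integrable,
so a second transform returns that function reflected. This is where integrability of the gradient
is essential. -/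
theorem FourierRep.fourier_inner_gradient (H : FourierRep g h) (hc : Continuous h)
    (hg : Integrable (gradient g)) (u ξ : RSpace d) :
    𝓕 (fun z => ((inner ℝ (gradient g z) u : ℝ) : ℂ)) ξ =
      2 * Real.pi * Complex.I * (inner ℝ ξ u : ℝ) * h (-ξ) := by
  have h3 : (fun z => ((inner ℝ (gradient g z) u : ℝ) : ℂ)) =
      𝓕 (fun ξ => -(2 * Real.pi * Complex.I * (inner ℝ ξ u : ℝ)) * h ξ) :=
    funext fun z => H.inner_gradient z u
  have hi : Integrable fun ξ => -(2 * Real.pi * Complex.I * (inner ℝ ξ u : ℝ)) * h ξ := by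
    refine (H.int1.const_mul (2 * Real.pi * ‖u‖)).mono' (by fun_prop) (ae_of_all _ fun ξ => ?_)
    have := abs_real_inner_le_norm ξ u
    simp only [norm_mul, norm_neg, Complex.norm_real, Complex.norm_I, Complex.norm_ofNat,
      Real.norm_eq_abs, abs_of_pos Real.pi_pos]
    nlinarith [norm_nonneg (h ξ), mul_nonneg Real.pi_pos.le (norm_nonneg (h ξ)),
      mul_le_mul_of_nonneg_left this (mul_nonneg Real.pi_pos.le (norm_nonneg (h ξ)))]
  have hgi : Integrable (𝓕 (fun ξ => -(2 * Real.pi * Complex.I * (inner ℝ ξ u : ℝ)) * h ξ)) := by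
    rw [← h3]
    exact (hg.inner_const u).ofReal
  have h4 := hi.fourierInv_fourier_eq hgi (v := -ξ) (Continuous.continuousAt (by fun_prop))
  rw [Real.fourierInv_eq_fourier_neg, neg_neg, ← h3] at h4
  rw [h4]
  simp

/-- The phase `e^{-2πi⟨u;ξ⟩} - 1`. -/
def phaseIncrement (u ξ : RSpace d) : ℂ :=
  (Real.fourierChar (-inner ℝ ξ u) : ℂ) - 1

theorem phaseIncrement_eq (u ξ : RSpace d) : phaseIncrement u ξ =
    ((Real.cos (inner ℝ u ((2 * Real.pi) • ξ)) - 1 : ℝ) : ℂ) -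
      (Real.sin (inner ℝ u ((2 * Real.pi) • ξ)) : ℝ) * Complex.I := by
  rw [phaseIncrement, Real.fourierChar_apply, Complex.exp_mul_I, inner_smul_right,
    real_inner_comm, mul_neg, Complex.ofReal_neg, Complex.cos_neg, Complex.sin_neg]
  push_cast
  ring

theorem continuous_phaseIncrement :
    Continuous fun w : RSpace d × RSpace d => phaseIncrement w.1 w.2 := by
  unfold phaseIncrement
  fun_prop

theorem norm_phaseIncrement_le (u ξ : RSpace d) :
    ‖phaseIncrement u ξ‖ ≤ 2 * ((1 + Real.pi * ‖ξ‖) * min 1 ‖u‖) := by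
  have e1 : ‖phaseIncrement u ξ‖ ≤ 2 := by
    refine (norm_sub_le _ _).trans ?_
    rw [Circle.norm_coe, norm_one]
    norm_num
  have e2 : ‖phaseIncrement u ξ‖ ≤ 2 * Real.pi * (‖ξ‖ * ‖u‖) := by
    have := Real.norm_exp_I_mul_ofReal_sub_one_le (x := 2 * Real.pi * -inner ℝ ξ u)
    rw [phaseIncrement, Real.fourierChar_apply, mul_comm _ Complex.I]
    refine this.trans ?_
    rw [norm_mul, norm_neg, Real.norm_of_nonneg (by positivity)]
    exact mul_le_mul_of_nonneg_left (abs_real_inner_le_norm _ _) (by positivity)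
  have := min_mul_le (a := ‖phaseIncrement u ξ‖ / 2) (b := ‖u‖) (c := Real.pi * ‖ξ‖)
    (by positivity) (norm_nonneg _) (le_min (by linarith) (by nlinarith))
  linarith

theorem fourier_phaseIncrement_mul (h0 : Integrable h) (u x : RSpace d) :
    𝓕 (fun ξ => phaseIncrement u ξ * h ξ) x = 𝓕 h (x + u) - 𝓕 h x := by
  simp only [Real.fourier_eq, Circle.smul_def, smul_eq_mul]
  have hi : ∀ x : RSpace d, Integrable fun ξ =>
      (Real.fourierChar (-inner ℝ ξ x) : ℂ) * h ξ := fun x =>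
    h0.norm.mono' ((Continuous.aestronglyMeasurable (by fun_prop)).mul h0.1)
      (ae_of_all _ fun ξ => by rw [norm_mul, Circle.norm_coe, one_mul])
  rw [← integral_sub (hi _) (hi _)]
  refine integral_congr_ae (ae_of_all _ fun ξ => ?_)
  dsimp only
  rw [inner_add_right, neg_add, AddChar.map_add_eq_mul, Circle.coe_mul, phaseIncrement]
  ring

/-- The symbol of `div D^{α-1}`. -/
theorem integral_phaseIncrement_mul (h1 : 1 < α) (h2 : α < 2) (hν : IsStableLevyMeasure α ν)
    (hs : IsSymmetricLevy α ν) (ξ : RSpace d) :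
    ∫ u, phaseIncrement u ξ * (2 * Real.pi * Complex.I * (inner ℝ ξ u : ℝ)) ∂ν =
      (α * levyExponent ν ((2 * Real.pi) • ξ) : ℝ) := by
  set η := (2 * Real.pi) • ξ with hη
  -- The real part is the integrand of Euler's identity; the imaginary part is odd in `u` and
  -- integrates to zero.
  have h3 : ∀ u, phaseIncrement u ξ * (2 * Real.pi * Complex.I * (inner ℝ ξ u : ℝ)) =
      ((Real.sin (inner ℝ u η) * inner ℝ u η : ℝ) : ℂ) +
        (((Real.cos (inner ℝ u η) - 1) * inner ℝ u η : ℝ) : ℂ) * Complex.I := by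
    intro u
    have h4 : (2 * Real.pi * Complex.I * (inner ℝ ξ u : ℝ)) =
        ((inner ℝ u η : ℝ) : ℂ) * Complex.I := by
      rw [hη, inner_smul_right, real_inner_comm]
      push_cast
      ring
    rw [h4, phaseIncrement_eq, ← hη]
    push_cast
    linear_combination (-(Complex.sin (inner ℝ u η : ℝ) * (inner ℝ u η : ℝ))) * Complex.I_sq
  have hi : Integrable (fun u => (Real.cos (inner ℝ u η) - 1) * inner ℝ u η) ν := by
    have hb := (integrable_levy_moment h1 h2 hν).const_mul (2 * (1 + Real.pi * ‖ξ‖) * ‖η‖)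
    refine hb.mono' (by fun_prop) (ae_of_all _ fun u => ?_)
    have e1 : |Real.cos (inner ℝ u η) - 1| ≤ 2 * ((1 + Real.pi * ‖ξ‖) * min 1 ‖u‖) := by
      have h4 := Complex.abs_re_le_norm (phaseIncrement u ξ)
      rw [phaseIncrement_eq, ← hη] at h4
      refine (le_of_eq ?_).trans (h4.trans ?_)
      · rw [Complex.sub_re, Complex.ofReal_re, Complex.re_ofReal_mul, Complex.I_re, mul_zero,
          sub_zero]
      · rw [hη, ← phaseIncrement_eq]
        exact norm_phaseIncrement_le u ξ
    rw [norm_mul, Real.norm_eq_abs, Real.norm_eq_abs]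
    calc _ ≤ (2 * ((1 + Real.pi * ‖ξ‖) * min 1 ‖u‖)) * (‖u‖ * ‖η‖) :=
          mul_le_mul e1 (abs_inner_le u η) (abs_nonneg _) (by positivity)
      _ = _ := by ring
  simp only [h3]
  rw [integral_add (integrable_sin_mul_inner h1 h2 hν η).ofReal (hi.ofReal.mul_const _),
    integral_mul_const, integral_complex_ofReal, integral_complex_ofReal,
    integral_sin_mul_inner h1 h2 hν,
    integral_odd_eq_zero (levy_map_neg (by linarith) hν hs) fun u => by simp]
  simp

/-- For a fixed jump `u`, the multiplication formula turns the `z`-integral into a Fourier integral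
with symbol `(e^{-2πi⟨u;ξ⟩} - 1) 2πi⟨cξ;u⟩`. Integrating this symbol over `ν` gives `c α Ψ(2πξ)` by
`integral_phaseIncrement_mul`. The exchange in `(z, u)` rests on `∇p ∈ L¹`, the one in `(u, ξ)` on
the moments of `h`. -/
theorem FourierRep.integral_inner_fracGradient (H : FourierRep g h) (h1 : 1 < α) (h2 : α < 2)
    (hν : IsStableLevyMeasure α ν) (hs : IsSymmetricLevy α ν) {p : RSpace d → ℝ}
    {T : RSpace d → ℂ} (Hp : FourierRep p T) (hT : Continuous T) (hTn : ∀ ξ, T (-ξ) = T ξ)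
    (hTb : ∀ ξ, ‖T ξ‖ ≤ 1) (hp : Integrable (gradient p)) {c : ℝ} (hc0 : 0 < c) (y : RSpace d) :
    ((∫ z, (inner ℝ (gradient p z) (fracGradient ν g (y + c • z)) : ℝ) : ℝ) : ℂ) =
      c * α * 𝓕 (fun ξ => (levyExponent ν ((2 * Real.pi) • ξ) : ℝ) * (T (c • ξ) * h ξ)) y := by
  have := sFinite_levy (by linarith) hν
  obtain ⟨C, hC, hb⟩ := H.norm_increment_le
  have hgc := H.contDiff.continuous
  have hpc := Hp.continuous_gradient
  have hmom := integrable_levy_moment h1 h2 hν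
  have hincr : ∀ x, Integrable (fun u => (g (x + u) - g x) • u) ν := fun x =>
    (hmom.const_mul C).mono' (by fun_prop) (ae_of_all _ fun u => hb x u)
  have hF1 : Integrable (fun w : RSpace d × RSpace d =>
      (inner ℝ (gradient p w.1) ((g (y + c • w.1 + w.2) - g (y + c • w.1)) • w.2) : ℝ))
      (volume.prod ν) := by
    refine (hp.norm.mul_prod (hmom.const_mul C)).mono' ?_ (ae_of_all _ fun w => ?_)
    · exact (Continuous.inner (hpc.comp continuous_fst) (by fun_prop)).aestronglyMeasurable
    · refine (norm_inner_le_norm _ _).trans ?_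
      exact mul_le_mul_of_nonneg_left (hb _ _) (norm_nonneg _)
  have hF2 : Integrable (fun w : RSpace d × RSpace d =>
      (Real.fourierChar (-inner ℝ w.2 y) : ℂ) * (phaseIncrement w.1 w.2 * h w.2 *
        (2 * Real.pi * Complex.I * (inner ℝ (c • w.2) w.1 : ℝ) * T (-(c • w.2)))))
      (ν.prod volume) := by
    -- The phase contributes `1 + π ‖ξ‖` and the linear factor `‖ξ‖`, so the first and second
    -- moments of `h` both appear.
    have hb2 : Integrable fun ξ => ‖ξ‖ * ‖h ξ‖ + Real.pi * (‖ξ‖ ^ 2 * ‖h ξ‖) :=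
      H.int1.add (H.int2.const_mul _)
    refine ((hmom.mul_prod hb2).const_mul (4 * Real.pi * c)).mono' ?_
      (ae_of_all _ fun w => ?_)
    · have := continuous_phaseIncrement (d := d)
      refine AEStronglyMeasurable.mul (Continuous.aestronglyMeasurable (by fun_prop))
        (AEStronglyMeasurable.mul (AEStronglyMeasurable.mul this.aestronglyMeasurable
          H.int0.1.comp_snd) (Continuous.aestronglyMeasurable (by fun_prop)))
    · have e1 := norm_phaseIncrement_le w.1 w.2
      have e2 : |(inner ℝ (c • w.2) w.1 : ℝ)| ≤ c * (‖w.2‖ * ‖w.1‖) := by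
        rw [inner_smul_left, abs_mul]
        simp only [conj_trivial, abs_of_pos hc0]
        exact mul_le_mul_of_nonneg_left (abs_real_inner_le_norm _ _) hc0.le
      simp only [norm_mul, Complex.norm_real, Complex.norm_I, Complex.norm_ofNat, Circle.norm_coe,
        Real.norm_eq_abs, abs_of_pos Real.pi_pos, one_mul, mul_one]
      calc _ ≤ 2 * ((1 + Real.pi * ‖w.2‖) * min 1 ‖w.1‖) * ‖h w.2‖ *
            (2 * Real.pi * (c * (‖w.2‖ * ‖w.1‖)) * 1) := by
            gcongr
            exact hTb _
        _ = _ := by ring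
  have hstep : ∀ u, ∫ z, ((inner ℝ (gradient p z) ((g (y + c • z + u) - g (y + c • z)) • u) : ℝ) : ℂ)
      = 𝓕 (fun ξ => phaseIncrement u ξ * h ξ *
        (2 * Real.pi * Complex.I * (inner ℝ (c • ξ) u : ℝ) * T (-(c • ξ)))) y := by
    intro u
    have hk : Integrable fun ξ => phaseIncrement u ξ * h ξ := by
      refine (H.int0.norm.const_mul 2).mono' ?_ (ae_of_all _ fun ξ => ?_)
      · exact ((continuous_phaseIncrement.comp (Continuous.prodMk_right u)).aestronglyMeasurable).mul
          H.int0.1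
      · rw [norm_mul]
        refine mul_le_mul_of_nonneg_right ((norm_sub_le _ _).trans ?_) (norm_nonneg _)
        rw [Circle.norm_coe, norm_one]
        norm_num
    have h3 := integral_fourier_translate_mul hk (q := fun z => ((inner ℝ (gradient p z) u : ℝ) : ℂ))
      (hp.inner_const u).ofReal c y
    simp only [Hp.fourier_inner_gradient hT hp, fourier_phaseIncrement_mul H.int0, ← H.eq] at h3
    rw [← h3]
    refine integral_congr_ae (ae_of_all _ fun z => ?_)
    dsimp only
    rw [inner_smul_right]
    push_cast
    ring
  calc ((∫ z, (inner ℝ (gradient p z) (fracGradient ν g (y + c • z)) : ℝ) : ℝ) : ℂ)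
      = ((∫ z, ∫ u, (inner ℝ (gradient p z) ((g (y + c • z + u) - g (y + c • z)) • u) : ℝ) ∂ν : ℝ)
          : ℂ) := by
        congr 1
        refine integral_congr_ae (ae_of_all _ fun z => ?_)
        dsimp only
        rw [fracGradient, integral_inner (hincr _)]
    _ = ∫ u, (∫ z, ((inner ℝ (gradient p z) ((g (y + c • z + u) - g (y + c • z)) • u) : ℝ) : ℂ))
          ∂ν := by
        rw [integral_integral_swap hF1]
        simp only [integral_complex_ofReal]
    _ = ∫ u, (∫ ξ, (Real.fourierChar (-inner ℝ ξ y) : ℂ) * (phaseIncrement u ξ * h ξ *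
        (2 * Real.pi * Complex.I * (inner ℝ (c • ξ) u : ℝ) * T (-(c • ξ))))) ∂ν := by
        simp only [hstep, Real.fourier_eq, Circle.smul_def, smul_eq_mul]
    _ = ∫ ξ, (∫ u, (Real.fourierChar (-inner ℝ ξ y) : ℂ) * (phaseIncrement u ξ * h ξ *
        (2 * Real.pi * Complex.I * (inner ℝ (c • ξ) u : ℝ) * T (-(c • ξ)))) ∂ν) :=
        integral_integral_swap hF2
    _ = _ := by
        rw [Real.fourier_eq, ← integral_const_mul]
        refine integral_congr_ae (ae_of_all _ fun ξ => ?_)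
        dsimp only
        have h4 : ∀ u, (Real.fourierChar (-inner ℝ ξ y) : ℂ) * (phaseIncrement u ξ * h ξ *
            (2 * Real.pi * Complex.I * (inner ℝ (c • ξ) u : ℝ) * T (-(c • ξ)))) =
            ((Real.fourierChar (-inner ℝ ξ y) : ℂ) * h ξ * c * T (c • ξ)) *
            (phaseIncrement u ξ * (2 * Real.pi * Complex.I * (inner ℝ ξ u : ℝ))) := by
          intro u
          rw [hTn, real_inner_smul_left]
          push_cast
          ring
        simp only [h4]
        rw [integral_const_mul, integral_phaseIncrement_mul h1 h2 hν hs, Circle.smul_def,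
          smul_eq_mul]
        push_cast
        ring

end FracPairing

/-! ### Duhamel's formula and the fractional increment bound -/

section FracDuhamel

open scoped FourierTransform InnerProductSpace

variable {d : ℕ} {α : ℝ} {ν μ : Measure (RSpace d)} {g : RSpace d → ℝ} {h : RSpace d → ℂ}

theorem FourierRep.integrable_levyExponent_mul (H : FourierRep g h) (h1 : 1 < α) (h2 : α < 2)
    (hν : IsStableLevyMeasure α ν) :
    Integrable fun ξ => levyExponent ν ((2 * Real.pi) • ξ) * ‖h ξ‖ := by
  obtain ⟨C, hC, hb⟩ := levyExponent_le h1 h2 hν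
  have hc := continuous_levyExponent h1 h2 hν
  have hm := H.int0.1
  refine (((H.int0.norm.add (H.int2.const_mul ((2 * Real.pi) ^ 2))).const_mul C)).mono'
    (AEStronglyMeasurable.mul (Continuous.aestronglyMeasurable (by fun_prop)) hm.norm)
    (ae_of_all _ fun ξ => ?_)
  rw [Real.norm_of_nonneg (mul_nonneg (levyExponent_nonneg _ _) (norm_nonneg _))]
  have e1 : levyExponent ν ((2 * Real.pi) • ξ) ≤ C * (1 + (2 * Real.pi * ‖ξ‖) ^ 2) := by
    refine (hb _).trans (mul_le_mul_of_nonneg_left ?_ hC)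
    have e2 : ‖(2 * Real.pi) • ξ‖ = 2 * Real.pi * ‖ξ‖ := by
      rw [norm_smul, Real.norm_of_nonneg (by positivity)]
    rw [e2]
    have e3 : 0 ≤ 2 * Real.pi * ‖ξ‖ := by positivity
    rcases le_total (2 * Real.pi * ‖ξ‖) 1 with e4 | e4
    · have := Real.rpow_le_one e3 e4 (by linarith : 0 ≤ α)
      nlinarith [sq_nonneg (2 * Real.pi * ‖ξ‖)]
    · have := Real.rpow_le_rpow_of_exponent_le e4 h2.le
      rw [Real.rpow_two] at this
      linarith
  calc _ ≤ C * (1 + (2 * Real.pi * ‖ξ‖) ^ 2) * ‖h ξ‖ := by gcongr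
    _ = _ := by simp only [Pi.add_apply]; ring

theorem integral_mul_exp_neg_mul (a : ℝ) {t : ℝ} (ht : 0 ≤ t) :
    ∫ r in Ioc 0 t, a * Real.exp (-(r * a)) = 1 - Real.exp (-(t * a)) := by
  rw [← intervalIntegral.integral_of_le ht]
  have hd : ∀ r ∈ uIcc 0 t, HasDerivAt (fun r => -Real.exp (-(r * a)))
      (a * Real.exp (-(r * a))) r := by
    intro r _
    have := (((hasDerivAt_id r).mul_const a).neg.exp).neg
    convert! this using 1
    simp only [Pi.neg_apply, id]
    ring
  rw [intervalIntegral.integral_eq_sub_of_hasDerivAt hd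
    (Continuous.intervalIntegrable (by fun_prop) _ _)]
  simp
  ring

/-- Duhamel's formula for the stable semigroup on the Fourier side. -/
theorem FourierRep.integral_fourier_levyExponent_mul (H : FourierRep g h) (h1 : 1 < α) (h2 : α < 2)
    (hν : IsStableLevyMeasure α ν) (hs : IsSymmetricLevy α ν) (hμ : IsStableLaw ν μ)
    {t : ℝ} (ht : 0 ≤ t) (x : RSpace d) :
    ∫ r in Ioc 0 t, 𝓕 (fun ξ => ((levyExponent ν ((2 * Real.pi) • ξ) : ℝ) : ℂ) *
        (stableTransform ν r ξ * h ξ)) x =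
      ((g x - ∫ y, g (x + y) ∂(stableLaw α μ t) : ℝ) : ℂ) := by
  have := hμ.1
  have := isProbabilityMeasure_stableLaw (α := α) (μ := μ) t
  have hm := H.int0.1
  have hc := continuous_levyExponent h1 h2 hν
  have hi : Integrable (fun w : ℝ × RSpace d => (Real.fourierChar (-inner ℝ w.2 x) : ℂ) *
      (((levyExponent ν ((2 * Real.pi) • w.2) : ℝ) : ℂ) * (stableTransform ν w.1 w.2 * h w.2)))
      ((volume.restrict (Ioc 0 t)).prod volume) := by
    have hb := (H.integrable_levyExponent_mul h1 h2 hν).comp_snd (volume.restrict (Ioc 0 t))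
    refine hb.mono' ?_ ?_
    · unfold stableTransform
      refine AEStronglyMeasurable.mul (Continuous.aestronglyMeasurable (by fun_prop))
        (AEStronglyMeasurable.mul (Continuous.aestronglyMeasurable (by fun_prop))
        (AEStronglyMeasurable.mul (Continuous.aestronglyMeasurable (by fun_prop)) hm.comp_snd))
    · have h3 : ∀ᵐ w ∂((volume.restrict (Ioc 0 t)).prod (volume : Measure (RSpace d))),
          w.1 ∈ Ioc 0 t :=
        Measure.quasiMeasurePreserving_fst.ae (ae_restrict_mem measurableSet_Ioc)
      filter_upwards [h3] with w hw
      have h4 := levyExponent_nonneg ν ((2 * Real.pi) • w.2)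
      rw [norm_mul, norm_mul, norm_mul, Circle.norm_coe, one_mul, Complex.norm_real,
        Real.norm_of_nonneg h4, stableTransform, Complex.norm_real,
        Real.norm_of_nonneg (Real.exp_nonneg _)]
      have h5 : Real.exp (-(w.1 * levyExponent ν ((2 * Real.pi) • w.2))) ≤ 1 :=
        Real.exp_le_one_iff.2 (by have := mul_nonneg hw.1.le h4; linarith)
      exact mul_le_mul_of_nonneg_left (mul_le_of_le_one_left (norm_nonneg _) h5) h4
  have h6 := (H.translate_average (stableLaw α μ t)).eq x
  simp only [charFun_stableLaw_neg_two_pi h1 h2 hν hs hμ ht] at h6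
  rw [Complex.ofReal_sub, h6, H.eq]
  simp only [Real.fourier_eq, Circle.smul_def, smul_eq_mul]
  rw [integral_integral_swap hi, ← integral_sub]
  · refine integral_congr_ae (ae_of_all _ fun ξ => ?_)
    dsimp only
    rw [integral_const_mul]
    have h7 : ∀ r, ((levyExponent ν ((2 * Real.pi) • ξ) : ℝ) : ℂ) *
        (stableTransform ν r ξ * h ξ) = ((levyExponent ν ((2 * Real.pi) • ξ) *
          Real.exp (-(r * levyExponent ν ((2 * Real.pi) • ξ))) : ℝ) : ℂ) * h ξ := by
      intro r
      rw [stableTransform]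
      push_cast
      ring
    simp only [h7]
    rw [integral_mul_const, integral_complex_ofReal, integral_mul_exp_neg_mul _ ht,
      stableTransform]
    push_cast
    ring
  · exact H.int0.norm.mono' ((Continuous.aestronglyMeasurable (by fun_prop)).mul hm)
      (ae_of_all _ fun ξ => by rw [norm_mul, Circle.norm_coe, one_mul])
  · have h8 := continuous_stableTransform h1 h2 hν t
    refine H.int0.norm.mono' ((Continuous.aestronglyMeasurable (by fun_prop)).mul
      (hm.mul h8.aestronglyMeasurable)) (ae_of_all _ fun ξ => ?_)
    rw [norm_mul, norm_mul, Circle.norm_coe, one_mul]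
    refine mul_le_of_le_one_right (norm_nonneg _) ?_
    rw [stableTransform, Complex.norm_real, Real.norm_of_nonneg (Real.exp_nonneg _)]
    exact Real.exp_le_one_iff.2
      (by have := mul_nonneg ht (levyExponent_nonneg ν ((2 * Real.pi) • ξ)); linarith)

/-- Duhamel's formula with the pairing at `c = r ^ (1/α)`, for which `T (c ξ)` is the transform at
time `r`. Dividing by `c α` gives the weight. The derivative falls on the kernel, so only `D^{α-1}
g` is left on the other side. -/
theorem FourierRep.sub_average_eq (H : FourierRep g h) (hd : 1 ≤ d) (h1 : 1 < α) (h2 : α < 2)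
    (hν : IsStableLevyMeasure α ν) (hs : IsSymmetricLevy α ν) (hnd : IsNondegenerateLevy α ν)
    (hμ : IsStableLaw ν μ) {t : ℝ} (ht : 0 ≤ t) (x : RSpace d) :
    g x - ∫ y, g (x + y) ∂(stableLaw α μ t) =
      ∫ r in Ioc 0 t, r ^ (-(1 / α)) / α * ∫ z, (inner ℝ (gradient (stableDensity ν 1) z)
        (fracGradient ν g (x + r ^ (1 / α) • z)) : ℝ) := by
  have Hp := fourierRep_stableDensity h1 h2 hν hs hnd hμ one_pos
  have hp : Integrable (gradient (stableDensity ν 1)) :=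
    ⟨Hp.continuous_gradient.aestronglyMeasurable,
      lintegral_gradient_stableDensity_lt_top hd h1 h2 hν hs hnd⟩
  have h3 := H.integral_fourier_levyExponent_mul h1 h2 hν hs hμ ht x
  refine Complex.ofReal_injective ?_
  rw [← h3, ← integral_complex_ofReal]
  refine setIntegral_congr_fun measurableSet_Ioc fun r hr => ?_
  have hr0 : 0 < r := hr.1
  have hc0 : 0 < r ^ (1 / α) := Real.rpow_pos_of_pos hr0 _
  have h4 := H.integral_inner_fracGradient h1 h2 hν hs Hp (continuous_stableTransform h1 h2 hν 1)
    (fun ξ => by simp only [stableTransform, smul_neg, levyExponent_neg])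
    (fun ξ => by
      rw [stableTransform, Complex.norm_real, Real.norm_of_nonneg (Real.exp_nonneg _), one_mul]
      exact Real.exp_le_one_iff.2 (by linarith [levyExponent_nonneg ν ((2 * Real.pi) • ξ)]))
    hp hc0 x
  have h5 : ∀ ξ, stableTransform ν 1 (r ^ (1 / α) • ξ) = stableTransform ν r ξ := by
    intro ξ
    rw [stableTransform, stableTransform, one_mul, mul_levyExponent h1 h2 hν hr0.le, smul_comm]
  simp only [h5] at h4
  rw [Complex.ofReal_mul, h4, Real.rpow_neg hr0.le]
  have h6 : ((r ^ (1 / α) : ℝ) : ℂ) ≠ 0 := by exact_mod_cast hc0.ne'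
  have h7 : (α : ℂ) ≠ 0 := by
    have : α ≠ 0 := by linarith
    exact_mod_cast this
  push_cast
  field_simp

/-- By translation invariance the `z`-integral contributes the product of the `L¹` norms for every
`r`. The time integral of `r ^ (-1/α) / α` converges since `α > 1` and gives `t ^ ((α-1)/α) / (α -
1)`. -/
theorem FourierRep.lintegral_average_sub_le (H : FourierRep g h) (hd : 1 ≤ d) (h1 : 1 < α)
    (h2 : α < 2) (hν : IsStableLevyMeasure α ν) (hs : IsSymmetricLevy α ν)
    (hnd : IsNondegenerateLevy α ν) (hμ : IsStableLaw ν μ) {t : ℝ} (ht : 0 ≤ t) :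
    ∫⁻ x, ‖(∫ y, g (x + y) ∂(stableLaw α μ t)) - g x‖ₑ ≤
      ENNReal.ofReal (t ^ ((α - 1) / α) / (α - 1)) *
        ((∫⁻ z, ‖gradient (stableDensity ν 1) z‖ₑ) * ∫⁻ x, ‖fracGradient ν g x‖ₑ) := by
  have hp := (fourierRep_stableDensity h1 h2 hν hs hnd hμ one_pos).continuous_gradient
  have hD := H.continuous_fracGradient h1 h2 hν
  set q := gradient (stableDensity ν 1) with hq
  set D := fracGradient ν g with hDdef
  have hα0 : 0 < α := by linarith
  have hmF : Measurable fun w : (RSpace d × ℝ) × RSpace d =>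
      ‖q w.2‖ₑ * ‖D (w.1.1 + w.1.2 ^ (1 / α) • w.2)‖ₑ := by
    have e1 : Measurable fun w : (RSpace d × ℝ) × RSpace d => q w.2 :=
      hp.measurable.comp measurable_snd
    have e2 : Measurable fun w : (RSpace d × ℝ) × RSpace d => D (w.1.1 + w.1.2 ^ (1 / α) • w.2) :=
      hD.measurable.comp (by fun_prop)
    exact e1.enorm.mul e2.enorm
  have hm1 : Measurable fun w : RSpace d × ℝ => ENNReal.ofReal (w.2 ^ (-(1 / α)) / α) *
      ∫⁻ z, ‖q z‖ₑ * ‖D (w.1 + w.2 ^ (1 / α) • z)‖ₑ :=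
    Measurable.mul (by fun_prop) hmF.lintegral_prod_right'
  calc ∫⁻ x, ‖(∫ y, g (x + y) ∂(stableLaw α μ t)) - g x‖ₑ
      ≤ ∫⁻ x, ∫⁻ r in Ioc 0 t, ENNReal.ofReal (r ^ (-(1 / α)) / α) *
          ∫⁻ z, ‖q z‖ₑ * ‖D (x + r ^ (1 / α) • z)‖ₑ := by
        refine lintegral_mono fun x => ?_
        rw [enorm_sub_rev, H.sub_average_eq hd h1 h2 hν hs hnd hμ ht x]
        refine (enorm_integral_le_lintegral_enorm _).trans
          (setLIntegral_mono' measurableSet_Ioc fun r hr => ?_)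
        rw [enorm_mul, Real.enorm_of_nonneg (div_nonneg (Real.rpow_nonneg hr.1.le _) hα0.le)]
        gcongr
        refine (enorm_integral_le_lintegral_enorm _).trans (lintegral_mono fun z => ?_)
        rw [← ofReal_norm, ← ofReal_norm, ← ofReal_norm, ← ENNReal.ofReal_mul (norm_nonneg _)]
        exact ENNReal.ofReal_le_ofReal (norm_inner_le_norm _ _)
    _ = ∫⁻ r in Ioc 0 t, ∫⁻ x, ENNReal.ofReal (r ^ (-(1 / α)) / α) *
          ∫⁻ z, ‖q z‖ₑ * ‖D (x + r ^ (1 / α) • z)‖ₑ := lintegral_lintegral_swap hm1.aemeasurable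
    _ = ∫⁻ r in Ioc 0 t, ENNReal.ofReal (r ^ (-(1 / α)) / α) *
          ((∫⁻ z, ‖q z‖ₑ) * ∫⁻ x, ‖D x‖ₑ) := by
        refine lintegral_congr fun r => ?_
        have e3 : Measurable fun w : RSpace d × RSpace d =>
            ‖q w.2‖ₑ * ‖D (w.1 + r ^ (1 / α) • w.2)‖ₑ :=
          (hp.measurable.comp measurable_snd).enorm.mul
            (hD.measurable.comp (by fun_prop : Measurable fun w : RSpace d × RSpace d =>
              w.1 + r ^ (1 / α) • w.2)).enorm
        rw [lintegral_const_mul' _ _ ENNReal.ofReal_ne_top, lintegral_lintegral_swap e3.aemeasurable,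
          ← lintegral_mul_const _ hp.measurable.enorm]
        congr 1
        refine lintegral_congr fun z => ?_
        rw [lintegral_const_mul' _ _ enorm_ne_top, lintegral_add_right_eq_self (fun x => ‖D x‖ₑ)]
    _ = _ := by
        rw [lintegral_mul_const _ (by fun_prop)]
        congr 1
        have e4 : IntegrableOn (fun r : ℝ => r ^ (-(1 / α))) (Ioc 0 t) := by
          rw [← intervalIntegrable_iff_integrableOn_Ioc_of_le ht]
          refine intervalIntegral.intervalIntegrable_rpow' ?_
          rw [neg_lt_neg_iff, div_lt_one hα0]
          exact h1
        rw [← ofReal_integral_eq_lintegral_ofReal (e4.div_const α)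
          ((ae_restrict_mem measurableSet_Ioc).mono fun r hr =>
            div_nonneg (Real.rpow_nonneg hr.1.le _) hα0.le), integral_div,
          ← intervalIntegral.integral_of_le ht, integral_rpow]
        · congr 1
          have e5 : -(1 / α) + 1 = (α - 1) / α := by field_simp; ring
          rw [e5, Real.zero_rpow (by
            have : (0 : ℝ) < (α - 1) / α := div_pos (by linarith) hα0
            exact this.ne'), sub_zero]
          have : α - 1 ≠ 0 := by linarith
          field_simp
        · left
          rw [neg_lt_neg_iff, div_lt_one hα0]
          exact h1

theorem lintegral_semigroup_sub_le_frac (hd : 1 ≤ d) (h1 : 1 < α) (h2 : α < 2)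
    (hν : IsStableLevyMeasure α ν) (hs : IsSymmetricLevy α ν) (hnd : IsNondegenerateLevy α ν)
    (hμ : IsStableLaw ν μ) {A : Set (RSpace d)} (hA : MeasurableSet A) (hAf : volume A < ⊤)
    {s t : ℝ} (hs0 : 0 < s) (ht0 : 0 ≤ t) :
    ∫⁻ x, ‖stableSemigroup α μ (t + s) (A.indicator fun _ => (1 : ℝ)) x -
        stableSemigroup α μ s (A.indicator fun _ => (1 : ℝ)) x‖ₑ ≤
      ENNReal.ofReal (t ^ ((α - 1) / α) / (α - 1)) *
        ((∫⁻ z, ‖gradient (stableDensity ν 1) z‖ₑ) * fracVariation α ν μ A s) := by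
  rw [stableSemigroup_indicator_add h1 h2 hν hs hμ hA ht0 hs0.le]
  exact (fourierRep_stableSemigroup_indicator h1 h2 hν hs hnd hμ hA hAf hs0).lintegral_average_sub_le
    hd h1 h2 hν hs hnd hμ ht0

end FracDuhamel

/-! ### Mass conservation and the bound on the kernel -/

section VolumeBound

open scoped FourierTransform InnerProductSpace

variable {d : ℕ} {α : ℝ} {ν μ : Measure (RSpace d)} {A : Set (RSpace d)}

theorem tendsto_volume_inter_translate (hA : MeasurableSet A) (hAf : volume A < ⊤) :
    Tendsto (fun w : RSpace d => volume (A ∩ (fun x => x + w) ⁻¹' A)) (𝓝 0) (𝓝 (volume A)) := by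
  -- Translations as a continuous family of continuous maps, the form used by
  -- `tendsto_measure_symmDiff_preimage_nhds_zero`.
  let F : C(RSpace d, C(RSpace d, RSpace d)) :=
    ContinuousMap.curry ⟨fun p : RSpace d × RSpace d => p.2 + p.1, by fun_prop⟩
  have hF : ∀ w x, F w x = x + w := fun w x => rfl
  have hmp : ∀ w, MeasurePreserving (F w) (volume : Measure (RSpace d)) volume := fun w =>
    measurePreserving_add_right volume w
  have h1 : Tendsto (fun w => volume (symmDiff (F w ⁻¹' A) (F 0 ⁻¹' A))) (𝓝 0) (𝓝 0) :=
    tendsto_measure_symmDiff_preimage_nhds_zero F.continuous.continuousAt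
      (Eventually.of_forall hmp) (hmp 0) hA.nullMeasurableSet hAf.ne
  have h0 : F 0 ⁻¹' A = A := by ext x; simp [hF]
  rw [h0] at h1
  have h2 : Tendsto (fun w => volume A - volume (symmDiff (F w ⁻¹' A) A)) (𝓝 0) (𝓝 (volume A)) := by
    simpa using ENNReal.Tendsto.sub (tendsto_const_nhds (x := volume A)) h1 (Or.inl hAf.ne)
  refine tendsto_of_tendsto_of_tendsto_of_le_of_le h2 tendsto_const_nhds (fun w => ?_)
    (fun w => measure_mono inter_subset_left)
  refine tsub_le_iff_right.2 ?_
  refine (measure_mono (fun x hx => ?_)).trans (measure_union_le _ _)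
  by_cases hx' : x ∈ F w ⁻¹' A
  · exact Or.inl ⟨hx, hx'⟩
  · exact Or.inr (Or.inr ⟨hx, hx'⟩)

theorem measurable_stableLaw_translate [IsProbabilityMeasure μ] (hA : MeasurableSet A) (s : ℝ) :
    Measurable fun x => stableLaw α μ s ((fun y => x + y) ⁻¹' A) := by
  have := isProbabilityMeasure_stableLaw (α := α) (μ := μ) s
  exact measurable_measure_prodMk_left
    ((by fun_prop : Measurable fun p : RSpace d × RSpace d => p.1 + p.2) hA)

theorem enorm_stableSemigroup_indicator [IsProbabilityMeasure μ] (hA : MeasurableSet A) (s : ℝ)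
    (x : RSpace d) : ‖stableSemigroup α μ s (A.indicator fun _ => (1 : ℝ)) x‖ₑ =
      stableLaw α μ s ((fun y => x + y) ⁻¹' A) := by
  have := isProbabilityMeasure_stableLaw (α := α) (μ := μ) s
  have hm : MeasurableSet ((fun y => x + y) ⁻¹' A) := measurable_const_add x hA
  have h3 : (fun y => A.indicator (fun _ => (1 : ℝ)) (x + y)) =
      ((fun y => x + y) ⁻¹' A).indicator fun _ => (1 : ℝ) := rfl
  rw [stableSemigroup_eq (measurable_indicator_one hA), h3, integral_indicator hm]
  simp [Real.enorm_of_nonneg]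

theorem stableSemigroup_indicator_nonneg (A : Set (RSpace d)) (s : ℝ) (x : RSpace d) :
    0 ≤ stableSemigroup α μ s (A.indicator fun _ => (1 : ℝ)) x :=
  integral_nonneg fun _ => indicator_nonneg (fun _ _ => zero_le_one) _

theorem lintegral_stableSemigroup_indicator [IsProbabilityMeasure μ] (hA : MeasurableSet A)
    (s : ℝ) : ∫⁻ x, ‖stableSemigroup α μ s (A.indicator fun _ => (1 : ℝ)) x‖ₑ = volume A := by
  have := isProbabilityMeasure_stableLaw (α := α) (μ := μ) s
  simp only [enorm_stableSemigroup_indicator hA]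
  have h3 := lintegral_lintegral_translate
    (measurable_const.indicator hA : Measurable (A.indicator fun _ => (1 : ℝ≥0∞)))
    (stableLaw α μ s)
  have h4 : ∫⁻ x, A.indicator (fun _ => (1 : ℝ≥0∞)) x = volume A := lintegral_indicator_one hA
  rw [h4, measure_univ, one_mul] at h3
  rw [← h3]
  refine lintegral_congr fun x => ?_
  exact (lintegral_indicator_one (measurable_const_add x hA)).symm

theorem integrable_stableSemigroup_indicator [IsProbabilityMeasure μ] (hA : MeasurableSet A)
    (hAf : volume A < ⊤) (s : ℝ) :
    Integrable (stableSemigroup α μ s (A.indicator fun _ => (1 : ℝ))) := by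
  have hm := (measurable_stableLaw_translate (α := α) (μ := μ) hA s).ennreal_toReal
  have h3 : stableSemigroup α μ s (A.indicator fun _ => (1 : ℝ)) =
      fun x => (stableLaw α μ s ((fun y => x + y) ⁻¹' A)).toReal := by
    funext x
    rw [← enorm_stableSemigroup_indicator hA, toReal_enorm,
      Real.norm_of_nonneg (stableSemigroup_indicator_nonneg A s x)]
  refine ⟨by rw [h3]; exact hm.aestronglyMeasurable, ?_⟩
  rw [HasFiniteIntegral, lintegral_stableSemigroup_indicator hA]
  exact hAf

/-- By Tonelli, `∫_A P_s 1_A` is the `μ`-average of the volumes of `A ∩ (A - s ^ (1/α) y)`, each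
bounded by the volume of `A`. This is the only continuity of the semigroup at time `0` that the
argument needs. -/
theorem tendsto_setLIntegral_stableSemigroup (h1 : 1 < α) [IsProbabilityMeasure μ]
    (hA : MeasurableSet A) (hAf : volume A < ⊤) :
    Tendsto (fun s => ∫⁻ x in A, ‖stableSemigroup α μ s (A.indicator fun _ => (1 : ℝ)) x‖ₑ)
      (𝓝[>] 0) (𝓝 (volume A)) := by
  set φ : RSpace d → ℝ≥0∞ := fun w => volume (A ∩ (fun x => x + w) ⁻¹' A) with hφ
  have hS : MeasurableSet {p : RSpace d × RSpace d | p.1 + p.2 ∈ A} :=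
    (by fun_prop : Measurable fun p : RSpace d × RSpace d => p.1 + p.2) hA
  have hφm : Measurable φ := by
    have := measurable_measure_prodMk_right (μ := volume.restrict A) hS
    convert! this using 2 with w
    refine Eq.trans ?_ (Measure.restrict_apply (measurable_add_const w hA)).symm
    rw [hφ, inter_comm]
  have h3 : ∀ s, ∫⁻ x in A, ‖stableSemigroup α μ s (A.indicator fun _ => (1 : ℝ)) x‖ₑ =
      ∫⁻ y, φ (s ^ (1 / α) • y) ∂μ := by
    intro s
    have := isProbabilityMeasure_stableLaw (α := α) (μ := μ) s
    simp only [enorm_stableSemigroup_indicator hA]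
    have h4 := Measure.prod_apply (μ := volume.restrict A) (ν := stableLaw α μ s) hS
    have h5 := Measure.prod_apply_symm (μ := volume.restrict A) (ν := stableLaw α μ s) hS
    rw [← lintegral_map (g := fun y => s ^ (1 / α) • y) hφm (by fun_prop)]
    refine h4.symm.trans (h5.trans (lintegral_congr fun w => ?_))
    refine (Measure.restrict_apply (measurable_add_const w hA)).trans ?_
    rw [hφ, inter_comm]
  simp only [h3]
  have h4 : ∫⁻ _y, volume A ∂μ = volume A := by simp
  rw [← h4]
  refine tendsto_lintegral_filter_of_dominated_convergence (fun _ => volume A)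
    (Eventually.of_forall fun s => hφm.comp (measurable_const_smul _))
    (Eventually.of_forall fun s => ae_of_all _ fun y => measure_mono inter_subset_left)
    (by rw [h4]; exact hAf.ne) (ae_of_all _ fun y => ?_)
  refine (tendsto_volume_inter_translate hA hAf).comp ?_
  have h5 : Tendsto (fun s : ℝ => s ^ (1 / α)) (𝓝[>] 0) (𝓝 0) := by
    have h6 : (0 : ℝ) < 1 / α := by positivity
    have := (Real.continuous_rpow_const h6.le).tendsto 0
    rw [Real.zero_rpow h6.ne'] at this
    exact this.mono_left nhdsWithin_le_nhds
  simpa using h5.smul_const y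

theorem stableLaw_apply_le {p : RSpace d → ℝ}
    (hp : μ = volume.withDensity fun x => ENNReal.ofReal (p x)) {t : ℝ} (ht : 0 < t)
    {B : Set (RSpace d)} (hB : MeasurableSet B) :
    stableLaw α μ t B ≤ (⨆ x, ‖p x‖ₑ) * (ENNReal.ofReal ((t ^ (1 / α)) ^ d)⁻¹ * volume B) := by
  have hc : 0 < t ^ (1 / α) := by positivity
  have h3 := Measure.addHaar_preimage_smul (volume : Measure (RSpace d)) hc.ne' B
  rw [finrank_euclideanSpace_fin, abs_of_pos (by positivity)] at h3
  rw [← h3, stableLaw, Measure.map_apply (by fun_prop) hB, hp,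
    withDensity_apply _ (measurable_const_smul _ hB), ← setLIntegral_const]
  refine lintegral_mono fun x => le_trans ?_ (le_iSup (fun x => ‖p x‖ₑ) x)
  exact Real.ofReal_le_enorm _

/-- With equal total integrals, the positive and negative parts of `f₂ - f₁` both have half its `L¹`
norm as integral, so `∫_A (f₂ - f₁)` is at most that half. -/
theorem two_mul_setLIntegral_le {f₁ f₂ : RSpace d → ℝ} (hf₁ : Integrable f₁) (hf₂ : Integrable f₂)
    (h₁ : ∀ x, 0 ≤ f₁ x) (h₂ : ∀ x, 0 ≤ f₂ x) (hint : ∫⁻ x, ‖f₁ x‖ₑ = ∫⁻ x, ‖f₂ x‖ₑ)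
    (hA : MeasurableSet A) :
    2 * ∫⁻ x in A, ‖f₂ x‖ₑ ≤ 2 * (∫⁻ x in A, ‖f₁ x‖ₑ) + ∫⁻ x, ‖f₁ x - f₂ x‖ₑ := by
  have hi : ∀ {f : RSpace d → ℝ} {m : Measure (RSpace d)}, Integrable f m → (∀ x, 0 ≤ f x) →
      ∫⁻ x, ‖f x‖ₑ ∂m = ENNReal.ofReal (∫ x, f x ∂m) := by
    intro f m hf h
    rw [ofReal_integral_eq_lintegral_ofReal hf (ae_of_all _ h)]
    simp only [Real.enorm_of_nonneg (h _)]
  have hd := hf₁.sub hf₂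
  have heq : ∫ x, f₁ x = ∫ x, f₂ x := by
    rw [hi hf₁ h₁, hi hf₂ h₂] at hint
    exact (ENNReal.ofReal_eq_ofReal_iff (integral_nonneg h₁) (integral_nonneg h₂)).1 hint
  have hn : ∫⁻ x, ‖f₁ x - f₂ x‖ₑ = ENNReal.ofReal (∫ x, |f₁ x - f₂ x|) := by
    rw [← hi (f := fun x => |f₁ x - f₂ x|) hd.norm fun x => abs_nonneg _]
    simp
  have h2 : ∀ a : ℝ, 2 * ENNReal.ofReal a = ENNReal.ofReal (2 * a) := fun a => by
    rw [ENNReal.ofReal_mul zero_le_two, ENNReal.ofReal_ofNat]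
  rw [hi hf₁.integrableOn h₁, hi hf₂.integrableOn h₂, hn, h2, h2, ← ENNReal.ofReal_add
      (mul_nonneg zero_le_two (integral_nonneg h₁)) (integral_nonneg fun x => abs_nonneg _)]
  refine ENNReal.ofReal_le_ofReal ?_
  have hab : Integrable fun x => |f₁ x - f₂ x| := hd.norm
  have h4 : ∫ x in A, (f₂ x - f₁ x) ≤ ∫ x, (|f₁ x - f₂ x| + (f₂ x - f₁ x)) / 2 := by
    rw [← integral_indicator hA]
    refine integral_mono ((hf₂.sub hf₁).indicator hA) ((hab.add (hf₂.sub hf₁)).div_const 2)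
      fun x => ?_
    have e1 := neg_abs_le (f₁ x - f₂ x)
    have e2 := le_abs_self (f₁ x - f₂ x)
    by_cases hx : x ∈ A
    · rw [indicator_of_mem hx]
      simp only
      linarith
    · rw [indicator_of_notMem hx]
      simp only
      linarith
  rw [integral_div, integral_add (f := fun x => |f₁ x - f₂ x|) (g := fun x => f₂ x - f₁ x) hab (hf₂.sub hf₁), integral_sub hf₂.integrableOn hf₁.integrableOn,
    integral_sub hf₂ hf₁, heq] at h4
  linarith

/-- Compares `P_{t+s} 1_A` with `P_s 1_A` on `A` and lets `s` tend to `0`. The kernel bound at time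
`t + s` is dominated by the one at time `t`, hence uniform in `s`. -/
theorem two_mul_volume_le (h1 : 1 < α) (hμ : IsProbabilityMeasure μ) {p : RSpace d → ℝ}
    (hp : μ = volume.withDensity fun x => ENNReal.ofReal (p x))
    (hA : MeasurableSet A) (hAf : volume A < ⊤) {t : ℝ} (ht : 0 < t) {R : ℝ≥0∞}
    (hR : ∀ s, 0 < s → ∫⁻ x, ‖stableSemigroup α μ (t + s) (A.indicator fun _ => (1 : ℝ)) x -
        stableSemigroup α μ s (A.indicator fun _ => (1 : ℝ)) x‖ₑ ≤ R) :
    2 * volume A ≤ 2 * ((⨆ x, ‖p x‖ₑ) * (ENNReal.ofReal ((t ^ (1 / α)) ^ d)⁻¹ * volume A)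
      * volume A) + R := by
  have h3 := ENNReal.Tendsto.const_mul
    (tendsto_setLIntegral_stableSemigroup (α := α) (μ := μ) h1 hA hAf)
    (Or.inr (ENNReal.ofNat_ne_top (n := 2)))
  refine le_of_tendsto h3 ?_
  filter_upwards [self_mem_nhdsWithin] with s hs
  have hs : 0 < s := hs
  refine (two_mul_setLIntegral_le
    (integrable_stableSemigroup_indicator (α := α) (μ := μ) hA hAf (t + s))
    (integrable_stableSemigroup_indicator (α := α) (μ := μ) hA hAf s) (stableSemigroup_indicator_nonneg A _)
    (stableSemigroup_indicator_nonneg A _) ?_ hA).trans ?_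
  · rw [lintegral_stableSemigroup_indicator hA, lintegral_stableSemigroup_indicator hA]
  · refine add_le_add (mul_le_mul_right ?_ _) (hR s hs)
    rw [← setLIntegral_const]
    refine lintegral_mono fun x => ?_
    rw [enorm_stableSemigroup_indicator hA]
    refine (stableLaw_apply_le (α := α) hp (by positivity) (measurable_const_add x hA)).trans ?_
    have h4 : volume ((fun y => x + y) ⁻¹' A) = volume A := measure_preimage_add _ x A
    rw [h4]
    have hc : 0 < t ^ (1 / α) := by positivity
    gcongr
    linarith

end VolumeBound

/-! ### Optimisation in the time scale -/

section Optimization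

variable {d : ℕ} {θ : ℝ}

/-- Since `(2d) ^ (θ/(d+θ)) = 2d (2d) ^ (-d/(d+θ))`, a common power factors out. The right-hand side
is the constant produced by the optimisation. -/
theorem isoperimetric_const_eq (hd : 1 ≤ d) (hθ : 0 < θ) :
    (1 / (2 * θ) * (2 * d) ^ (θ / (d + θ)) + (1 / (2 * d)) ^ ((d : ℝ) / (d + θ))) ^ ((d + θ) / d) =
      (d / θ + 1) ^ ((d + θ) / d) / (2 * d) := by
  have hd0 : (0 : ℝ) < d := by exact_mod_cast hd
  have h1 : (2 * (d : ℝ)) ^ (θ / (d + θ)) = 2 * d * (1 / (2 * d)) ^ ((d : ℝ) / (d + θ)) := by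
    rw [one_div, Real.inv_rpow (by positivity), ← Real.rpow_neg (by positivity)]
    nth_rewrite 2 [← Real.rpow_one (2 * (d : ℝ))]
    rw [← Real.rpow_add (by positivity)]
    congr 1
    field_simp
    ring
  have h2 : 1 / (2 * θ) * (2 * d) ^ (θ / (d + θ)) + (1 / (2 * d)) ^ ((d : ℝ) / (d + θ)) =
      (d / θ + 1) * (1 / (2 * (d : ℝ))) ^ ((d : ℝ) / (d + θ)) := by
    rw [h1]
    field_simp
  have h3 : ((d : ℝ) / (d + θ)) * ((d + θ) / d) = 1 := by field_simp
  rw [h2, Real.mul_rpow (by positivity) (by positivity), ← Real.rpow_mul (by positivity), h3,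
    Real.rpow_one, mul_one_div]

theorem rpow_le_of_forall_scale_real (hd : 1 ≤ d) (hθ : 0 < θ) {v M Q : ℝ} (hv : 0 < v)
    (hM : 0 < M)
    (h : ∀ τ : ℝ, 0 < τ → 2 * v ≤ 2 * (M * ((τ ^ d)⁻¹ * v) * v) + τ ^ θ / θ * Q) :
    v ^ ((d - θ) / d) ≤ (d / θ + 1) ^ ((d + θ) / d) / (2 * d) * M ^ (θ / d) * Q := by
  have hd0 : (0 : ℝ) < d := by exact_mod_cast hd
  set K : ℝ := d / θ + 1 with hK
  have hK0 : 0 < K := by positivity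
  -- The maximiser of `v τ ^ (-θ) - M v ^ 2 τ ^ (-d-θ)` is given by `τ ^ d = K v M`. There the
  -- kernel term is `2 v / K`, leaving the fraction `1 - 1/K` of `2 v` to be bounded by `Q`.
  have hτ : 0 < (K * v * M) ^ (1 / (d : ℝ)) := by positivity
  have h1 := h _ hτ
  have h2 : ((K * v * M) ^ (1 / (d : ℝ))) ^ d = K * v * M := by
    rw [← Real.rpow_natCast, ← Real.rpow_mul (by positivity), one_div_mul_cancel hd0.ne',
      Real.rpow_one]
  have h3 : ((K * v * M) ^ (1 / (d : ℝ))) ^ θ = K ^ (θ / d) * v ^ (θ / d) * M ^ (θ / d) := by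
    rw [← Real.rpow_mul (by positivity), Real.mul_rpow (by positivity) hM.le,
      Real.mul_rpow hK0.le hv.le, one_div_mul_eq_div]
  rw [h2, h3] at h1
  have h4 : M * ((K * v * M)⁻¹ * v) * v = v / K := by field_simp
  rw [h4] at h1
  have h5 : v = v ^ ((d - θ) / d) * v ^ (θ / d) := by
    rw [← Real.rpow_add hv, ← add_div, sub_add_cancel, div_self hd0.ne', Real.rpow_one]
  have h6 : K ^ ((d + θ) / d) = K * K ^ (θ / d) := by
    rw [add_div, div_self hd0.ne', Real.rpow_add hK0, Real.rpow_one]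
  rw [h6]
  have hw : 0 < v ^ (θ / d) := by positivity
  refine le_of_mul_le_mul_right ?_ hw
  rw [← h5]
  have h7 : v - v / K = v * (d / θ) / K := by
    rw [hK]
    field_simp
    ring
  have h8 : 2 * (v * (d / θ) / K) ≤ K ^ (θ / d) * v ^ (θ / d) * M ^ (θ / d) / θ * Q := by
    rw [← h7]
    linarith
  have h9 : v = 2 * (v * (d / θ) / K) * (K * θ / (2 * d)) := by field_simp
  rw [h9]
  refine (mul_le_mul_of_nonneg_right h8 (by positivity)).trans_eq ?_
  field_simp

theorem rpow_le_of_forall_scale (hd : 1 ≤ d) (hθ : 0 < θ) {v M Q : ℝ≥0∞} (hv0 : v ≠ 0)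
    (hv : v ≠ ⊤) (hM0 : M ≠ 0) (hM : M ≠ ⊤)
    (h : ∀ τ : ℝ, 0 < τ → 2 * v ≤ 2 * (M * (ENNReal.ofReal (τ ^ d)⁻¹ * v) * v) +
      ENNReal.ofReal (τ ^ θ / θ) * Q) :
    v ^ ((d - θ) / d) ≤ ENNReal.ofReal ((d / θ + 1) ^ ((d + θ) / d) / (2 * d)) * M ^ (θ / d) * Q := by
  have hd0 : (0 : ℝ) < d := by exact_mod_cast hd
  have hC : 0 < (d / θ + 1) ^ ((d + θ) / d) / (2 * d) := by positivity
  -- For infinite `Q` the right-hand side is infinite because the other factors do not vanish;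
  -- otherwise everything is real.
  rcases eq_or_ne Q ⊤ with rfl | hQ
  · rw [ENNReal.mul_top]
    · exact le_top
    · refine mul_ne_zero (by simpa using hC) ?_
      simp [ENNReal.rpow_eq_zero_iff, hM0, hM]
  lift v to NNReal using hv
  lift M to NNReal using hM
  lift Q to NNReal using hQ
  have hv' : (0 : ℝ) < v := by
    have : v ≠ 0 := by simpa using hv0
    positivity
  have hM' : (0 : ℝ) < M := by
    have : M ≠ 0 := by simpa using hM0
    positivity
  have key := rpow_le_of_forall_scale_real hd hθ hv' hM' (Q := Q) fun τ hτ => by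
    have h1 := ENNReal.toReal_mono (by finiteness) (h τ hτ)
    rw [ENNReal.toReal_add (by finiteness) (by finiteness)] at h1
    simpa [ENNReal.toReal_mul, ENNReal.toReal_ofReal,
      (by positivity : 0 ≤ τ ^ θ / θ), (by positivity : 0 ≤ τ ^ d)] using h1
  have h2 := ENNReal.ofReal_le_ofReal key
  rw [ENNReal.ofReal_mul (by positivity), ENNReal.ofReal_mul hC.le,
    ← ENNReal.ofReal_rpow_of_pos hv', ← ENNReal.ofReal_rpow_of_pos hM'] at h2
  simpa using h2

end Optimization

/-! ### Comparison with the stated constants, and their finiteness -/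

section Isoperimetric

variable {d : ℕ} {α : ℝ}

/-- The optimised constant lacks the factor `2 ^ ((α - 1) / α)`, which is at least one: the stated
constant has slack. -/
theorem le_isoConstFrac (hd : 1 ≤ d) (h1 : 1 < α) (p : RSpace d → ℝ) :
    ENNReal.ofReal ((d / (α - 1) + 1) ^ ((d + (α - 1)) / d) / (2 * d)) *
      (⨆ x, ‖p x‖ₑ) ^ ((α - 1) / d) * ∫⁻ x, ‖gradient p x‖ₑ ≤ isoConstFrac α p := by
  have hθ : 0 < α - 1 := by linarith
  rw [isoConstFrac, ← isoperimetric_const_eq hd hθ]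
  simp only [← add_sub_assoc]
  gcongr
  refine le_mul_of_one_le_right (Real.rpow_nonneg ?_ _) ?_
  · have : 0 < d + α - 1 := by
      have : (0 : ℝ) ≤ d := by positivity
      linarith
    positivity
  · exact Real.one_le_rpow one_le_two (div_nonneg hθ.le (by linarith))

theorem le_isoConstClass (hd : 1 ≤ d) (h1 : 1 < α) (p : RSpace d → ℝ) (m : ℝ≥0∞) :
    ENNReal.ofReal ((d / 1 + 1) ^ (((d : ℝ) + 1) / d) / (2 * d)) *
      (⨆ x, ‖p x‖ₑ) ^ ((1 : ℝ) / d) * m ≤ isoConstClass α p m := by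
  rw [isoConstClass, ← isoperimetric_const_eq hd one_pos, mul_one, Real.div_rpow zero_le_one
    (by positivity), Real.one_rpow]
  gcongr
  refine le_mul_of_one_le_right (Real.rpow_nonneg (by positivity) _) ?_
  exact Real.one_le_rpow one_le_two (by positivity)

theorem isoConstFrac_lt_top (h1 : 1 < α) {p : RSpace d → ℝ} (hp : ⨆ x, ‖p x‖ₑ < ⊤)
    (hg : ∫⁻ x, ‖gradient p x‖ₑ < ⊤) : isoConstFrac α p < ⊤ :=
  ENNReal.mul_lt_top (ENNReal.mul_lt_top ENNReal.ofReal_lt_top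
    (ENNReal.rpow_lt_top_of_nonneg (div_nonneg (by linarith) (by positivity)) hp.ne)) hg

theorem isoConstClass_lt_top {p : RSpace d → ℝ} (hp : ⨆ x, ‖p x‖ₑ < ⊤) {m : ℝ≥0∞}
    (hm : m < ⊤) : isoConstClass α p m < ⊤ :=
  ENNReal.mul_lt_top (ENNReal.mul_lt_top ENNReal.ofReal_lt_top
    (ENNReal.rpow_lt_top_of_nonneg (by positivity) hp.ne)) hm

end Isoperimetric

end

/-! ### The isoperimetric inequalities -/

theorem mainTheorem3 {d : ℕ} (hd : 1 ≤ d) {α : ℝ} (hα1 : 1 < α) (hα2 : α < 2)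
    (ν μ : Measure (RSpace d)) (hν : IsStableLevyMeasure α ν) (hsymm : IsSymmetricLevy α ν)
    (hnd : IsNondegenerateLevy α ν) (hμ : IsStableLaw ν μ)
    {Ω : Type*} [MeasurableSpace Ω] (P : Measure Ω) [IsProbabilityMeasure P]
    (Y : Ω → ℝ) (hY : Measurable Y)
    (hYchar : ∀ ξ : ℝ, ∫ ω, Complex.exp (Complex.I * (ξ * Y ω : ℝ)) ∂P =
      Complex.exp (-(|ξ| ^ α : ℝ))) :
    ∃ p : RSpace d → ℝ, ContDiff ℝ 1 p ∧ (∀ x, 0 < p x) ∧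
      μ = volume.withDensity (fun x => ENNReal.ofReal (p x)) ∧
      isoConstFrac α p < ∞ ∧ isoConstClass α p (∫⁻ ω, ‖Y ω‖ₑ ∂P) < ∞ ∧
      ∀ E : Set (RSpace d), MeasurableSet E → volume E < ∞ →
        Tendsto (fracVariation α ν μ E) (𝓝[>] 0) (𝓝 (fracPerimeter α ν μ E)) ∧
        Tendsto (classVariation α ν μ E) (𝓝[>] 0) (𝓝 (classPerimeter α ν μ E)) ∧
        volume E ^ (((d : ℝ) - (α - 1)) / d) ≤ isoConstFrac α p * fracPerimeter α ν μ E ∧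
        (2 ≤ d ∨ 0 < volume E →
          volume E ^ (((d : ℝ) - 1) / d) ≤
            isoConstClass α p (∫⁻ ω, ‖Y ω‖ₑ ∂P) * classPerimeter α ν μ E) := by
  have hd0 : (1 : ℝ) ≤ d := by exact_mod_cast hd
  have hα0 : 0 < α := by linarith
  have hθ : 0 < α - 1 := by linarith
  have hp := stableLaw_eq_withDensity hα1 hα2 hν hsymm hnd hμ one_pos
  rw [stableLaw_one] at hp
  have hpos := stableDensity_pos hα1 hα2 hν hsymm hnd hμ
  have hM := iSup_stableDensity_lt_top hα1 hα2 hν hsymm hnd hμ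
  have hm := lintegral_enorm_stable_lt_top hα1 hα2 hY hYchar
  have hM0 : ⨆ x, ‖stableDensity ν 1 x‖ₑ ≠ 0 := by
    refine (lt_of_lt_of_le ?_ (le_iSup (fun x => ‖stableDensity ν 1 x‖ₑ) 0)).ne'
    exact enorm_pos.2 (hpos 0).ne'
  refine ⟨stableDensity ν 1, (fourierRep_stableDensity hα1 hα2 hν hsymm hnd hμ one_pos).contDiff,
    hpos, hp, isoConstFrac_lt_top hα1 hM
      (lintegral_gradient_stableDensity_lt_top hd hα1 hα2 hν hsymm hnd),
    isoConstClass_lt_top hM hm, fun E hE hEf => ?_⟩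
  have hVf : ∀ s t : ℝ, 0 ≤ s → 0 < t → fracVariation α ν μ E (s + t) ≤ fracVariation α ν μ E t :=
    fun s t hs ht => fracVariation_add_le hα1 hα2 hν hsymm hnd hμ hE hEf hs ht
  have hVc : ∀ s t : ℝ, 0 ≤ s → 0 < t → classVariation α ν μ E (s + t) ≤ classVariation α ν μ E t :=
    fun s t hs ht => classVariation_add_le hα1 hα2 hν hsymm hnd hμ hY hYchar hE hEf hs ht
  -- The optimisation runs over the length scale `τ`, at time `t = τ ^ α`.
  have hscale : ∀ τ : ℝ, 0 < τ → (τ ^ α) ^ (1 / α) = τ := fun τ hτ => by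
    rw [← Real.rpow_mul hτ.le, mul_one_div_cancel hα0.ne', Real.rpow_one]
  refine ⟨tendsto_limUnder_of_antitone hVf, tendsto_limUnder_of_antitone hVc, ?_, ?_⟩
  · rcases eq_or_ne (volume E) 0 with h0 | h0
    -- The exponent is positive in every dimension because `α - 1 < 1 ≤ d`.
    · rw [h0, ENNReal.zero_rpow_of_pos (div_pos (by linarith) (by linarith))]
      exact zero_le
    refine (rpow_le_of_forall_scale hd hθ h0 hEf.ne hM0 hM.ne
      (Q := (∫⁻ x, ‖gradient (stableDensity ν 1) x‖ₑ) * fracPerimeter α ν μ E)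
      fun τ hτ => ?_).trans ?_
    · have hτα : 0 < τ ^ α := by positivity
      have h3 := two_mul_volume_le hα1 hμ.1 hp hE hEf hτα fun s hs =>
        (lintegral_semigroup_sub_le_frac hd hα1 hα2 hν hsymm hnd hμ hE hEf hs hτα.le).trans
          (mul_le_mul_right (mul_le_mul_right (le_limUnder_of_antitone hVf hs) _) _)
      rwa [hscale τ hτ, ← Real.rpow_mul hτ.le, mul_div_cancel₀ _ hα0.ne'] at h3
    · rw [← mul_assoc]
      exact mul_le_mul_left (le_isoConstFrac hd hα1 _) _
  · intro hcond
    rcases eq_or_ne (volume E) 0 with h0 | h0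
    -- For `d = 1` the exponent is `0` and `0 ^ 0 = 1`, so null sets must be excluded there; for `d
    -- ≥ 2` the left-hand side vanishes.
    · have h2 : 2 ≤ d := hcond.resolve_right (by simp [h0])
      have h2' : (2 : ℝ) ≤ d := by exact_mod_cast h2
      rw [h0, ENNReal.zero_rpow_of_pos (div_pos (by linarith) (by linarith))]
      exact zero_le
    refine (rpow_le_of_forall_scale hd one_pos h0 hEf.ne hM0 hM.ne
      (Q := (∫⁻ ω, ‖Y ω‖ₑ ∂P) * classPerimeter α ν μ E) fun τ hτ => ?_).trans ?_
    · have hτα : 0 < τ ^ α := by positivity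
      have h3 := two_mul_volume_le hα1 hμ.1 hp hE hEf hτα fun s hs =>
        (lintegral_semigroup_sub_le_class hα1 hα2 hν hsymm hnd hμ hY hYchar hE hEf hs hτα.le).trans
          (mul_le_mul_right (mul_le_mul_left (le_limUnder_of_antitone hVc hs) _) _)
      rw [hscale τ hτ, mul_comm (limUnder _ _)] at h3
      rwa [Real.rpow_one, div_one]
    · rw [← mul_assoc]
      exact mul_le_mul_left (le_isoConstClass hd hα1 _ _) _
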